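/- Let $K$ be a number field, let $n\ge 2$ and $m$ be integers, and let $G\subset S_n$ be a transitive subgroup. For $g\in S_n$ put $\mathrm{ind}(g)=n-\#\{\text{orbits of } g \text{ on } \{1,\dots,n\}\}$ and $\mathrm{ind}(G)=\min\{\mathrm{ind}(g): 1\ne g\in G\}$, and assume $m\cdot\mathrm{ind}(G)\ge 2$. Let $Y=(\mathbb P^m_K)^n$ with projections $p_i:Y\to\mathbb P^m_K$ and with $G$ permuting the factors, let $\pi:Y\to X=Y/G$ be the quotient variety, and let $X^\circ\subset X$ be the largest open subvariety over which $\pi$ is unramified, with preimage $Y^\circ\subset Y$. The set of primitive $K$-points of $X$ is $$X(K)^{\mathrm{prim}}=X^\circ(K)\setminus\bigcup_{H\subsetneq G}\mathrm{Im}\big((Y^\circ/H)(K)\to X^\circ(K)\big),$$ the union running over the proper subgroups $H$ of $G$. For a number field $F$ and $x=(x_0:\cdots:x_m)\in\mathbb P^m(F)$ let $$H(x)=\prod_{v}\max_i\|x_i\|_v^{\,m+1},$$ the product over all places $v$ of $F$, with $\|a\|_v=|N_{F_v/\mathbb Q_p}(a)|_p$ where $p$ is the place of $\mathbb Q$ below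 $v$; this is the height for the anticanonical divisor $-K_{\mathbb P^m}$ with its standard metric. Give $-K_X$ the metric for which $\pi^*(-K_X)=\sum_{i=1}^n p_i^*(-K_{\mathbb P^m})$ as metrized divisors, and let $H$ also denote the resulting height on $X(K)$. Thus $H(x)=\big(\prod_v\|f(x)\|_v^{-1}\big)^{1/\#G}$, the product over all places $v$ of $K$, where $f$ is any section of $\mathcal O_X(-\#G\cdot K_X)$, that is, any $G$-invariant form on $Y$ of multidegree $(\#G(m+1),\dots,\#G(m+1))$, with $f(x)\ne0$. A large $G$-field over $K$ is a Galois extension $L/K$ together with an isomorphism $\mathrm{Gal}(L/K)\cong G$; an isomorphism of large $G$-fields is a $G$-equivariant $K$-isomorphism, and $G\text{-}\mathrm{Fie}(K)$ denotes the set of isomorphism classes. Let $G_1\subset G$ be the stabilizer of $1\in\{1,\dots,n\}$. A point $x\in\mathbb P^m(L^{G_1})$ is called original if $x\notin\mathbb P^m(L^{\langle G_1,N\rangle})$ for every nontrivial normal subgroup $N$ of $G$; the set of original points is denoted $\mathbb P^m(L^{G_1})^{\mathrm{orig}}$. For a set $U$ of points with a height $H$, the height zeta function of $U$ is $Z_U(s)=\sum_{x\in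 U}H(x)^{-s}$. Let $s\in\mathbb C$ be such that the series $Z_{X(K)^{\mathrm{prim}}}(s)$ converges absolutely. Then for every $L\in G\text{-}\mathrm{Fie}(K)$ the series $Z_{\mathbb P^m(L^{G_1})^{\mathrm{orig}}}(s)$ converges absolutely, the sum of these values over $L$ converges absolutely, and $$Z_{X(K)^{\mathrm{prim}}}(s)=\frac{1}{\#Z(G)}\sum_{L\in G\text{-}\mathrm{Fie}(K)}Z_{\mathbb P^m(L^{G_1})^{\mathrm{orig}}}(s),$$ where $Z(G)$ is the center of $G$. -/

import Mathlib

open CategoryTheory AlgebraicGeometry Limits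

universe u

noncomputable section

namespace PermQuot

/-! ### The power of projective space and the permutation action -/

section Geometry

variable (K : Type u) [Field K] (m n : ℕ)

attribute [local instance] MvPolynomial.gradedAlgebra

/-- The projective space `ℙ^m` over `K`, as a scheme over `Spec K`. -/
def projSpace : Over (Spec (CommRingCat.of K)) :=
  Over.mk (Proj.toSpecZero (MvPolynomial.homogeneousSubmodule (Fin (m + 1)) K) ≫
    Spec.map (CommRingCat.ofHom
      (algebraMap K (MvPolynomial.homogeneousSubmodule (Fin (m + 1)) K 0))))

/-- `Y = (ℙ^m)^n`, the `n`-fold fibre power over `Spec K`. -/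
abbrev projPower : Over (Spec (CommRingCat.of K)) :=
  ∏ᶜ fun _ : Fin n => projSpace K m

/-- The left action of the symmetric group on `(ℙ^m)^n` by permuting the factors:
`(σ y)_i = y_{σ⁻¹ i}` (in `End`, the product `f * g` is `g` followed by `f`). -/
def permAction : Equiv.Perm (Fin n) →* End (projPower K m n) where
  toFun σ := Pi.lift fun i : Fin n => Pi.π (fun _ : Fin n => projSpace K m) (σ⁻¹ i)
  map_one' := by
    refine Pi.hom_ext _ _ fun i => ?_
    simp [End.one_def]
  map_mul' σ τ := by
    refine Pi.hom_ext _ _ fun i => ?_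
    simp [End.mul_def]

variable {K m n}

/-- `π : Y ⟶ X` is the quotient of `Y` by the operators `act h`: it is affine and invariant, and
`𝒪_X` is the sheaf of invariants `(π_* 𝒪_Y)^H`. -/
structure IsQuotientBy {S : Scheme.{u}} {Y X : Over S} {H : Type*} (act : H → (Y ⟶ Y))
    (π : Y ⟶ X) : Prop where
  invariant : ∀ h, act h ≫ π = π
  isAffineHom : IsAffineHom π.left
  sections : ∀ (U : X.left.Opens) (s : Γ(Y.left, π.left ⁻¹ᵁ U)),
    (∀ (h : H) (e : π.left ⁻¹ᵁ U ≤ (act h).left ⁻¹ᵁ (π.left ⁻¹ᵁ U)),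
      (act h).left.appLE (π.left ⁻¹ᵁ U) (π.left ⁻¹ᵁ U) e s = s) →
    ∃! t : Γ(X.left, U), π.left.app U t = s

variable (K m n) in
/-- The quotient varieties `Y/H` of `Y = (ℙ^m)^n` by the subgroups `H` of the symmetric group,
with the quotient morphisms `Y ⟶ Y/H` and the induced morphisms `Y/H ⟶ Y/H'` for `H ≤ H'`.
All of this is determined by `Y` up to unique isomorphism, and it exists because `Y` is
projective and the groups are finite. -/
structure PermQuotients where
  /-- the quotient variety `Y/H` -/
  quot : Subgroup (Equiv.Perm (Fin n)) → Over (Spec (CommRingCat.of K))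
  /-- the quotient morphism `Y ⟶ Y/H` -/
  proj : ∀ H, projPower K m n ⟶ quot H
  isQuotientBy : ∀ H : Subgroup (Equiv.Perm (Fin n)), IsQuotientBy (fun σ : H => permAction K m n σ.1) (proj H)
  /-- the induced morphism `Y/H ⟶ Y/H'` -/
  desc : ∀ {H H' : Subgroup (Equiv.Perm (Fin n))}, H ≤ H' → (quot H ⟶ quot H')
  proj_desc : ∀ {H H' : Subgroup (Equiv.Perm (Fin n))} (h : H ≤ H'), proj H ≫ desc h = proj H'

/-- The set `X(K)` of `K`-points of a scheme `X` over `K`. -/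
abbrev RatPoint (X : Over (Spec (CommRingCat.of K))) : Type u :=
  Over.mk (𝟙 (Spec (CommRingCat.of K))) ⟶ X

/-- The largest open subscheme `X°` of `X` over which `π : Y ⟶ X` is unramified (being unramified
is local on the target, and for morphisms locally of finite type it is the same as being formally
unramified). -/
def unramifiedLocus {S : Scheme.{u}} {Y X : Over S} (π : Y ⟶ X) : X.left.Opens :=
  sSup {U | FormallyUnramified (π.left ∣_ U)}

/-- The primitive `K`-points of `X = Y/G`: the `K`-points of `X°` that are not the image of a
`K`-point of `Y/H` (equivalently, of `Y°/H`, the preimage of `X°` in `Y/H`) for any proper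
subgroup `H` of `G`. -/
def primPoints (Q : PermQuotients K m n) (G : Subgroup (Equiv.Perm (Fin n))) :
    Set (RatPoint (Q.quot G)) :=
  {x | (∀ p, x.left p ∈ unramifiedLocus (Q.proj G)) ∧
    ∀ (H : Subgroup (Equiv.Perm (Fin n))) (hH : H < G),
      ¬ ∃ z : RatPoint (Q.quot H), z ≫ Q.desc hH.le = x}

/-! ### Points with given homogeneous coordinates -/

/-- `Spec F` as a scheme over `Spec K`. -/
def specOver (K F : Type u) [Field K] [Field F] [Algebra K F] : Over (Spec (CommRingCat.of K)) :=
  Over.mk (Spec.map (CommRingCat.ofHom (algebraMap K F)))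

variable {F : Type u} [Field F] [Algebra K F]

/-- Evaluation of polynomials at `v`, with values in the global functions on `Spec F`. -/
def evalHom (v : Fin (m + 1) → F) :
    MvPolynomial (Fin (m + 1)) K →+* Γ(Spec (CommRingCat.of F), ⊤) :=
  (Scheme.ΓSpecIso (CommRingCat.of F)).inv.hom.comp
    (MvPolynomial.aeval v : MvPolynomial (Fin (m + 1)) K →ₐ[K] F).toRingHom

theorem map_irrelevant_evalHom {v : Fin (m + 1) → F} (hv : v ≠ 0) :
    (HomogeneousIdeal.irrelevant
      (MvPolynomial.homogeneousSubmodule (Fin (m + 1)) K)).toIdeal.map (evalHom v) = ⊤ := by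
  obtain ⟨j, hj⟩ := Function.ne_iff.mp hv
  refine Ideal.eq_top_of_isUnit_mem _ (Ideal.mem_map_of_mem (evalHom v) (x := MvPolynomial.X j) ?_) ?_
  · exact HomogeneousIdeal.mem_irrelevant_of_mem _ Nat.one_pos
      (MvPolynomial.isHomogeneous_X K j)
  · have h : evalHom (K := K) v (MvPolynomial.X j) =
        (Scheme.ΓSpecIso (CommRingCat.of F)).inv.hom (v j) := by
      simp [evalHom]
    rw [h]
    exact (IsUnit.mk0 _ hj).map _

/-- The `F`-point `(v_0 : ⋯ : v_m)` of `ℙ^m`. -/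
def coordPoint (v : Fin (m + 1) → F) (hv : v ≠ 0) : specOver K F ⟶ projSpace K m :=
  Over.homMk (Proj.fromOfGlobalSections _ (evalHom v) (map_irrelevant_evalHom hv)) (by
    simp only [projSpace, specOver, Over.mk_hom, Proj.fromOfGlobalSections_toSpecZero_assoc]
    rw [← Spec.map_comp, ← CommRingCat.ofHom_comp]
    have h : CommRingCat.ofHom (((evalHom v).comp
        (algebraMap (MvPolynomial.homogeneousSubmodule (Fin (m + 1)) K 0)
          (MvPolynomial (Fin (m + 1)) K))).comp
        (algebraMap K (MvPolynomial.homogeneousSubmodule (Fin (m + 1)) K 0))) =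
        CommRingCat.ofHom (algebraMap K F) ≫ (Scheme.ΓSpecIso (CommRingCat.of F)).inv := by
      ext a
      simp only [CommRingCat.hom_comp, CommRingCat.hom_ofHom, RingHom.comp_apply, evalHom]
      congr 1
      exact (MvPolynomial.aeval v : MvPolynomial (Fin (m + 1)) K →ₐ[K] F).commutes a
    rw [h, Spec.map_comp]
    exact (toSpecΓ_SpecMap_ΓSpecIso_inv_assoc (CommRingCat.of F) _))

/-- The `F`-point of `(ℙ^m)^n` whose `i`-th component is `(y_{i0} : ⋯ : y_{im})`. -/
def coordPowerPoint (y : Fin n → Fin (m + 1) → F) (hy : ∀ i, y i ≠ 0) :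
    specOver K F ⟶ projPower K m n :=
  Pi.lift fun i => coordPoint (y i) (hy i)

/-- `y` gives multihomogeneous coordinates of a geometric point of `(ℙ^m)^n` lying over the
`K`-point `x` of `(ℙ^m)^n / G`. -/
def IsLift (Q : PermQuotients K m n) (G : Subgroup (Equiv.Perm (Fin n)))
    (x : RatPoint (Q.quot G)) (y : Fin n → Fin (m + 1) → AlgebraicClosure K) : Prop :=
  ∃ hy : ∀ i, y i ≠ 0,
    coordPowerPoint y hy ≫ Q.proj G = Over.mkIdTerminal.from (specOver K _) ≫ x

end Geometry

/-! ### Metrics and heights on the quotient -/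

section Height

variable {K : Type u} [Field K] {m n : ℕ}

/-- Multihomogeneous forms on `(ℙ^m)^n` of multidegree `(d, …, d)` that are invariant under `G`:
the global sections of the line bundle on `X = (ℙ^m)^n / G` whose pullback to `(ℙ^m)^n` is
`⨂ p_i^* 𝒪(d)`. -/
def invForms (K : Type u) [Field K] (m : ℕ) {n : ℕ} (G : Subgroup (Equiv.Perm (Fin n))) (d : ℕ) :
    Set (MvPolynomial (Fin n × Fin (m + 1)) K) :=
  {f | (∀ c ∈ f.support, ∀ i, ∑ j, c (i, j) = d) ∧
    ∀ σ ∈ G, MvPolynomial.rename (fun p => (σ p.1, p.2)) f = f}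

/-- The value of a form at a tuple of homogeneous coordinates. -/
def evalForm (f : MvPolynomial (Fin n × Fin (m + 1)) K)
    (y : Fin n → Fin (m + 1) → AlgebraicClosure K) : AlgebraicClosure K :=
  MvPolynomial.aeval (fun p : Fin n × Fin (m + 1) => y p.1 p.2) f

/-- The norm at the point `y` of a form `f` of multidegree `(d, …, d)`, for the tensor product of
the pullbacks of the standard metric of `𝒪(d)`, i.e. `‖ℓ(y)‖ = |ℓ(y)| / max_j |y_j|` for linear
forms `ℓ`. -/
def upstairsNorm (w : AbsoluteValue (AlgebraicClosure K) ℝ) (d : ℕ)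
    (f : MvPolynomial (Fin n × Fin (m + 1)) K)
    (y : Fin n → Fin (m + 1) → AlgebraicClosure K) : ℝ :=
  w (evalForm f y) / ∏ i, (⨆ j, w (y i j)) ^ d

/-- The norm `‖f(x)‖_v` at a place `v` for the metric that pulls back to the one on `(ℙ^m)^n`:
it is the norm of `f` at any geometric point of `(ℙ^m)^n` over `x`, for any extension `w` of `v`
to the algebraic closure. The value does not depend on these choices. -/
def localNorm (Q : PermQuotients K m n) (G : Subgroup (Equiv.Perm (Fin n)))
    (v : AbsoluteValue K ℝ) (d : ℕ) (f : MvPolynomial (Fin n × Fin (m + 1)) K)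
    (x : RatPoint (Q.quot G)) : ℝ :=
  Classical.epsilon fun t : ℝ =>
    ∃ w : AbsoluteValue (AlgebraicClosure K) ℝ, (∀ a, w (algebraMap K _ a) = v a) ∧
      ∃ y, IsLift Q G x y ∧ t = upstairsNorm w d f y

open Height in
/-- The height `H(x)` of a `K`-point `x` of `X = (ℙ^m)^n / G` for the metrized anticanonical
divisor with `π^*(-K_X) = ∑ p_i^*(-K_{ℙ^m})` as metrized divisors, where `-K_{ℙ^m}` is metrized
through `𝒪(-K_{ℙ^m}) = 𝒪(m + 1)`. For `r = #G`, the divisor `-r K_X` is Cartier and the forms in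
`invForms K m G (r (m + 1))` are its global sections, so
`H(x) = (∏_v ‖f(x)‖_v⁻¹)^(1/r)` for any such `f` with `f(x) ≠ 0`; archimedean places are counted
with multiplicity. By the product formula the value does not depend on `f`. -/
def quotHeight [NumberField K] (Q : PermQuotients K m n) (G : Subgroup (Equiv.Perm (Fin n)))
    (x : RatPoint (Q.quot G)) : ℝ :=
  Classical.epsilon fun t : ℝ =>
    ∃ f ∈ invForms K m G (Nat.card G * (m + 1)),
      (∃ y, IsLift Q G x y ∧ evalForm f y ≠ 0) ∧
      t = (((AdmissibleAbsValues.archAbsVal (K := K)).map fun v =>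
              (localNorm Q G v (Nat.card G * (m + 1)) f x)⁻¹).prod *
            ∏ᶠ v : AdmissibleAbsValues.nonarchAbsVal (K := K),
              (localNorm Q G v.1 (Nat.card G * (m + 1)) f x)⁻¹) ^ ((Nat.card G : ℝ)⁻¹)

end Height

/-! ### Large `G`-fields and original points -/

section Fields

/-- A large `G`-field over `K`: a finite Galois extension `L/K` with an isomorphism
`G ≃ Gal(L/K)`. -/
structure LargeGField (K : Type u) [Field K] (G : Type*) [Group G] where
  carrier : Type u
  [field : Field carrier]
  [algebra : Algebra K carrier]
  [finiteDimensional : FiniteDimensional K carrier]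
  [isGalois : IsGalois K carrier]
  galEquiv : G ≃* Gal(carrier/K)

attribute [instance] LargeGField.field LargeGField.algebra LargeGField.finiteDimensional
  LargeGField.isGalois

variable {K : Type u} [Field K] {G : Type*} [Group G]

/-- Two large `G`-fields are isomorphic if there is a `G`-equivariant `K`-isomorphism. -/
instance LargeGField.setoid (K : Type u) [Field K] (G : Type*) [Group G] :
    Setoid (LargeGField K G) where
  r L L' := ∃ φ : L.carrier ≃ₐ[K] L'.carrier,
    ∀ (g : G) (a : L.carrier), φ (L.galEquiv g a) = L'.galEquiv g (φ a)
  iseqv :=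
    { refl := fun _ => ⟨AlgEquiv.refl, fun _ _ => rfl⟩
      symm := by
        rintro L L' ⟨φ, h⟩
        refine ⟨φ.symm, fun g a => ?_⟩
        apply φ.injective
        simp [h]
      trans := by
        rintro L L' L'' ⟨φ, h⟩ ⟨ψ, h'⟩
        exact ⟨φ.trans ψ, fun g a => by simp [h, h']⟩ }

/-- The set of isomorphism classes of large `G`-fields over `K`. -/
def LargeGFieldClass (K : Type u) [Field K] (G : Type*) [Group G] :=
  Quotient (LargeGField.setoid K G)

/-- The subfield `L^H` fixed by a subgroup `H` of `G`. -/
def LargeGField.fixed (L : LargeGField K G) (H : Subgroup G) : IntermediateField K L.carrier :=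
  IntermediateField.fixedField (H.map L.galEquiv.toMonoidHom)

instance [NumberField K] (L : LargeGField K G) (H : Subgroup G) : NumberField (L.fixed H) :=
  NumberField.of_module_finite K (L.fixed H)

/-- For a stabilizer `S = G_i` of a permutation group `G`, the original points of `ℙ^m(L^S)`:
those that, for every nontrivial normal subgroup `N` of `G`, do not lie in `ℙ^m(L^⟨S, N⟩)`,
i.e. have no homogeneous coordinates in `L^⟨S, N⟩`. -/
def LargeGField.origPoints (L : LargeGField K G) (S : Subgroup G) (m : ℕ) :
    Set (Projectivization (L.fixed S) (Fin (m + 1) → L.fixed S)) :=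
  {x | ∀ N : Subgroup G, N.Normal → N ≠ ⊥ →
    ¬ ∃ (v : Fin (m + 1) → L.fixed S) (hv : v ≠ 0),
      (∀ j, (v j : L.carrier) ∈ L.fixed (S ⊔ N)) ∧ Projectivization.mk _ v hv = x}

/-- The height of a point of `ℙ^m(F)` for the metrized anticanonical divisor of `ℙ^m`:
`H(x) = ∏_v max_i ‖x_i‖_v ^ (m + 1)`, the product over the places of `F`. -/
def projHeight {F : Type*} [Field F] [NumberField F] {m : ℕ}
    (x : Projectivization F (Fin (m + 1) → F)) : ℝ :=
  x.mulHeight ^ (m + 1)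

end Fields

/-! ### Height zeta functions and the index -/

/-- The series defining the height zeta function of `U` converges absolutely at `s`. -/
def ZetaSummable {α : Type*} (U : Set α) (H : α → ℝ) (s : ℂ) : Prop :=
  Summable fun x : U => ‖((H x : ℝ) : ℂ) ^ (-s)‖

/-- The height zeta function `Z_U(s) = ∑_{x ∈ U} H(x)^{-s}`. -/
def heightZeta {α : Type*} (U : Set α) (H : α → ℝ) (s : ℂ) : ℂ :=
  ∑' x : U, ((H x : ℝ) : ℂ) ^ (-s)

/-- The index of a permutation: `n` minus its number of orbits on `Fin n`. -/
def permIndex {n : ℕ} (g : Equiv.Perm (Fin n)) : ℕ :=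
  n - Nat.card (MulAction.orbitRel.Quotient (Subgroup.zpowers g) (Fin n))

/-- The index of a permutation group: the least index of its nontrivial elements. -/
def groupIndex {n : ℕ} (G : Subgroup (Equiv.Perm (Fin n))) : ℕ :=
  sInf {k | ∃ g ∈ G, g ≠ 1 ∧ permIndex g = k}

end PermQuot

end

/-! A primitive point `x` of X = Y/G lifts to a geometric point y = (y_1, ..., y_n) of Y, unique up
to G. Lying in the unramified locus means that y has trivial stabilizer in G
(`IsLift.eq_one_of_mem_unramifiedLocus`, with converse `IsLift.mem_unramifiedLocus`). So each Galois
element τ acts on y as a unique permutation ρ(τ) in G. This ρ is a homomorphism, and it is onto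
because otherwise `x` would come from a rational point of Y/H with H the image of ρ
(`IsLift.exists_galois_hom`). After normalizing coordinates, the field L that they generate is a
large G-field, y_1 is a point of ℙ^m(L^{G_1}), and y consists of its conjugates. Conversely, a point
of ℙ^m(L^{G_1}) together with its conjugates is permuted by Galois through G, and so descends to a
rational point of X.

The elements of G that fix y form a normal subgroup. Hence y_1 is original exactly when y has
trivial stabilizer, which is equivalent to `x` being primitive. Original points over the same `x`
belong to isomorphic G-fields, and within one G-field they differ by an element of Z(G), which acts
freely on them. This gives a bijection from X(K)^prim × Z(G) to the disjoint union of the sets of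
original points (`exists_primPoints_prod_center_equiv`).

Heights match along the bijection (`quotHeight_eq`). At a place of K, the product of the local
factors of all y_i, raised to the order of G_1, is a product over Gal(L/K), which regroups into a
product over the places of L above it. Globally this yields the height of y_1 over L^{G_1}, and the
value of the auxiliary form f disappears by the product formula. The theorem is then a rearrangement
of an absolutely convergent series. -/

open NumberField IsDedekindDomain

/-! ### Extending absolute values, and conjugacy of the extensions. -/

theorem NumberField.FinitePlace.isNontrivial {K : Type*} [Field K] [NumberField K] (v : FinitePlace K) : v.1.IsNontrivial := by
  obtain ⟨x, hx, hx0⟩ := Submodule.exists_mem_ne_zero_of_ne_bot v.maximalIdeal.ne_bot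
  refine ⟨algebraMap _ K x, by simpa using hx0, ne_of_lt ?_⟩
  have := (FinitePlace.norm_lt_one_iff_mem K v.maximalIdeal x).mpr hx
  rwa [FinitePlace.norm_embedding_eq] at this

/-- Over the completion the spectral norm extends the absolute value multiplicatively to the
algebraic closure; it is pulled back along an embedding of the two closures. -/
theorem NumberField.FinitePlace.exists_extension_algebraicClosure {K : Type*} [Field K] [NumberField K] (v : FinitePlace K) :
    ∃ w : AbsoluteValue (AlgebraicClosure K) ℝ, ∀ a, w (algebraMap K _ a) = v a := by
  let P := v.maximalIdeal
  let E := P.adicCompletion K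
  let _ : NontriviallyNormedField E :=
    { (inferInstance : NormedField E) with
      non_trivial := by
        obtain ⟨x, hx⟩ := v.isNontrivial.exists_abv_gt_one
        exact ⟨FinitePlace.embedding P x, by rw [FinitePlace.norm_embedding_eq]; exact hx⟩ }
  have : IsUltrametricDist E := inferInstanceAs (IsUltrametricDist (P.adicCompletion K))
  have : CompleteSpace E := inferInstanceAs (CompleteSpace (P.adicCompletion K))
  let f : MulAlgebraNorm E (AlgebraicClosure E) := spectralMulAlgNorm E (AlgebraicClosure E)
  let _ : Algebra K E := (FinitePlace.embedding P).toAlgebra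
  let φ : AlgebraicClosure K →ₐ[K] AlgebraicClosure E := IsAlgClosed.lift
  refine ⟨⟨⟨fun a => f (φ a), by simp⟩, by simp, ?_, ?_⟩, ?_⟩
  · intro a
    simp
  · intro a b
    simpa using map_add_le_add f (φ a) (φ b)
  · intro a
    change f (φ _) = _
    rw [φ.commutes, IsScalarTower.algebraMap_apply K E (AlgebraicClosure E)]
    refine (spectralNorm_extends _).trans ?_
    exact FinitePlace.norm_embedding_eq v a

theorem NumberField.InfinitePlace.exists_extension_algebraicClosure {K : Type*} [Field K] [NumberField K] (v : InfinitePlace K) :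
    ∃ w : AbsoluteValue (AlgebraicClosure K) ℝ, ∀ a, w (algebraMap K _ a) = v a := by
  let _ : Algebra K ℂ := v.embedding.toAlgebra
  let φ : AlgebraicClosure K →ₐ[K] ℂ := IsAlgClosed.lift
  refine ⟨(InfinitePlace.mk φ.toRingHom).1, fun a => ?_⟩
  change ‖φ _‖ = _
  rw [φ.commutes, RingHom.algebraMap_toAlgebra, InfinitePlace.norm_embedding_eq]

/-- Two absolute values on a Galois extension that restrict to the same nontrivial absolute value are conjugate. -/
theorem AbsoluteValue.exists_galois_conj {K L : Type*} [Field K] [Field L] [Algebra K L] [FiniteDimensional K L] [IsGalois K L]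
    (w w' : AbsoluteValue L ℝ) (h : ∀ a, w (algebraMap K L a) = w' (algebraMap K L a))
    (hw : ∃ a : K, a ≠ 0 ∧ w (algebraMap K L a) ≠ 1) : ∃ g : Gal(L/K), ∀ a, w' a = w (g a) := by
  classical
  by_contra! hne
  let c (u : AbsoluteValue L ℝ) (g : Gal(L/K)) : AbsoluteValue L ℝ := u.comp (f := (g : L →+* L)) g.injective
  have hc : ∀ u g a, c u g a = u (g a) := fun _ _ _ => rfl
  let S : Finset (AbsoluteValue L ℝ) := Finset.univ.image (c w) ∪ Finset.univ.image (c w')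
  have hS : ∀ u ∈ S, ∀ a, u (algebraMap K L a) = w (algebraMap K L a) := by
    intro u hu a
    simp only [S, Finset.mem_union, Finset.mem_image, Finset.mem_univ, true_and] at hu
    obtain ⟨g, rfl⟩ | ⟨g, rfl⟩ := hu
    · simp [hc]
    · simp [hc, h]
  obtain ⟨a₀, ha₀, ha₁⟩ := hw
  have hnt : ∀ u : S, u.1.IsNontrivial := fun u => ⟨algebraMap K L a₀, by simpa using ha₀, by rwa [hS u.1 u.2]⟩
  have hpw : Pairwise fun i j : S => ¬ i.1.IsEquiv j.1 := by
    intro u u' hne' he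
    apply hne'
    obtain ⟨t, ht, htt⟩ := AbsoluteValue.isEquiv_iff_exists_rpow_eq.mp he
    -- Both members restrict to the same nontrivial absolute value of `K`, so the exponent relating
    -- them must be 1. Distinct members of `S` are thus inequivalent and weak approximation applies.
    have ht1 : t = 1 := by
      have h1 := congrFun htt (algebraMap K L a₀)
      simp only [hS _ u.2, hS _ u'.2] at h1
      have hpos : 0 < w (algebraMap K L a₀) := w.pos (by simpa using ha₀)
      exact (Real.rpow_right_inj hpos ha₁).mp (h1.trans (Real.rpow_one _).symm)
    ext a
    have h1 := congrFun htt a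
    simpa [ht1] using h1
  have hd := AbsoluteValue.denseRange_algebraMap_pi hnt hpw
  -- approximate `0` at the conjugates of `w` and `1` at the conjugates of `w'`
  let z : (i : S) → WithAbs i.1 := fun i => if i.1 ∈ Finset.univ.image (c w) then 0 else 1
  obtain ⟨a, ha⟩ := hd.exists_dist_lt z (ε := 1/4) (by norm_num)
  have hi : ∀ i : S, i.1 (WithAbs.equiv i.1 (z i) - a) < 1/4 := by
    intro i
    have := (dist_pi_lt_iff (by norm_num)).mp ha i
    rwa [dist_eq_norm, WithAbs.norm_eq_apply_ofAbs] at this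
  have h0 : ∀ g : Gal(L/K), w (g a) < 1/4 := by
    intro g
    have hm : c w g ∈ Finset.univ.image (c w) := Finset.mem_image_of_mem _ (Finset.mem_univ _)
    have := hi ⟨c w g, Finset.mem_union_left _ hm⟩
    simp only [z, if_pos hm] at this
    simpa [hc] using this
  have h1 : ∀ g : Gal(L/K), 3/4 < w' (g a) := by
    intro g
    have hm : c w' g ∉ Finset.univ.image (c w) := by
      simp only [Finset.mem_image, Finset.mem_univ, true_and, not_exists]
      intro g' hg'
      obtain ⟨b, hb⟩ := hne (g' * g⁻¹)
      apply hb
      have := DFunLike.congr_fun hg' (g⁻¹ b)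
      simp only [hc] at this
      rw [AlgEquiv.mul_apply, this, ← AlgEquiv.mul_apply, mul_inv_cancel]; rfl
    have := hi ⟨c w' g, Finset.mem_union_right _ (Finset.mem_image_of_mem _ (Finset.mem_univ _))⟩
    simp only [z, if_neg hm] at this
    have h2 : c w' g (1 - a) < 1/4 := by simpa using this
    have h4 := (c w' g).add_le (1 - a) a
    simp only [sub_add_cancel, map_one, hc] at h2 h4
    linarith
  -- The norm of `a` lies in `K`, where `w` and `w'` agree, yet each factor on the left is below 1/4
  -- and each factor on the right is above 3/4.
  have hN : ∏ g : Gal(L/K), w (g a) = ∏ g : Gal(L/K), w' (g a) := by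
    rw [← map_prod, ← map_prod, ← Algebra.norm_eq_prod_automorphisms, h]
  have ha0 : a ≠ 0 := by
    rintro rfl
    have := h1 1
    norm_num at this
  exact (Finset.prod_lt_prod_of_nonempty (fun g _ => w.pos (by simpa using ha0))
    (fun g _ => ((h0 g).trans (by norm_num)).trans (h1 g)) Finset.univ_nonempty).ne hN
-- Finite places in an extension: automorphisms and local degrees.
open NumberField IsDedekindDomain

theorem IsDedekindDomain.HeightOneSpectrum.intValuation_eq_of_ringEquiv {A B : Type*} [CommRing A] [IsDedekindDomain A]
    [CommRing B] [IsDedekindDomain B] (e : A ≃+* B) (P : HeightOneSpectrum A) (Q : HeightOneSpectrum B)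
    (h : P.asIdeal = Q.asIdeal.comap e) (a : A) : P.intValuation a = Q.intValuation (e a) := by
  have hmem : ∀ n : ℕ, a ∈ P.asIdeal ^ n ↔ e a ∈ Q.asIdeal ^ n := by
    intro n
    have hQ : P.asIdeal ^ n = (Q.asIdeal ^ n).comap e := by
      rw [h, ← Ideal.map_symm, ← Ideal.map_symm, Ideal.map_pow]
    rw [hQ, Ideal.mem_comap]
  by_cases ha : a = 0
  · simp [ha]
  have hea : e a ≠ 0 := by simpa using ha
  apply le_antisymm
  · rw [Q.intValuation_eq_exp_neg_multiplicity hea, HeightOneSpectrum.intValuation_le_pow_iff_mem, hmem,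
      ← HeightOneSpectrum.intValuation_le_pow_iff_mem, ← Q.intValuation_eq_exp_neg_multiplicity hea]
  · rw [P.intValuation_eq_exp_neg_multiplicity ha, HeightOneSpectrum.intValuation_le_pow_iff_mem, ← hmem,
      ← HeightOneSpectrum.intValuation_le_pow_iff_mem, ← P.intValuation_eq_exp_neg_multiplicity ha]

theorem WithZeroMulInt.toNNReal_pow_base {e : NNReal} (he : e ≠ 0) {n : ℕ} (hn : n ≠ 0) (h : e ^ n ≠ 0) (x : WithZero (Multiplicative ℤ)) :
    WithZeroMulInt.toNNReal h x = WithZeroMulInt.toNNReal he x ^ n := by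
  by_cases hx : x = 0
  · subst hx
    simp [hn]
  · rw [WithZeroMulInt.toNNReal_neg_apply _ hx, WithZeroMulInt.toNNReal_neg_apply _ hx, ← zpow_natCast, ← zpow_natCast, ← zpow_mul, ← zpow_mul, mul_comm]

/-- The preimage of the prime under `g` has a residue field of the same cardinality, so the
normalization is transported along with the valuation. -/
theorem NumberField.FinitePlace.exists_eq_comp {L : Type*} [Field L] [NumberField L] (u : FinitePlace L) (g : L ≃+* L) :
    ∃ u' : FinitePlace L, ∀ x, u' x = u (g x) := by
  let h := RingOfIntegers.mapRingEquiv g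
  let P := u.maximalIdeal
  let P' : HeightOneSpectrum (𝓞 L) := ⟨P.asIdeal.comap h, inferInstance, by
    intro hb
    apply P.ne_bot
    rw [← Ideal.map_comap_of_surjective h h.surjective P.asIdeal, hb, Ideal.map_bot]⟩
  have hN : Ideal.absNorm P'.asIdeal = Ideal.absNorm P.asIdeal := by
    simp only [Ideal.absNorm_apply, Submodule.cardQuot_apply]
    exact Nat.card_congr (Ideal.quotientEquiv P'.asIdeal P.asIdeal h
      (Ideal.map_comap_of_surjective h h.surjective P.asIdeal).symm).toEquiv
  have hint : ∀ a : 𝓞 L, FinitePlace.mk P' (algebraMap (𝓞 L) L a) = u (g (algebraMap (𝓞 L) L a)) := by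
    intro a
    rw [← FinitePlace.norm_embedding_eq u]
    change _ = ‖FinitePlace.embedding P (algebraMap (𝓞 L) L (h a))‖
    rw [FinitePlace.mk_apply, FinitePlace.norm_embedding_int, FinitePlace.norm_embedding_int]
    rw [HeightOneSpectrum.intValuation_eq_of_ringEquiv h P' P rfl]
    congr 3
    simp only [hN]
  refine ⟨FinitePlace.mk P', fun x => ?_⟩
  obtain ⟨a, b, hb, rfl⟩ := IsFractionRing.div_surjective (A := 𝓞 L) x
  simp only [map_div₀, hint]

section
variable {K L : Type*} [Field K] [NumberField K] [Field L] [NumberField L] [Algebra K L]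

/-- The finite place of `K` below a finite place of `L`. -/
noncomputable def NumberField.FinitePlace.below (K : Type*) {L : Type*} [Field K] [NumberField K] [Field L] [NumberField L] [Algebra K L]
    (u : FinitePlace L) : FinitePlace K :=
  FinitePlace.mk ⟨u.maximalIdeal.asIdeal.under (𝓞 K), inferInstance, Ideal.under_ne_bot _ u.maximalIdeal.ne_bot⟩

/-- The local degree, the product of the ramification index and the inertia degree, of a finite place over `K`. -/
noncomputable def NumberField.FinitePlace.localDegree (K : Type*) {L : Type*} [Field K] [NumberField K] [Field L] [NumberField L] [Algebra K L]
    (u : FinitePlace L) : ℕ :=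
  (u.below K).maximalIdeal.asIdeal.ramificationIdx' u.maximalIdeal.asIdeal *
    (u.below K).maximalIdeal.asIdeal.inertiaDeg' u.maximalIdeal.asIdeal

theorem NumberField.FinitePlace.below_asIdeal (u : FinitePlace L) :
    (u.below K).maximalIdeal.asIdeal = u.maximalIdeal.asIdeal.under (𝓞 K) := by
  rw [FinitePlace.below, FinitePlace.maximalIdeal_mk]

instance (u : FinitePlace L) : u.maximalIdeal.asIdeal.LiesOver (u.below K).maximalIdeal.asIdeal :=
  ⟨u.below_asIdeal⟩

theorem NumberField.FinitePlace.below_eq_iff (u : FinitePlace L) (v : FinitePlace K) :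
    u.below K = v ↔ u.maximalIdeal.asIdeal.LiesOver v.maximalIdeal.asIdeal := by
  constructor
  · rintro rfl; infer_instance
  · intro h
    rw [← FinitePlace.maximalIdeal_inj]
    ext1
    rw [FinitePlace.below_asIdeal, h.over]

/-- Finite places are normalized as N(P)^(-ord). Ramification multiplies the order by e, and N(P) =
N(p)^f, which accounts for the exponent ef. -/
theorem NumberField.FinitePlace.apply_algebraMap (u : FinitePlace L) (a : K) :
    u (algebraMap K L a) = u.below K a ^ u.localDegree K := by
  rw [← FinitePlace.norm_embedding_eq u, ← FinitePlace.norm_embedding_eq (u.below K),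
    FinitePlace.norm_embedding', FinitePlace.norm_embedding',
    ← HeightOneSpectrum.valuation_liesOver L (u.below K).maximalIdeal u.maximalIdeal, map_pow]
  have hN := Ideal.absNorm_eq_pow_inertiaDeg'_of_liesOver u.maximalIdeal.asIdeal
    (u.below K).maximalIdeal.asIdeal inferInstance (u.below K).maximalIdeal.ne_bot
  simp only [hN, Nat.cast_pow]
  rw [WithZeroMulInt.toNNReal_pow_base (HeightOneSpectrum.absNorm_ne_zero _) (Ideal.inertiaDeg'_ne_zero _ _), NNReal.coe_pow, NNReal.coe_pow, ← pow_mul, mul_comm]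
  rfl

/-- The identity Σ ef = [L:K], carried over from primes to places. The finite set is part of the
conclusion so that later products over the places above `v` can run over it. -/
theorem NumberField.FinitePlace.sum_localDegree (v : FinitePlace K) :
    ∃ S : Finset (FinitePlace L), (∀ u, u ∈ S ↔ u.below K = v) ∧ ∑ u ∈ S, u.localDegree K = Module.finrank K L := by
  classical
  have := v.maximalIdeal.isMaximal
  have h := Ideal.sum_ramification_inertia (𝓞 L) K L v.maximalIdeal.ne_bot
  have hmem := fun P => IsDedekindDomain.mem_primesOverFinset_iff (B := 𝓞 L) v.maximalIdeal.ne_bot (P := P)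
  let f : FinitePlace L → Ideal (𝓞 L) := fun u => u.maximalIdeal.asIdeal
  have hf : Function.Injective f := fun u u' h => FinitePlace.maximalIdeal_injective (HeightOneSpectrum.ext h)
  have hS : ∀ u, u ∈ (IsDedekindDomain.primesOverFinset v.maximalIdeal.asIdeal (𝓞 L)).preimage f hf.injOn ↔ u.below K = v := by
    intro u
    rw [Finset.mem_preimage, FinitePlace.below_eq_iff, hmem]
    exact ⟨fun h => h.2, fun h => ⟨inferInstance, h⟩⟩
  refine ⟨_, hS, ?_⟩
  rw [← h, ← Finset.sum_preimage f _ hf.injOn]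
  · refine Finset.sum_congr rfl fun u hu => ?_
    rw [hS] at hu
    rw [FinitePlace.localDegree, hu]
  · intro P hP hPf
    obtain ⟨h1, h2⟩ := (hmem P).mp hP
    refine absurd ⟨FinitePlace.mk ⟨P, h1, Ideal.ne_bot_of_liesOver_of_ne_bot v.maximalIdeal.ne_bot P⟩, ?_⟩ hPf
    simp [f, FinitePlace.maximalIdeal_mk]
end
-- Local factors as products over the Galois group.
theorem prod_comp_eq_prod_image_pow {G T M : Type*} [Group G] [Fintype G] [DecidableEq T] [CommMonoid M] (Θ : G → T)
    (hΘ : ∀ g h k, Θ g = Θ h → Θ (g * k) = Θ (h * k)) :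
    ∃ n : ℕ, (Finset.univ.image Θ).card * n = Nat.card G ∧ n = Nat.card {g // Θ g = Θ 1} ∧
      ∀ F : T → M, ∏ g, F (Θ g) = (∏ t ∈ Finset.univ.image Θ, F t) ^ n := by
  classical
  let n := (Finset.univ.filter fun g => Θ g = Θ 1).card
  have hn : ∀ t ∈ Finset.univ.image Θ, (Finset.univ.filter fun g => Θ g = t).card = n := by
    intro t ht
    obtain ⟨k, -, rfl⟩ := Finset.mem_image.mp ht
    -- By `hΘ` right translations permute the fibres of `Θ`, so every fibre has the size of the
    -- fibre through 1.
    refine Finset.card_equiv (Equiv.mulRight k⁻¹) fun g => ?_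
    simp only [Finset.mem_filter, Finset.mem_univ, true_and, Equiv.coe_mulRight]
    exact ⟨fun h => by simpa using hΘ _ _ k⁻¹ h, fun h => by simpa using hΘ _ _ k h⟩
  refine ⟨n, ?_, ?_, fun F => ?_⟩
  · rw [Nat.card_eq_fintype_card, ← Finset.card_univ,
      Finset.card_eq_sum_card_image Θ, Finset.sum_congr rfl hn, Finset.sum_const, smul_eq_mul]
  · rw [Nat.card_eq_fintype_card, Fintype.card_subtype]
  · rw [Finset.prod_comp F Θ, ← Finset.prod_pow]
    exact Finset.prod_congr rfl fun t ht => by rw [hn t ht]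

open NumberField IsDedekindDomain

theorem Real.iSup_rpow {ι : Type*} [Finite ι] [Nonempty ι] (f : ι → ℝ) (hf : ∀ i, 0 ≤ f i) {p : ℝ} (hp : 0 ≤ p) :
    (⨆ i, f i) ^ p = ⨆ i, f i ^ p := by
  have hb : BddAbove (Set.range f) := Set.finite_range f |>.bddAbove
  have hb' : BddAbove (Set.range fun i => f i ^ p) := (Set.finite_range _).bddAbove
  apply le_antisymm
  · obtain ⟨i, hi⟩ := exists_eq_ciSup_of_finite (f := f)
    rw [← hi]
    exact le_ciSup hb' i
  · exact ciSup_le fun i => Real.rpow_le_rpow (hf i) (le_ciSup hb i) hp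

/-- The power `u ^ p` of a finite place is an absolute value. -/
noncomputable def NumberField.FinitePlace.rpow {L : Type*} [Field L] [NumberField L] (u : FinitePlace L) {p : ℝ} (hp : 0 < p) :
    AbsoluteValue L ℝ where
  toFun x := u x ^ p
  map_mul' x y := by rw [map_mul, Real.mul_rpow (apply_nonneg _ _) (apply_nonneg _ _)]
  nonneg' x := Real.rpow_nonneg (apply_nonneg _ _) _
  eq_zero' x := by
    rw [Real.rpow_eq_zero (apply_nonneg _ _) hp.ne', map_eq_zero]
  add_le' x y := by
    -- The ultrametric inequality survives every positive power, while the triangle inequality alone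
    -- would not for `p > 1`.
    have h := u.add_le x y
    have hm : max (u x) (u y) ^ p = max (u x ^ p) (u y ^ p) := by
      rcases le_total (u x) (u y) with h | h
      · rw [max_eq_right h, max_eq_right (Real.rpow_le_rpow (apply_nonneg _ _) h hp.le)]
      · rw [max_eq_left h, max_eq_left (Real.rpow_le_rpow (apply_nonneg _ _) h hp.le)]
    refine (Real.rpow_le_rpow (apply_nonneg _ _) h hp.le).trans ?_
    rw [hm]
    exact max_le_add_of_nonneg (Real.rpow_nonneg (apply_nonneg _ _) _) (Real.rpow_nonneg (apply_nonneg _ _) _)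

theorem NumberField.FinitePlace.rpow_apply {L : Type*} [Field L] [NumberField L] (u : FinitePlace L) {p : ℝ} (hp : 0 < p) (x : L) :
    u.rpow hp x = u x ^ p := rfl

variable {K L : Type*} [Field K] [NumberField K] [Field L] [NumberField L] [Algebra K L]

theorem NumberField.FinitePlace.localDegree_pos (u : FinitePlace L) : 0 < u.localDegree K :=
  Nat.mul_pos (Nat.pos_of_ne_zero (Ideal.IsDedekindDomain.ramificationIdx'_ne_zero_of_liesOver _
    (u.below K).maximalIdeal.ne_bot)) (Nat.pos_of_ne_zero (Ideal.inertiaDeg'_ne_zero _ _))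

/-- With the exponent 1/(ef) the place becomes a true extension of the one below, so that
`AbsoluteValue.exists_galois_conj` can be used. -/
theorem NumberField.FinitePlace.rpow_inv_localDegree (u : FinitePlace L) {n : ℕ} (hn : n = u.localDegree K)
    (hp : 0 < (n : ℝ)⁻¹) (a : K) : u.rpow hp (algebraMap K L a) = u.below K a := by
  rw [FinitePlace.rpow_apply, u.apply_algebraMap, ← hn, ← Real.rpow_natCast, ← Real.rpow_mul (apply_nonneg _ _),
    mul_inv_cancel₀ (inv_pos.mp hp).ne', Real.rpow_one]

theorem Real.rpow_lt_one_iff_lt_one {x p : ℝ} (hx : 0 ≤ x) (hp : 0 < p) : x ^ p < 1 ↔ x < 1 := by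
  rw [← Real.rpow_lt_rpow_iff hx zero_le_one hp, Real.one_rpow]

/-- The integers of absolute value below 1 form the prime, which determines the place. This
criterion does not see powers of absolute values. -/
theorem NumberField.FinitePlace.ext_of_lt_one {u u' : FinitePlace L} (h : ∀ x, u x < 1 ↔ u' x < 1) : u = u' := by
  rw [← FinitePlace.maximalIdeal_inj]
  ext x
  rw [← FinitePlace.norm_lt_one_iff_mem L, ← FinitePlace.norm_lt_one_iff_mem L, FinitePlace.norm_embedding_eq, FinitePlace.norm_embedding_eq, h]

theorem NumberField.FinitePlace.below_eq_of_comp [IsGalois K L] {u u' : FinitePlace L} (g : Gal(L/K)) (h : ∀ x, u x = u' (g x)) :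
    u.below K = u'.below K := by
  apply FinitePlace.ext_of_lt_one
  intro x
  have hu := u.apply_algebraMap x
  rw [h, AlgEquiv.commutes, u'.apply_algebraMap] at hu
  rw [← pow_lt_one_iff_of_nonneg (apply_nonneg _ _) (u.localDegree_pos (K := K)).ne', ← hu, pow_lt_one_iff_of_nonneg (apply_nonneg _ _) u'.localDegree_pos.ne']

theorem NumberField.FinitePlace.exists_galois_conj [IsGalois K L] {u u' : FinitePlace L} (h : u.below K = u'.below K) :
    ∃ g : Gal(L/K), ∀ x, u x = u' (g x) := by
  have hp := fun u : FinitePlace L => inv_pos.mpr (Nat.cast_pos (α := ℝ).mpr (u.localDegree_pos (K := K)))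
  obtain ⟨g, hg⟩ := AbsoluteValue.exists_galois_conj (u'.rpow (hp u')) (u.rpow (hp u)) (K := K)
    (fun a => by rw [u.rpow_inv_localDegree rfl, u'.rpow_inv_localDegree rfl, h]) (by
      obtain ⟨a, ha, ha1⟩ := (u'.below K).isNontrivial
      exact ⟨a, ha, by rw [u'.rpow_inv_localDegree rfl]; exact ha1⟩)
  obtain ⟨u'', hu''⟩ := FinitePlace.exists_eq_comp u' g.toRingEquiv
  -- The exponents in `h1` are not yet known to coincide, so only the conditions "value below 1" are
  -- compared.
  have : u = u'' := by
    apply FinitePlace.ext_of_lt_one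
    intro x
    have h1 := hg x
    rw [FinitePlace.rpow_apply, FinitePlace.rpow_apply] at h1
    rw [hu'', AlgEquiv.coe_ringEquiv, ← Real.rpow_lt_one_iff_lt_one (apply_nonneg _ _) (hp u), h1,
      Real.rpow_lt_one_iff_lt_one (apply_nonneg _ _) (hp u')]
  exact ⟨g, this ▸ hu''⟩

/-- Up to conjugation `w` is u₀^(1/n), with n the local degree. As g runs through the group, each
place above `v` is met n times, n being also the order of the decomposition group, so the exponents
cancel. -/
theorem NumberField.FinitePlace.prod_galois_iSup [IsGalois K L] (v : FinitePlace K) (w : AbsoluteValue L ℝ)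
    (hw : ∀ a, w (algebraMap K L a) = v a) {S : Finset (FinitePlace L)} (hS : ∀ u, u ∈ S ↔ u.below K = v)
    {ι : Type*} [Finite ι] [Nonempty ι] (y : ι → L) :
    ∏ g : Gal(L/K), ⨆ j, w (g (y j)) = ∏ u ∈ S, ⨆ j, u (y j) := by
  classical
  obtain ⟨S', hS', hsum⟩ := v.sum_localDegree (L := L)
  obtain rfl : S = S' := by ext u; rw [hS, hS']
  have hne : S.Nonempty := by
    rw [Finset.nonempty_iff_ne_empty]
    rintro rfl
    exact (Module.finrank_pos (R := K) (M := L)).ne hsum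
  obtain ⟨u₀, hu₀⟩ := hne
  have hu₀v := (hS u₀).mp hu₀
  choose Θ hΘ using fun g : Gal(L/K) => FinitePlace.exists_eq_comp u₀ g.toRingEquiv
  have hΘ' : ∀ g x, Θ g x = u₀ (g x) := hΘ
  obtain ⟨n, hn, -, hprod⟩ := prod_comp_eq_prod_image_pow (M := ℝ) Θ (fun g h k hgh => by
    refine Subtype.ext (AbsoluteValue.ext fun x => ?_)
    change Θ _ x = Θ _ x
    rw [hΘ', hΘ', AlgEquiv.mul_apply, AlgEquiv.mul_apply, ← hΘ', ← hΘ', hgh])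
  have himg : Finset.univ.image Θ = S := by
    ext u
    rw [Finset.mem_image, hS]
    constructor
    · rintro ⟨g, -, rfl⟩
      rw [FinitePlace.below_eq_of_comp g (hΘ' g), hu₀v]
    · intro hu
      obtain ⟨g, hg⟩ := FinitePlace.exists_galois_conj (hu.trans hu₀v.symm)
      exact ⟨g, Finset.mem_univ _, Subtype.ext (AbsoluteValue.ext fun x => (hΘ' g x).trans (hg x).symm)⟩
  rw [himg] at hn hprod
  -- all local degrees agree
  have hdeg : ∀ u ∈ S, u.localDegree K = u₀.localDegree K := by
    intro u hu
    obtain ⟨g, hg⟩ := FinitePlace.exists_galois_conj (((hS u).mp hu).trans hu₀v.symm)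
    obtain ⟨a, ha, ha1⟩ := v.isNontrivial
    have h1 := u.apply_algebraMap a
    rw [hg, AlgEquiv.commutes, u₀.apply_algebraMap, hu₀v, (hS u).mp hu] at h1
    exact (pow_right_injective₀ (FinitePlace.pos_iff.mpr ha) ha1 h1).symm
  -- Both |S| times the local degree and |S| times the fibre size `n` equal [L:K], so these two
  -- numbers agree.
  rw [Finset.sum_congr rfl hdeg, Finset.sum_const, smul_eq_mul, ← IsGalois.card_aut_eq_finrank, ← hn] at hsum
  have hnd : n = u₀.localDegree K := (Nat.eq_of_mul_eq_mul_left (Finset.card_pos.mpr ⟨u₀, hu₀⟩) hsum).symm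
  have hn0 : n ≠ 0 := hnd ▸ u₀.localDegree_pos.ne'
  have hp : (0 : ℝ) < (n : ℝ)⁻¹ := by positivity
  have hext := fun a => hu₀v ▸ u₀.rpow_inv_localDegree hnd hp a
  obtain ⟨g₀, hg₀⟩ := AbsoluteValue.exists_galois_conj (u₀.rpow hp) w (K := K) (fun a => by rw [hw, hext]) (by
    obtain ⟨a, ha, ha1⟩ := v.isNontrivial
    exact ⟨a, ha, by rw [hext]; exact ha1⟩)
  have hw' : ∀ g : Gal(L/K), ⨆ j, w (g (y j)) = (⨆ j, Θ (g₀ * g) (y j)) ^ (n : ℝ)⁻¹ := by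
    intro g
    rw [Real.iSup_rpow _ (fun _ => apply_nonneg _ _) hp.le]
    refine iSup_congr fun j => ?_
    rw [hg₀, hΘ']
    rfl
  rw [Finset.prod_congr rfl fun g _ => hw' g,
    Fintype.prod_equiv (Equiv.mulLeft g₀) (fun g => (⨆ j, Θ (g₀ * g) (y j)) ^ (n : ℝ)⁻¹)
      (fun g => (⨆ j, Θ g (y j)) ^ (n : ℝ)⁻¹) (fun _ => rfl),
    hprod (fun u => (⨆ j, u (y j)) ^ (n : ℝ)⁻¹), ← Finset.prod_pow]
  refine Finset.prod_congr rfl fun u _ => ?_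
  rw [← Real.rpow_natCast, ← Real.rpow_mul (Real.iSup_nonneg fun _ => apply_nonneg _ _), inv_mul_cancel₀ (by positivity), Real.rpow_one]

/-! ### Global heights as products over the places of the base field. -/

open NumberField IsDedekindDomain
theorem NumberField.FinitePlace.hasFiniteMulSupport_iSup {L : Type*} [Field L] [NumberField L] {ι : Type*} [Finite ι]
    {y : ι → L} (hy : y ≠ 0) : Function.HasFiniteMulSupport fun u : FinitePlace L => ⨆ j, u (y j) := by
  obtain ⟨j₀, hj₀⟩ := Function.ne_iff.mp hy
  have : Nonempty ι := ⟨j₀⟩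
  refine (Set.finite_iUnion fun j : {j // y j ≠ 0} => FinitePlace.hasFiniteMulSupport j.2).subset fun u hu => ?_
  by_contra h
  simp only [Set.mem_iUnion, Function.mem_mulSupport, not_exists, not_not, Subtype.forall] at h
  refine hu (le_antisymm (ciSup_le fun j => ?_) ?_)
  · by_cases hj : y j = 0
    · simp [hj]
    · exact (h j hj).le
  · exact (h j₀ hj₀).ge.trans (le_ciSup (Set.finite_range fun j => u (y j)).bddAbove j₀)

variable {K L : Type*} [Field K] [NumberField K] [Field L] [NumberField L] [Algebra K L]

theorem NumberField.InfinitePlace.mult_eq_card_stabilizer_mul {K L : Type*} [Field K] [Field L] [Algebra K L] [IsGalois K L] (u : InfinitePlace L) :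
    u.mult = Nat.card (MulAction.stabilizer Gal(L/K) u) * (u.comap (algebraMap K L)).mult := by
  classical
  rw [InfinitePlace.card_stabilizer]
  split_ifs with h
  · rw [one_mul, h.eq]
  · obtain ⟨h1, h2⟩ := InfinitePlace.not_isUnramified_iff.mp h
    rw [InfinitePlace.mult_isComplex ⟨u, h1⟩, InfinitePlace.mult_isReal ⟨_, h2⟩]

/-- Here a place above `v` is already an extension of `v`. Each is met as often as the order of its
stabilizer, and that order times the multiplicity of `v` is the multiplicity upstairs. -/
theorem NumberField.InfinitePlace.prod_galois_iSup [IsGalois K L] (v : InfinitePlace K) (w : AbsoluteValue L ℝ)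
    (hw : ∀ a, w (algebraMap K L a) = v a) [DecidableEq (InfinitePlace K)]
    {ι : Type*} [Finite ι] [Nonempty ι] (y : ι → L) :
    (∏ g : Gal(L/K), ⨆ j, w (g (y j))) ^ v.mult =
      ∏ u : InfinitePlace L with u.comap (algebraMap K L) = v, (⨆ j, u (y j)) ^ u.mult := by
  classical
  obtain ⟨u₀, hu₀⟩ : ∃ u₀ : InfinitePlace L, u₀.comap (algebraMap K L) = v :=
    InfinitePlace.comap_surjective v
  let Θ : Gal(L/K) → InfinitePlace L := fun g => g⁻¹ • u₀
  have hΘ : ∀ g x, Θ g x = u₀ (g x) := fun g x => rfl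
  obtain ⟨n, hn, hstab, hprod⟩ := prod_comp_eq_prod_image_pow (M := ℝ) Θ (fun g h k hgh => by
    simp only [Θ, mul_inv_rev, mul_smul] at hgh ⊢
    rw [hgh])
  have himg : Finset.univ.image Θ = Finset.univ.filter fun u : InfinitePlace L => u.comap (algebraMap K L) = v := by
    ext u
    simp only [Finset.mem_image, Finset.mem_filter, Finset.mem_univ, true_and]
    rw [← hu₀, eq_comm, ← InfinitePlace.mem_orbit_iff]
    exact ⟨fun ⟨g, hg⟩ => ⟨g⁻¹, hg⟩, fun ⟨g, hg⟩ => ⟨g⁻¹, by simpa [Θ] using hg⟩⟩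
  have hst : ∀ u : InfinitePlace L, u ∈ Finset.univ.image Θ → n * v.mult = u.mult := by
    intro u hu
    have hr : u.mult = u₀.mult := by
      obtain ⟨g, -, rfl⟩ := Finset.mem_image.mp hu
      simp only [InfinitePlace.mult, Θ, InfinitePlace.isReal_smul_iff]
    rw [hr, u₀.mult_eq_card_stabilizer_mul (K := K), hu₀, hstab]
    congr 1
    refine Nat.card_congr ((Equiv.inv _).subtypeEquiv fun g => ?_)
    simp only [Θ, inv_one, one_smul, MulAction.mem_stabilizer_iff, Equiv.inv_apply]
  obtain ⟨g₀, hg₀⟩ := AbsoluteValue.exists_galois_conj u₀.1 w (K := K) (fun a => by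
    rw [hw, ← hu₀]; rfl) (by
    obtain ⟨a, ha, ha1⟩ := v.isNontrivial
    exact ⟨a, ha, by rw [← hu₀] at ha1; exact ha1⟩)
  have hw' : ∀ g : Gal(L/K), ⨆ j, w (g (y j)) = ⨆ j, Θ (g₀ * g) (y j) := by
    intro g
    refine iSup_congr fun j => ?_
    rw [hg₀, hΘ]
    rfl
  rw [Finset.prod_congr rfl fun g _ => hw' g,
    Fintype.prod_equiv (Equiv.mulLeft g₀) (fun g => ⨆ j, Θ (g₀ * g) (y j)) (fun g => ⨆ j, Θ g (y j)) (fun _ => rfl),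
    hprod (fun u => ⨆ j, u (y j)), ← pow_mul, himg, ← Finset.prod_pow]
  refine Finset.prod_congr rfl fun u hu => ?_
  rw [hst u (himg ▸ hu)]

open Height

/-- The places of `L` are grouped by the place of `K` below them, with any choice of extensions `w`.
Finiteness of the support is recorded because powers must later be moved through `∏ᶠ`. -/
theorem Height.mulHeight_eq_prod_galois [IsGalois K L] {ι : Type*} [Finite ι] {y : ι → L} (hy : y ≠ 0)
    (w : AbsoluteValue K ℝ → AbsoluteValue L ℝ) (hinf : ∀ (v : InfinitePlace K) a, w v.1 (algebraMap K L a) = v a)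
    (hfin : ∀ (v : FinitePlace K) a, w v.1 (algebraMap K L a) = v a) :
    (Function.HasFiniteMulSupport fun v : FinitePlace K => ∏ g : Gal(L/K), ⨆ j, w v.1 (g (y j))) ∧
    mulHeight y = (∏ v : InfinitePlace K, (∏ g : Gal(L/K), ⨆ j, w v.1 (g (y j))) ^ v.mult) *
      ∏ᶠ v : FinitePlace K, ∏ g : Gal(L/K), ⨆ j, w v.1 (g (y j)) := by
  classical
  have : Nonempty ι := by
    obtain ⟨j, -⟩ := Function.ne_iff.mp hy
    exact ⟨j⟩
  have hs : (Function.mulSupport fun u : FinitePlace L => ⨆ j, u (y j)).Finite :=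
    FinitePlace.hasFiniteMulSupport_iSup hy
  choose S hS _ using fun v : FinitePlace K => v.sum_localDegree (L := L)
  have hloc : ∀ v : FinitePlace K, ∏ g : Gal(L/K), ⨆ j, w v.1 (g (y j)) = ∏ u ∈ hs.toFinset with u.below K = v, ⨆ j, u (y j) := by
    intro v
    rw [v.prod_galois_iSup (w v.1) (hfin v) (hS v)]
    symm
    refine Finset.prod_subset (fun u hu => ?_) (fun u hu hu' => ?_)
    · rw [hS]; exact (Finset.mem_filter.mp hu).2
    · by_contra h1
      exact hu' (Finset.mem_filter.mpr ⟨by simpa using h1, (hS v u).mp hu⟩)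
  have hsub : (Function.mulSupport fun v : FinitePlace K => ∏ g : Gal(L/K), ⨆ j, w v.1 (g (y j))) ⊆
      (hs.toFinset.image (FinitePlace.below K) : Finset (FinitePlace K)) := by
    intro v hv
    rw [Function.mem_mulSupport, hloc] at hv
    obtain ⟨u, hu, -⟩ := Finset.exists_ne_one_of_prod_ne_one hv
    rw [Finset.mem_filter] at hu
    exact Finset.mem_coe.mpr (Finset.mem_image.mpr ⟨u, hu⟩)
  refine ⟨(Finset.finite_toSet _).subset hsub, ?_⟩
  rw [NumberField.mulHeight_eq hy]
  congr 1
  · rw [← Finset.prod_fiberwise (s := Finset.univ) (g := fun u : InfinitePlace L => u.comap (algebraMap K L))]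
    exact Finset.prod_congr rfl fun v _ => (v.prod_galois_iSup (w v.1) (hinf v) y).symm
  · rw [finprod_eq_prod_of_mulSupport_subset _ hsub, finprod_eq_prod_of_mulSupport_subset (s := hs.toFinset) _ (by simp)]
    rw [← Finset.prod_fiberwise_of_maps_to (g := FinitePlace.below K) (t := hs.toFinset.image (FinitePlace.below K))
      (fun u hu => Finset.mem_image_of_mem _ hu)]
    exact Finset.prod_congr rfl fun v _ => (hloc v).symm

/-- When the coordinates lie in `K`, all Galois elements give the same local factor; this produces
the exponent. The later use has the fixed field L^{G_1} as base. -/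
theorem Height.mulHeight_algebraMap [IsGalois K L] {ι : Type*} [Finite ι] {x : ι → K} (hx : x ≠ 0) :
    mulHeight (fun j => algebraMap K L (x j)) = mulHeight x ^ Module.finrank K L := by
  classical
  have : Nonempty ι := by
    obtain ⟨j, -⟩ := Function.ne_iff.mp hx
    exact ⟨j⟩
  let φ : L →ₐ[K] AlgebraicClosure K := IsAlgClosed.lift
  have hex : ∀ v : AbsoluteValue K ℝ, ∃ w : AbsoluteValue L ℝ,
      IsInfinitePlace v ∨ IsFinitePlace v → ∀ a, w (algebraMap K L a) = v a := by
    intro v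
    have key : ∀ w' : AbsoluteValue (AlgebraicClosure K) ℝ, (∀ a, w' (algebraMap K _ a) = v a) →
        ∀ a, w'.comp (f := (φ : L →+* _)) φ.injective (algebraMap K L a) = v a := fun w' hw' a => by
      rw [← hw', ← φ.commutes]; rfl
    by_cases hv : IsInfinitePlace v
    · obtain ⟨w', hw'⟩ := InfinitePlace.exists_extension_algebraicClosure ⟨v, hv⟩
      exact ⟨_, fun _ => key w' hw'⟩
    · by_cases hv' : IsFinitePlace v
      · obtain ⟨w', hw'⟩ := FinitePlace.exists_extension_algebraicClosure ⟨v, hv'⟩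
        exact ⟨_, fun _ => key w' hw'⟩
      · exact ⟨AbsoluteValue.trivial, fun h => absurd h (by tauto)⟩
  choose w hw using hex
  have hinf := fun v : InfinitePlace K => hw v.1 (Or.inl v.isInfinitePlace)
  have hfin := fun v : FinitePlace K => hw v.1 (Or.inr v.isFinitePlace)
  have hx' : (fun j => algebraMap K L (x j)) ≠ 0 := by
    obtain ⟨j, hj⟩ := Function.ne_iff.mp hx
    exact Function.ne_iff.mpr ⟨j, by simpa using hj⟩
  rw [(mulHeight_eq_prod_galois hx' w hinf hfin).2, NumberField.mulHeight_eq hx, mul_pow, ← Finset.prod_pow,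
    finprod_pow (FinitePlace.hasFiniteMulSupport_iSup hx)]
  congr 1
  · refine Finset.prod_congr rfl fun v _ => ?_
    simp only [AlgEquiv.commutes, hinf, Finset.prod_const, Finset.card_univ, ← Nat.card_eq_fintype_card,
      IsGalois.card_aut_eq_finrank, ← pow_mul, mul_comm]
    rfl
  · refine finprod_congr fun v => ?_
    simp only [AlgEquiv.commutes, hfin, Finset.prod_const, Finset.card_univ, ← Nat.card_eq_fintype_card,
      IsGalois.card_aut_eq_finrank]
    rfl

/-! ### Points of projective space over rings, in a chart. -/

namespace AlgebraicGeometry.Proj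
open HomogeneousLocalization

/-- Since `f t` is a unit, the open set on which the glued morphism is given by the chart of `t` is
all of `X`. -/
theorem fromOfGlobalSections_eq_of_isUnit {σ : Type*} {A : Type u} [CommRing A] [SetLike σ A] [AddSubgroupClass σ A]
    (𝒜 : ℕ → σ) [GradedRing 𝒜] {X : Scheme.{u}} (f : A →+* Γ(X, ⊤))
    (hf : (HomogeneousIdeal.irrelevant 𝒜).toIdeal.map f = ⊤) {t : A} {d : ℕ} (ht : t ∈ 𝒜 d) (hd : 0 < d) (hu : IsUnit (f t)) :
    fromOfGlobalSections 𝒜 f hf =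
      X.toSpecΓ ≫ Spec.map (CommRingCat.ofHom ((IsLocalization.Away.lift (S := Localization.Away t) t hu).comp
        (algebraMap (Away 𝒜 t) (Localization.Away t)))) ≫ awayι 𝒜 t ht hd := by
  have hι : (X.basicOpen (f t)).ι ≫ fromOfGlobalSections 𝒜 f hf =
      toBasicOpenOfGlobalSections 𝒜 f rfl hd ht ≫ Scheme.Opens.ι _ :=
    (openCoverOfMapIrrelevantEqTop 𝒜 f hf).ι_glueMorphisms _ _ ⟨d, t, hd, ht⟩
  have htop : X.basicOpen (f t) = ⊤ := X.basicOpen_of_isUnit hu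
  have : IsIso (X.basicOpen (f t)).ι := by
    rw [htop]; exact inferInstanceAs (IsIso X.topIso.hom)
  rw [← cancel_epi (X.basicOpen (f t)).ι, hι]
  have hfac : IsLocalization.Away.lift (S := Localization.Away t) t hu =
      (IsLocalization.Away.lift (S := Localization.Away (f t)) (g := RingHom.id _) (f t) hu).comp
      (IsLocalization.map (M := .powers t) (T := .powers (f t)) _ f (by
        rw [← Submonoid.map_le_iff_le_comap, Submonoid.map_powers])) := by
    apply IsLocalization.ringHom_ext (M := .powers t)
    ext a
    simp
  have key : X.homOfLE (X.toSpecΓ_preimage_basicOpen (f t)).ge ≫ X.toSpecΓ ∣_ _ ≫ (basicOpenIsoSpecAway (f t)).hom =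
      (X.basicOpen (f t)).ι ≫ X.toSpecΓ ≫ Spec.map (CommRingCat.ofHom
        (IsLocalization.Away.lift (S := Localization.Away (f t)) (g := RingHom.id _) (f t) hu)) := by
    have : Mono (Spec.map (CommRingCat.ofHom (algebraMap Γ(X, ⊤) (Localization.Away (f t))))) :=
      inferInstance
    rw [← cancel_mono (Spec.map (CommRingCat.ofHom (algebraMap Γ(X, ⊤) (Localization.Away (f t)))))]
    simp only [Category.assoc, basicOpenIsoSpecAway_hom_SpecMap]
    rw [← Spec.map_comp, ← CommRingCat.ofHom_comp]
    have : (IsLocalization.Away.lift (S := Localization.Away (f t)) (g := RingHom.id _) (f t) hu).comp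
        (algebraMap Γ(X, ⊤) (Localization.Away (f t))) = RingHom.id _ := by
      ext a; simp
    have h2 : X.toSpecΓ ≫ Spec.map (CommRingCat.ofHom (RingHom.id Γ(X, ⊤))) = X.toSpecΓ := by
      rw [CommRingCat.ofHom_id]
      exact (congrArg _ (Spec.map_id _)).trans (Category.comp_id _)
    rw [this]
    exact ((congrArg (X.homOfLE _ ≫ ·) (morphismRestrict_ι X.toSpecΓ _)).trans
      (X.homOfLE_ι_assoc _ _)).trans (congrArg ((X.basicOpen (f t)).ι ≫ ·) h2.symm)
  simp only [toBasicOpenOfGlobalSections, Category.assoc, basicOpenIsoSpec_inv_ι, Scheme.isoOfEq_inv]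
  rw [reassoc_of% key, hfac]
  simp only [CommRingCat.ofHom_comp, Spec.map_comp, Category.assoc]

end AlgebraicGeometry.Proj

noncomputable section

theorem MvPolynomial.IsHomogeneous.eval₂_mul_left {σ K S : Type*} [CommSemiring K] [CommSemiring S] {a : MvPolynomial σ K} {n : ℕ}
    (ha : a.IsHomogeneous n) (c : K →+* S) (g : σ → S) (t : S) :
    MvPolynomial.eval₂ c (fun i => t * g i) a = t ^ n * MvPolynomial.eval₂ c g a := by
  rw [MvPolynomial.eval₂_eq, MvPolynomial.eval₂_eq, Finset.mul_sum]
  refine Finset.sum_congr rfl fun d hd => ?_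
  have hn := ha (MvPolynomial.mem_support_iff.mp hd)
  rw [Finsupp.weight_apply, Finsupp.sum] at hn
  simp only [Pi.one_apply, smul_eq_mul, mul_one] at hn
  rw [Finset.prod_congr rfl fun i _ => mul_pow t (g i) (d i), Finset.prod_mul_distrib, Finset.prod_pow_eq_pow_sum, hn]
  ring

namespace PermQuot

attribute [local instance] MvPolynomial.gradedAlgebra

section Points

variable {K : Type u} [Field K] {m n : ℕ}

open HomogeneousLocalization

local notation "𝒜" => MvPolynomial.homogeneousSubmodule (Fin (m + 1)) K

theorem X_mem_homogeneousSubmodule (K : Type u) [Field K] {m : ℕ} (j : Fin (m + 1)) :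
    (MvPolynomial.X j : MvPolynomial (Fin (m + 1)) K) ∈ MvPolynomial.homogeneousSubmodule (Fin (m + 1)) K 1 :=
  MvPolynomial.isHomogeneous_X K j

/-- The coordinate ratio `X_i / X_j`. -/
def coordFrac (K : Type u) [Field K] {m : ℕ} (i j : Fin (m + 1)) : Away (MvPolynomial.homogeneousSubmodule (Fin (m + 1)) K) (MvPolynomial.X j) :=
  Away.mk _ (X_mem_homogeneousSubmodule K j) 1 (MvPolynomial.X i) (by
    simpa using MvPolynomial.isHomogeneous_X K i)

/-- The constants in the degree zero part of the localization. -/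
def awayConst (K : Type u) [Field K] {m : ℕ} (j : Fin (m + 1)) : K →+* Away (MvPolynomial.homogeneousSubmodule (Fin (m + 1)) K) (MvPolynomial.X j) :=
  (fromZeroRingHom _ _).comp (algebraMap K (MvPolynomial.homogeneousSubmodule (Fin (m + 1)) K 0))

theorem algebraMap_coordFrac (i j : Fin (m + 1)) :
    algebraMap _ (Localization.Away (MvPolynomial.X j : MvPolynomial (Fin (m + 1)) K)) (coordFrac K i j) *
      algebraMap _ _ (MvPolynomial.X j : MvPolynomial (Fin (m + 1)) K) = algebraMap _ _ (MvPolynomial.X i : MvPolynomial (Fin (m + 1)) K) := by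
  rw [HomogeneousLocalization.algebraMap_apply, coordFrac, Away.val_mk, Localization.mk_eq_mk']
  simp

theorem algebraMap_awayConst (j : Fin (m + 1)) (a : K) :
    algebraMap _ (Localization.Away (MvPolynomial.X j : MvPolynomial (Fin (m + 1)) K)) (awayConst K j a) =
      algebraMap _ _ (MvPolynomial.C a : MvPolynomial (Fin (m + 1)) K) := by
  change (fromZeroRingHom _ _ (algebraMap K (MvPolynomial.homogeneousSubmodule (Fin (m + 1)) K 0) a)).val = _
  exact Localization.mk_one_eq_algebraMap _

theorem away_ringHom_ext {j : Fin (m + 1)} {S : Type*} [CommRing S] {φ ψ : Away 𝒜 (MvPolynomial.X j) →+* S}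
    (hc : φ.comp (awayConst K j) = ψ.comp (awayConst K j)) (hX : ∀ i, φ (coordFrac K i j) = ψ (coordFrac K i j)) : φ = ψ := by
  ext z
  obtain ⟨n, a, ha, rfl⟩ := Away.mk_surjective 𝒜 (X_mem_homogeneousSubmodule K j) z
  have ha' : a.IsHomogeneous n := by simpa using ha
  -- The fraction a / X_j^n is `a` evaluated at the ratios X_i / X_j: after multiplication by X_j^n
  -- this is the homogeneity of `a`. So constants and ratios generate the ring of the chart.
  have key : Away.mk 𝒜 (X_mem_homogeneousSubmodule K j) n a ha =
      MvPolynomial.eval₂ (awayConst K j) (fun i => coordFrac K i j) a := by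
    apply HomogeneousLocalization.val_injective
    let T := Localization.Away (MvPolynomial.X j : MvPolynomial (Fin (m + 1)) K)
    let ι : Away 𝒜 (MvPolynomial.X j) →+* T := algebraMap _ _
    let t : T := algebraMap _ _ (MvPolynomial.X j : MvPolynomial (Fin (m + 1)) K)
    change _ = ι _
    rw [MvPolynomial.hom_eval₂]
    have ht : IsUnit (t ^ n) := (IsLocalization.Away.algebraMap_isUnit (S := T) _).pow n
    rw [← ht.mul_right_inj, ← ha'.eval₂_mul_left]
    change _ = MvPolynomial.eval₂ _ (fun i => t * ι (coordFrac K i j)) a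
    have h1 : (fun i => t * ι (coordFrac K i j)) = fun i => algebraMap (MvPolynomial (Fin (m + 1)) K) T (MvPolynomial.X i) := by
      ext i
      rw [mul_comm]; exact algebraMap_coordFrac i j
    have h2 : ι.comp (awayConst K j) = (algebraMap (MvPolynomial (Fin (m + 1)) K) T).comp MvPolynomial.C := by
      ext a; exact algebraMap_awayConst j a
    have h3 : MvPolynomial.eval₂ ((algebraMap (MvPolynomial (Fin (m + 1)) K) T).comp MvPolynomial.C)
        (fun i => algebraMap (MvPolynomial (Fin (m + 1)) K) T (MvPolynomial.X i)) a = algebraMap _ T a := by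
      have := MvPolynomial.hom_eval₂ a MvPolynomial.C (algebraMap (MvPolynomial (Fin (m + 1)) K) T) MvPolynomial.X
      rw [MvPolynomial.eval₂_eta] at this
      exact this.symm
    rw [h1, h2, h3, Away.val_mk, Localization.mk_eq_mk', mul_comm]
    simpa [t] using IsLocalization.mk'_spec T a
      (⟨MvPolynomial.X j ^ n, n, rfl⟩ : Submonoid.powers (MvPolynomial.X j : MvPolynomial (Fin (m + 1)) K))
  rw [key, MvPolynomial.hom_eval₂, MvPolynomial.hom_eval₂, hc]
  congr 1
  ext i
  exact hX i

variable {R : Type u} [CommRing R] [Algebra K R]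

/-- Evaluation of degree-zero fractions. -/
def awayEval (v : Fin (m + 1) → R) (j : Fin (m + 1)) (hj : IsUnit (v j)) :
    Away (MvPolynomial.homogeneousSubmodule (Fin (m + 1)) K) (MvPolynomial.X j) →+* R :=
  (IsLocalization.Away.lift (S := Localization.Away (MvPolynomial.X j : MvPolynomial (Fin (m+1)) K)) (MvPolynomial.X j : MvPolynomial (Fin (m + 1)) K)
    (g := (MvPolynomial.aeval v : MvPolynomial (Fin (m + 1)) K →ₐ[K] R).toRingHom) (by simpa using hj)).comp
    (algebraMap _ _)

theorem awayEval_coordFrac (v : Fin (m + 1) → R) (j : Fin (m + 1)) (hj : IsUnit (v j)) (i) :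
    awayEval v j hj (coordFrac K i j) * v j = v i := by
  have h := congrArg (IsLocalization.Away.lift (S := Localization.Away (MvPolynomial.X j : MvPolynomial (Fin (m+1)) K)) (MvPolynomial.X j : MvPolynomial (Fin (m + 1)) K)
    (g := (MvPolynomial.aeval v : MvPolynomial (Fin (m + 1)) K →ₐ[K] R).toRingHom) (by simpa using hj)) (algebraMap_coordFrac (K := K) i j)
  rw [map_mul, IsLocalization.Away.lift_eq, IsLocalization.Away.lift_eq] at h
  simpa [awayEval] using h

theorem awayEval_awayConst (v : Fin (m + 1) → R) (j : Fin (m + 1)) (hj : IsUnit (v j)) :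
    (awayEval v j hj).comp (awayConst K j) = algebraMap K R := by
  ext a
  have h := congrArg (IsLocalization.Away.lift (S := Localization.Away (MvPolynomial.X j : MvPolynomial (Fin (m+1)) K)) (MvPolynomial.X j : MvPolynomial (Fin (m + 1)) K)
    (g := (MvPolynomial.aeval v : MvPolynomial (Fin (m + 1)) K →ₐ[K] R).toRingHom) (by simpa using hj)) (algebraMap_awayConst (K := K) j a)
  rw [IsLocalization.Away.lift_eq] at h
  simpa [awayEval] using h

theorem eq_awayEval {v : Fin (m + 1) → R} {j : Fin (m + 1)} (hj : IsUnit (v j)) {φ : Away 𝒜 (MvPolynomial.X j) →+* R}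
    (hc : φ.comp (awayConst K j) = algebraMap K R) (hX : ∀ i, φ (coordFrac K i j) * v j = v i) : φ = awayEval v j hj :=
  away_ringHom_ext (hc.trans (awayEval_awayConst v j hj).symm) fun i => by
    rw [← hj.mul_left_inj, hX, awayEval_coordFrac]

/-- `Spec R` as a scheme over `Spec K`. -/
def specAlg (K R : Type u) [Field K] [CommRing R] [Algebra K R] : Over (Spec (CommRingCat.of K)) :=
  Over.mk (Spec.map (CommRingCat.ofHom (algebraMap K R)))

/-- The morphism `Spec R ⟶ ℙ^m` with coordinates `(v_0 : ⋯ : v_m)`, one of which is a unit. -/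
def chartMap (v : Fin (m + 1) → R) (j : Fin (m + 1)) (hj : IsUnit (v j)) : Spec (CommRingCat.of R) ⟶ Proj 𝒜 :=
  Spec.map (CommRingCat.ofHom (awayEval v j hj)) ≫
    Proj.awayι _ (MvPolynomial.X j) (X_mem_homogeneousSubmodule K j) Nat.one_pos

/-- The `R`-point `(v_0 : ⋯ : v_m)` of `ℙ^m`, for coordinates one of which is a unit. -/
def ringPoint (v : Fin (m + 1) → R) (j : Fin (m + 1)) (hj : IsUnit (v j)) : specAlg K R ⟶ projSpace K m :=
  Over.homMk (chartMap v j hj) (by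
    simp only [chartMap, projSpace, specAlg, Over.mk_hom, Category.assoc, Proj.awayι_toSpecZero_assoc]
    rw [← Spec.map_comp, ← Spec.map_comp, ← CommRingCat.ofHom_comp, ← CommRingCat.ofHom_comp]
    exact congrArg (fun f => Spec.map (CommRingCat.ofHom f)) (awayEval_awayConst (K := K) v j hj))

theorem ringPoint_left (v : Fin (m + 1) → R) (j : Fin (m + 1)) (hj : IsUnit (v j)) :
    (ringPoint (K := K) v j hj).left = chartMap v j hj := rfl

/-- From here on points are computed in one chart. The coordinate ring may be any `K`-algebra in
`ringPoint`, because points over dual numbers are needed for the ramification argument. -/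
theorem coordPoint_eq_ringPoint {F : Type u} [Field F] [Algebra K F] (v : Fin (m + 1) → F) (hv : v ≠ 0) (j : Fin (m + 1)) (hj : IsUnit (v j)) :
    coordPoint (K := K) v hv = ringPoint v j hj := by
  apply Over.OverMorphism.ext
  have hu : IsUnit (evalHom (K := K) v (MvPolynomial.X j)) := by
    have : evalHom (K := K) v (MvPolynomial.X j) = (Scheme.ΓSpecIso (CommRingCat.of F)).inv.hom (v j) := by
      simp [evalHom]
    rw [this]
    exact hj.map _
  refine (Proj.fromOfGlobalSections_eq_of_isUnit 𝒜 (evalHom v) (map_irrelevant_evalHom hv) (X_mem_homogeneousSubmodule K j) Nat.one_pos hu).trans ?_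
  rw [ringPoint_left, chartMap]
  let ψ := (Scheme.ΓSpecIso (CommRingCat.of F)).inv
  have h : CommRingCat.ofHom ((IsLocalization.Away.lift (S := Localization.Away (MvPolynomial.X j : MvPolynomial (Fin (m + 1)) K)) _ hu).comp
      (algebraMap (Away 𝒜 (MvPolynomial.X j)) (Localization.Away (MvPolynomial.X j : MvPolynomial (Fin (m + 1)) K)))) =
      CommRingCat.ofHom (awayEval v j hj) ≫ ψ := by
    rw [← CommRingCat.ofHom_hom ψ, ← CommRingCat.ofHom_comp]
    congr 1
    rw [awayEval, ← RingHom.comp_assoc]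
    congr 1
    apply IsLocalization.ringHom_ext (M := .powers (MvPolynomial.X j : MvPolynomial (Fin (m + 1)) K))
    ext a <;> simp [evalHom, ψ]
  rw [h, Spec.map_comp, Category.assoc]
  exact toSpecΓ_SpecMap_ΓSpecIso_inv_assoc (CommRingCat.of F) _

/-- The morphism of spectra over `K` given by a homomorphism of `K`-algebras. -/
def specAlgMap {R S : Type u} [CommRing R] [Algebra K R] [CommRing S] [Algebra K S] (f : R →ₐ[K] S) : specAlg K S ⟶ specAlg K R :=
  Over.homMk (Spec.map (CommRingCat.ofHom f.toRingHom)) (by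
    simp only [specAlg, Over.mk_hom]
    rw [← Spec.map_comp, ← CommRingCat.ofHom_comp]
    congr 2
    exact f.comp_algebraMap)

theorem SpecMap_chartMap {R S : Type u} [CommRing R] [Algebra K R] [CommRing S] [Algebra K S] (f : R →ₐ[K] S)
    (v : Fin (m + 1) → R) (j : Fin (m + 1)) (hj : IsUnit (v j)) :
    Spec.map (CommRingCat.ofHom f.toRingHom) ≫ chartMap (K := K) v j hj = chartMap (fun i => f (v i)) j (hj.map f) := by
  rw [chartMap, chartMap, ← Category.assoc, ← Spec.map_comp, ← CommRingCat.ofHom_comp]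
  congr 3
  refine eq_awayEval (K := K) _ ?_ fun i => ?_
  · rw [RingHom.comp_assoc, awayEval_awayConst]
    exact f.comp_algebraMap
  · exact (map_mul f _ _).symm.trans (congrArg f (awayEval_coordFrac v j hj i))

theorem specAlgMap_ringPoint {R S : Type u} [CommRing R] [Algebra K R] [CommRing S] [Algebra K S] (f : R →ₐ[K] S)
    (v : Fin (m + 1) → R) (j : Fin (m + 1)) (hj : IsUnit (v j)) :
    specAlgMap f ≫ ringPoint v j hj = ringPoint (fun i => f (v i)) j (hj.map f) :=
  Over.OverMorphism.ext (SpecMap_chartMap f v j hj)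

/-- The chart is a monomorphism, so equality is tested on the ratios `v i / v j`, written with
denominators cleared. -/
theorem chartMap_eq_iff {v v' : Fin (m + 1) → R} {j : Fin (m + 1)} (hj : IsUnit (v j)) (hj' : IsUnit (v' j)) :
    chartMap (K := K) v j hj = chartMap v' j hj' ↔ ∀ i, v i * v' j = v' i * v j := by
  rw [chartMap, chartMap, cancel_mono, Spec.map_injective.eq_iff]
  constructor
  · intro h i
    have h1 : awayEval (K := K) v j hj (coordFrac K i j) = awayEval v' j hj' (coordFrac K i j) :=
      congrArg (fun f => f.hom (coordFrac K i j)) h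
    rw [← awayEval_coordFrac (K := K) v j hj i, ← awayEval_coordFrac (K := K) v' j hj' i, h1]
    ring
  · intro h
    congr 1
    refine eq_awayEval hj' (awayEval_awayConst _ _ _) fun i => ?_
    rw [← hj.mul_left_inj, ← h, ← awayEval_coordFrac (K := K) v j hj i]
    ring

theorem ringPoint_eq_iff {v v' : Fin (m + 1) → R} {j : Fin (m + 1)} (hj : IsUnit (v j)) (hj' : IsUnit (v' j)) :
    ringPoint (K := K) v j hj = ringPoint v' j hj' ↔ ∀ i, v i * v' j = v' i * v j := by
  rw [← chartMap_eq_iff (K := K) hj hj']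
  exact ⟨fun h => congrArg (fun f => f.left) h, fun h => Over.OverMorphism.ext h⟩

end Points

end PermQuot
end

/-! ### Field-valued points of projective space. -/

noncomputable section

namespace PermQuot

attribute [local instance] MvPolynomial.gradedAlgebra

section FieldPoints

variable {K : Type u} [Field K] {m n : ℕ}

open HomogeneousLocalization

local notation "𝒜" => MvPolynomial.homogeneousSubmodule (Fin (m + 1)) K

variable {F : Type u} [Field F] [Algebra K F]

/-- The underlying morphism of schemes of `coordPoint`. -/
def coordMap (K : Type u) [Field K] [Algebra K F] (v : Fin (m + 1) → F) (hv : v ≠ 0) : Spec (CommRingCat.of F) ⟶ Proj (MvPolynomial.homogeneousSubmodule (Fin (m + 1)) K) :=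
  Proj.fromOfGlobalSections _ (evalHom v) (map_irrelevant_evalHom hv)

/-- Ensures that equal morphisms have the same nonvanishing coordinates and can be compared in a
common chart. -/
theorem coordMap_preimage_basicOpen (v : Fin (m + 1) → F) (hv : v ≠ 0) (j : Fin (m + 1)) :
    coordMap K v hv ⁻¹ᵁ Proj.basicOpen 𝒜 (MvPolynomial.X j) = ⊤ ↔ v j ≠ 0 := by
  have h1 : coordMap K v hv ⁻¹ᵁ Proj.basicOpen 𝒜 (MvPolynomial.X j) = (Spec (CommRingCat.of F)).basicOpen (evalHom (K := K) v (MvPolynomial.X j)) :=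
    Proj.fromOfGlobalSections_preimage_basicOpen 𝒜 _ (map_irrelevant_evalHom hv) Nat.one_pos (X_mem_homogeneousSubmodule K j)
  have h2 : evalHom (K := K) v (MvPolynomial.X j) = (Scheme.ΓSpecIso (CommRingCat.of F)).inv.hom (v j) := by
    simp [evalHom]
  rw [h1, h2]
  constructor
  · intro h h0
    rw [h0, map_zero, Scheme.basicOpen_zero] at h
    have : (IsLocalRing.closedPoint F) ∈ (⊥ : (Spec (CommRingCat.of F)).Opens) := by
      rw [h]; trivial
    exact this
  · intro h
    exact Scheme.basicOpen_of_isUnit _ ((IsUnit.mk0 _ h).map _)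

theorem coordMap_eq_chartMap (v : Fin (m + 1) → F) (hv : v ≠ 0) (j : Fin (m + 1)) (hj : IsUnit (v j)) :
    coordMap K v hv = chartMap v j hj :=
  congrArg (fun f => f.left) (coordPoint_eq_ringPoint (K := K) v hv j hj)

theorem coordMap_eq_iff {v v' : Fin (m + 1) → F} (hv : v ≠ 0) (hv' : v' ≠ 0) :
    coordMap K v hv = coordMap K v' hv' ↔ ∃ c : F, c ≠ 0 ∧ v' = c • v := by
  constructor
  · intro h
    obtain ⟨j, hj⟩ := Function.ne_iff.mp hv
    have hj' : v' j ≠ 0 := by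
      rw [← coordMap_preimage_basicOpen (K := K) v' hv', ← h, coordMap_preimage_basicOpen]
      exact hj
    rw [coordMap_eq_chartMap v hv j (IsUnit.mk0 _ hj), coordMap_eq_chartMap v' hv' j (IsUnit.mk0 _ hj')] at h
    have h2 := (chartMap_eq_iff _ _).mp h
    refine ⟨v' j / v j, div_ne_zero hj' hj, funext fun i => ?_⟩
    have hj0 : v j ≠ 0 := hj
    rw [Pi.smul_apply, smul_eq_mul]
    field_simp
    linear_combination - h2 i
  · rintro ⟨c, hc, rfl⟩
    obtain ⟨j, hj⟩ := Function.ne_iff.mp hv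
    rw [coordMap_eq_chartMap v hv j (IsUnit.mk0 _ hj), coordMap_eq_chartMap _ hv' j (IsUnit.mk0 _ (mul_ne_zero hc hj)), chartMap_eq_iff]
    intro i
    simp only [Pi.smul_apply, smul_eq_mul]
    ring

theorem coordPoint_eq_iff {v v' : Fin (m + 1) → F} (hv : v ≠ 0) (hv' : v' ≠ 0) :
    coordPoint (K := K) v hv = coordPoint v' hv' ↔ ∃ c : F, c ≠ 0 ∧ v' = c • v := by
  rw [← coordMap_eq_iff (K := K) hv hv']
  exact ⟨fun h => congrArg (fun f => f.left) h, fun h => Over.OverMorphism.ext h⟩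

/-- The structure morphism of `ℙ^m`. -/
def projSpaceHom (K : Type u) [Field K] (m : ℕ) : Proj (MvPolynomial.homogeneousSubmodule (Fin (m + 1)) K) ⟶ Spec (CommRingCat.of K) :=
  (projSpace K m).hom

theorem awayι_projSpaceHom (j : Fin (m + 1)) :
    Proj.awayι 𝒜 _ (X_mem_homogeneousSubmodule K j) Nat.one_pos ≫ projSpaceHom K m =
      Spec.map (CommRingCat.ofHom (awayConst K j)) := by
  simp only [projSpaceHom, projSpace, Over.mk_hom, Proj.awayι_toSpecZero_assoc]
  rw [← Spec.map_comp, ← CommRingCat.ofHom_comp]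
  rfl

theorem coordFrac_self (j : Fin (m + 1)) : coordFrac K j j = 1 := by
  apply HomogeneousLocalization.val_injective
  have h := algebraMap_coordFrac (K := K) j j
  have hu := IsLocalization.Away.algebraMap_isUnit (S := Localization.Away (MvPolynomial.X j : MvPolynomial (Fin (m + 1)) K)) (MvPolynomial.X j : MvPolynomial (Fin (m + 1)) K)
  rw [HomogeneousLocalization.algebraMap_apply, hu.mul_eq_right] at h
  rw [h, HomogeneousLocalization.val_one]

theorem iSup_basicOpen_X : ⨆ j : Fin (m + 1), Proj.basicOpen 𝒜 (MvPolynomial.X j : MvPolynomial (Fin (m + 1)) K) = ⊤ := by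
  apply Proj.iSup_basicOpen_eq_top'
  · exact fun j => ⟨1, X_mem_homogeneousSubmodule K j⟩
  · rw [eq_top_iff]
    rintro p -
    induction p using MvPolynomial.induction_on with
    | C a =>
      exact Subalgebra.algebraMap_mem (Algebra.adjoin (MvPolynomial.homogeneousSubmodule (Fin (m + 1)) K 0) _)
        (⟨MvPolynomial.C a, MvPolynomial.isHomogeneous_C _ a⟩ : MvPolynomial.homogeneousSubmodule (Fin (m + 1)) K 0)
    | add p q hp hq => exact add_mem hp hq
    | mul_X p i hp => exact mul_mem hp (Algebra.subset_adjoin ⟨i, rfl⟩)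

/-- The spectrum of a field is one point, so the morphism lands in a single chart. The images of the
ratios X_i / X_j serve as coordinates, the `j`-th being 1. -/
theorem exists_coordPoint (f : specOver K F ⟶ projSpace K m) : ∃ v, ∃ hv : v ≠ 0, f = coordPoint v hv := by
  let g : Spec (CommRingCat.of F) ⟶ Proj 𝒜 := f.left
  let p : Spec (CommRingCat.of F) := IsLocalRing.closedPoint F
  obtain ⟨j, hj⟩ := TopologicalSpace.Opens.mem_iSup.mp ((iSup_basicOpen_X (K := K) (m := m)).ge (Set.mem_univ (g p)))
  let ι := Proj.awayι 𝒜 _ (X_mem_homogeneousSubmodule K j) Nat.one_pos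
  have hr : Set.range g ⊆ Set.range ι := by
    rintro _ ⟨q, rfl⟩
    have : q = p := Subsingleton.elim (α := PrimeSpectrum F) _ _
    rw [this]
    have h1 : g p ∈ ι.opensRange := by rw [Proj.opensRange_awayι]; exact hj
    exact h1
  let l := IsOpenImmersion.lift ι g hr
  obtain ⟨φ, hφ⟩ : ∃ φ : CommRingCat.of (Away 𝒜 (MvPolynomial.X j)) ⟶ CommRingCat.of F, l = Spec.map φ := ⟨_, (Spec.map_preimage l).symm⟩
  have hg : g = Spec.map φ ≫ ι := by rw [← hφ, IsOpenImmersion.lift_fac]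
  have hc : φ.hom.comp (awayConst K j) = algebraMap K F := by
    have hw : g ≫ projSpaceHom K m = Spec.map (CommRingCat.ofHom (algebraMap K F)) := Over.w f
    rw [hg, Category.assoc, awayι_projSpaceHom, ← Spec.map_comp, Spec.map_injective.eq_iff] at hw
    exact congrArg (fun f => f.hom) hw
  let v : Fin (m + 1) → F := fun i => φ.hom (coordFrac K i j)
  have hvj : v j = 1 := by
    change φ.hom (coordFrac K j j) = 1
    rw [coordFrac_self, map_one]
  have hv : v ≠ 0 := fun h => one_ne_zero (hvj.symm.trans (congrFun h j))
  refine ⟨v, hv, ?_⟩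
  have hu : IsUnit (v j) := by rw [hvj]; exact isUnit_one
  apply Over.OverMorphism.ext
  change g = coordMap K v hv
  rw [hg, coordMap_eq_chartMap v hv j hu, chartMap, ← eq_awayEval (φ := φ.hom) hu hc fun i => by rw [hvj, mul_one]]
  rfl

end FieldPoints

end PermQuot
end

/-! ### Rings of invariants of a finite group. -/

noncomputable section

theorem RingHom.exists_extension_of_isIntegral {A B F : Type*} [CommRing A] [CommRing B] [IsDomain B] [Field F] [IsAlgClosed F]
    (i : A →+* B) (hi : Function.Injective i) (hint : i.IsIntegral) (f : A →+* F) (hf : Function.Injective f) :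
    ∃ φ : B →+* F, φ.comp i = f := by
  algebraize [i, f]
  have : IsDomain A := hi.isDomain i
  have : FaithfulSMul A B := (faithfulSMul_iff_algebraMap_injective _ _).mpr hi
  have : FaithfulSMul A F := (faithfulSMul_iff_algebraMap_injective _ _).mpr hf
  let φ : B →ₐ[A] F := IsAlgClosed.lift
  exact ⟨φ.toRingHom, φ.comp_algebraMap⟩

namespace Algebra.IsInvariant

open Polynomial MulSemiringAction

variable {K A B F : Type*} [Field K] [CommRing A] [CommRing B] [Field F] [Algebra K A] [Algebra A B]
  (H : Type*) [Group H] [Finite H] [MulSemiringAction H B] [IsInvariant A B H]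

include H in
-- As `f` need not be injective, lying-over first provides a prime `Q` above its kernel; then the
-- embedding of A/ker f into `F` is extended to the integral extension B/Q.
theorem exists_ringHom_extension [IsAlgClosed F] (hinj : Function.Injective (algebraMap A B)) (f : A →+* F) :
    ∃ φ : B →+* F, φ.comp (algebraMap A B) = f := by
  have : Algebra.IsIntegral A B := isIntegral A B H
  have := RingHom.ker_isPrime f
  obtain ⟨Q, -, hQ, hQf⟩ := Ideal.exists_ideal_over_prime_of_isIntegral (S := B) (RingHom.ker f) ⊥ (by
    intro a ha
    rw [Ideal.mem_comap, Ideal.mem_bot] at ha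
    rw [hinj (ha.trans (map_zero _).symm)]
    exact zero_mem _)
  have hint : (Ideal.quotientMap Q (algebraMap A B) hQf.ge).IsIntegral := by
    refine RingHom.IsIntegral.tower_top (Ideal.Quotient.mk (RingHom.ker f)) _ ?_
    rw [Ideal.quotientMap_comp_mk]
    exact RingHom.IsIntegral.trans _ _ (algebraMap_isIntegral_iff.mpr inferInstance)
      (RingHom.isIntegral_of_surjective _ Ideal.Quotient.mk_surjective)
  have hinj' : Function.Injective (Ideal.quotientMap Q (algebraMap A B) hQf.ge) := Ideal.quotientMap_injective' hQf.le
  obtain ⟨φ, hφ⟩ := RingHom.exists_extension_of_isIntegral _ hinj' hint (RingHom.kerLift f) (RingHom.kerLift_injective f)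
  refine ⟨φ.comp (Ideal.Quotient.mk Q), ?_⟩
  ext a
  exact DFunLike.congr_fun hφ (Ideal.Quotient.mk _ a)

variable {H} [SMulCommClass H A B]

omit [SMulCommClass H A B] in
-- The polynomial ∏ (X - g b) has coefficients from `A`, on which `φ` and `ψ` agree, so `φ b` is one
-- of the roots `ψ (g • b)`. Here `g` still depends on `b`.
theorem exists_apply_eq_apply_smul {φ ψ : B →+* F} (h : φ.comp (algebraMap A B) = ψ.comp (algebraMap A B)) (b : B) :
    ∃ g : H, φ b = ψ (g • b) := by
  cases nonempty_fintype H
  obtain ⟨p, hp⟩ := (mem_lifts _).mp (charpoly_mem_lifts A B H b)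
  have h1 : p.eval₂ (φ.comp (algebraMap A B)) (φ b) = 0 := by
    rw [← hom_eval₂, ← Polynomial.eval_map, hp, eval_charpoly, map_zero]
  rw [h, ← eval₂_map, hp, charpoly_eq, eval₂_finsetProd, Finset.prod_eq_zero_iff] at h1
  obtain ⟨g, -, hg⟩ := h1
  exact ⟨g, by simpa [sub_eq_zero] using hg⟩

/-- The elements on which two homomorphisms with the same restriction to `A` agree. -/
def eqSubmodule (K : Type*) [Field K] [Algebra K A] [Module K B] [IsScalarTower K A B] {φ ψ : B →+* F} (h : φ.comp (algebraMap A B) = ψ.comp (algebraMap A B)) (g g' : H) : Submodule K B where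
  carrier := {b | φ (g • b) = ψ (g' • b)}
  zero_mem' := by simp
  add_mem' := by
    intro a b (ha : φ _ = _) (hb : φ _ = _)
    change φ _ = _
    rw [smul_add, smul_add, map_add, map_add, ha, hb]
  smul_mem' := by
    intro k b (hb : φ _ = _)
    change φ _ = _
    have hk := DFunLike.congr_fun h (algebraMap K A k)
    rw [RingHom.comp_apply, RingHom.comp_apply] at hk
    rw [← algebraMap_smul A k b, smul_comm g, smul_comm g', Algebra.smul_def, Algebra.smul_def, map_mul, map_mul, hb, hk]

variable (K) in
-- The subspaces on which `φ` agrees with `ψ ∘ g` are finitely many and cover `B`. Over an infinite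
-- field one of them is everything, which makes `g` independent of the element.
theorem exists_eq_comp_smul [Infinite K] [Module K B] [IsScalarTower K A B] {φ ψ : B →+* F}
    (h : φ.comp (algebraMap A B) = ψ.comp (algebraMap A B)) : ∃ g : H, ∀ b, φ b = ψ (g • b) := by
  obtain ⟨g, hg⟩ := Subspace.exists_eq_top_of_iUnion_eq_univ (p := fun g : H => eqSubmodule K h 1 g) (by
    rw [Set.eq_univ_iff_forall]
    intro b
    obtain ⟨g, hg⟩ := exists_apply_eq_apply_smul (H := H) h b
    exact Set.mem_iUnion.mpr ⟨g, by change φ ((1 : H) • b) = _; rwa [one_smul]⟩)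
  refine ⟨g, fun b => ?_⟩
  have hb : b ∈ eqSubmodule K h 1 g := hg ▸ Submodule.mem_top
  change φ ((1 : H) • b) = _ at hb
  rwa [one_smul] at hb

omit [IsInvariant A B H] in
variable (K A) in
-- The same covering argument: if no `c` separated all the conjugates of `φ`, two of these
-- conjugates would coincide on all of `B`.
theorem exists_injective_apply_smul [Infinite K] [Module K B] [IsScalarTower K A B] (φ : B →+* F)
    (h : ∀ g : H, (∀ b, φ (g • b) = φ b) → g = 1) : ∃ c : B, ∀ g g' : H, φ (g • c) = φ (g' • c) → g = g' := by
  by_contra! hc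
  let ι := {p : H × H // p.1 ≠ p.2}
  obtain ⟨⟨⟨g, g'⟩, hne⟩, hp⟩ := Subspace.exists_eq_top_of_iUnion_eq_univ (k := K) (E := B)
    (p := fun p : ι => eqSubmodule (A := A) K (rfl : φ.comp (algebraMap A B) = _) p.1.1 p.1.2) (by
    rw [Set.eq_univ_iff_forall]
    intro b
    obtain ⟨g, g', hg, hne⟩ := hc b
    exact Set.mem_iUnion.mpr ⟨⟨(g, g'), hne⟩, hg⟩)
  refine hne ?_
  have h1 : g * g'⁻¹ = 1 := h _ fun b => by
    have hb : g'⁻¹ • b ∈ eqSubmodule (A := A) K (rfl : φ.comp (algebraMap A B) = _) g g' := by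
      rw [hp]; trivial
    change φ (g • g'⁻¹ • b) = φ (g' • g'⁻¹ • b) at hb
    rwa [smul_inv_smul, ← mul_smul] at hb
  exact mul_inv_eq_one.mp h1

omit [SMulCommClass H A B] in
-- Lagrange interpolation at the conjugates of `c`. With δ = ∏_{g ≠ 1} (c - g c), a unit, P(c) = 0
-- and P'(c) = δ give dc = 0. Moreover each b δ is a polynomial in `c` over `A`, so d(b δ) = 0; the
-- case b = 1 gives dδ = 0, hence db = 0.
theorem formallyUnramified_of_isUnit_sub (c : B) (hc : ∀ g : H, g ≠ 1 → IsUnit (c - g • c)) :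
    Algebra.FormallyUnramified A B := by
  classical
  cases nonempty_fintype H
  -- Apart from the missing denominators this interpolates g c ↦ g b. It is invariant under the
  -- group, hence comes from `A[X]`, and its value at `c` is b δ.
  let N : B → B[X] := fun b => ∑ h : H, C (h • b) * ∏ g ∈ Finset.univ.erase h, (X - C (g • c))
  have hNc : ∀ b, (N b).eval c = b * ∏ g ∈ Finset.univ.erase (1 : H), (c - g • c) := by
    intro b
    rw [eval_finsetSum, Finset.sum_eq_single 1]
    · simp [eval_prod]
    · intro h _ hh
      rw [eval_mul, eval_prod, Finset.prod_eq_zero (Finset.mem_erase.mpr ⟨Ne.symm hh, Finset.mem_univ 1⟩) (by simp), mul_zero]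
    · simp
  have hNinv : ∀ b (k : H), k • N b = N b := by
    intro b k
    simp only [N, Finset.smul_sum, smul_mul', Finset.smul_prod', smul_sub, smul_X, smul_C]
    refine Fintype.sum_equiv (Equiv.mulLeft k) _ _ fun h => ?_
    rw [Equiv.coe_mulLeft, ← mul_smul]
    congr 1
    refine Finset.prod_bij (fun g _ => k * g) ?_ ?_ ?_ ?_
    · intro g hg; simpa using hg
    · intro a _ b _ hab; exact mul_left_cancel hab
    · intro g hg
      refine ⟨k⁻¹ * g, ?_, by simp⟩
      simp only [Finset.mem_erase, Finset.mem_univ, and_true, ne_eq] at hg ⊢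
      rintro rfl
      exact hg (by simp)
    · intro g _; rw [mul_smul]
  have hN : ∀ b, ∃ p : A[X], p.map (algebraMap A B) = N b := by
    intro b
    refine (mem_lifts _).mp ((lifts_iff_coeff_lifts _).mpr fun n => isInvariant (G := H) _ fun g => ?_)
    rw [← coeff_smul, hNinv]
  have hNa : ∀ b (p : A[X]), p.map (algebraMap A B) = N b → aeval c p = b * ∏ g ∈ Finset.univ.erase (1 : H), (c - g • c) := by
    intro b p hp
    rw [aeval_def, ← Polynomial.eval_map, hp, hNc]
  have hu : IsUnit (∏ g ∈ Finset.univ.erase (1 : H), (c - g • c)) :=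
    IsUnit.prod_iff.mpr fun g hg => hc g (Finset.ne_of_mem_erase hg)
  obtain ⟨P, hP⟩ := (mem_lifts _).mp (charpoly_mem_lifts A B H c)
  have hP0 : aeval c P = 0 := by
    rw [aeval_def, ← Polynomial.eval_map, hP, eval_charpoly]
  have hP1 : (derivative P).map (algebraMap A B) = N 1 := by
    rw [← derivative_map, hP, charpoly_eq, derivative_prod_finset]
    simp [N]
  let d := KaehlerDifferential.D A B
  have hdc : d c = 0 := by
    have h1 := d.map_aeval P c
    rw [hP0, map_zero, hNa 1 _ hP1, one_mul] at h1
    exact (hu.smul_eq_zero.mp h1.symm)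
  have hdN : ∀ p : A[X], d (aeval c p) = 0 := by
    intro p
    rw [d.map_aeval, hdc, smul_zero]
  have hd : ∀ b, d b = 0 := by
    intro b
    obtain ⟨p, hp⟩ := hN b
    have h1 := hdN p
    have h2 := hdN (derivative P)
    rw [hNa b p hp, d.leibniz] at h1
    rw [hNa 1 _ hP1, one_mul] at h2
    rw [h2, smul_zero, zero_add] at h1
    exact hu.smul_eq_zero.mp h1
  rw [Algebra.formallyUnramified_iff, ← Submodule.subsingleton_iff B, ← subsingleton_iff_bot_eq_top,
    ← KaehlerDifferential.span_range_derivation, eq_comm, Submodule.span_eq_bot]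
  rintro _ ⟨b, rfl⟩
  exact hd b

omit [Finite H] [SMulCommClass H A B] in
variable (A) in
-- Taken over all ordered pairs, the discriminant of the orbit of `c` has its factors merely
-- permuted by the group.
theorem exists_algebraMap_eq_prod_offDiag [Fintype H] [DecidableEq H] (c : B) :
    ∃ a : A, algebraMap A B a = ∏ p ∈ (Finset.univ : Finset H).offDiag, (p.1 • c - p.2 • c) := by
  refine isInvariant (G := H) _ fun k => ?_
  rw [Finset.smul_prod']
  refine Finset.prod_bij (fun p _ => (k * p.1, k * p.2)) ?_ ?_ ?_ ?_
  · intro p hp; simpa using hp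
  · rintro ⟨a, a'⟩ _ ⟨b, b'⟩ _ hab; simpa using hab
  · intro p hp
    exact ⟨(k⁻¹ * p.1, k⁻¹ * p.2), by simpa using hp, by simp⟩
  · intro p _; rw [smul_sub, mul_smul, mul_smul]

end Algebra.IsInvariant
end

/-! ### Affine quotients of schemes: the action on functions. -/

noncomputable section

namespace AlgebraicGeometry

theorem IsAffineOpen.exists_eq_SpecMap_comp_fromSpec {Z : Scheme.{u}} {U : Z.Opens} (hU : IsAffineOpen U) {R : CommRingCat.{u}} (g : Spec R ⟶ Z)
    (hg : ∀ p, g p ∈ U) : ∃ φ : Γ(Z, U) ⟶ R, g = Spec.map φ ≫ hU.fromSpec := by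
  have hr : Set.range g ⊆ Set.range hU.fromSpec := by
    rintro _ ⟨p, rfl⟩
    rw [hU.range_fromSpec]
    exact hg p
  exact ⟨Spec.preimage (IsOpenImmersion.lift hU.fromSpec g hr), by rw [Spec.map_preimage, IsOpenImmersion.lift_fac]⟩

theorem Scheme.Hom.appLE_eq_id {Y : Scheme.{u}} {f : Y ⟶ Y} (hf : f = 𝟙 Y) (V : Y.Opens) (e : V ≤ f ⁻¹ᵁ V) : f.appLE V V e = 𝟙 _ := by
  subst hf
  simp only [Scheme.Hom.appLE, Scheme.Hom.id_app]
  exact (Category.id_comp _).trans (Y.presheaf.map_id _)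

/-- `π : Y ⟶ X` is the affine quotient of `Y` by the right action `α` of `H`. -/
structure IsGroupQuotient {Y X : Scheme.{u}} {H : Type*} [Group H] (α : H → (Y ⟶ Y)) (π : Y ⟶ X) : Prop where
  one : α 1 = 𝟙 Y
  mul : ∀ g h, α (g * h) = α h ≫ α g
  comp_eq : ∀ h, α h ≫ π = π
  isAffineHom : IsAffineHom π
  sections : ∀ (U : X.Opens) (s : Γ(Y, π ⁻¹ᵁ U)),
    (∀ (h : H) (e : π ⁻¹ᵁ U ≤ (α h) ⁻¹ᵁ (π ⁻¹ᵁ U)), (α h).appLE (π ⁻¹ᵁ U) (π ⁻¹ᵁ U) e s = s) →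
    ∃! t : Γ(X, U), π.app U t = s

namespace IsGroupQuotient

variable {Y X : Scheme.{u}} {H : Type*} [Group H] {α : H → (Y ⟶ Y)} {π : Y ⟶ X} (hπ : IsGroupQuotient α π)

include hπ

theorem le_preimage (U : X.Opens) (h : H) : π ⁻¹ᵁ U ≤ (α h) ⁻¹ᵁ (π ⁻¹ᵁ U) := by
  rw [← Scheme.Hom.comp_preimage, hπ.comp_eq]

/-- The operators on the functions on the preimage of an open subset. -/
def sectionMap (U : X.Opens) (h : H) : Γ(Y, π ⁻¹ᵁ U) ⟶ Γ(Y, π ⁻¹ᵁ U) :=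
  (α h).appLE _ _ (hπ.le_preimage U h)

theorem sectionMap_one (U : X.Opens) : hπ.sectionMap U 1 = 𝟙 _ :=
  Scheme.Hom.appLE_eq_id hπ.one _ _

theorem sectionMap_mul (U : X.Opens) (g h : H) : hπ.sectionMap U (g * h) = hπ.sectionMap U g ≫ hπ.sectionMap U h := by
  rw [sectionMap, sectionMap, sectionMap, Scheme.Hom.appLE_comp_appLE]
  simp only [hπ.mul]

theorem app_sectionMap (U : X.Opens) (h : H) : π.app U ≫ hπ.sectionMap U h = π.app U := by
  rw [sectionMap, Scheme.Hom.app_eq_appLE, Scheme.Hom.appLE_comp_appLE]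
  simp only [hπ.comp_eq]

theorem sectionMap_res {U U' : X.Opens} (hU : U' ≤ U) (h : H) (s : Γ(Y, π ⁻¹ᵁ U)) :
    hπ.sectionMap U' h (Y.presheaf.map (homOfLE (π.preimage_mono hU)).op s) =
      Y.presheaf.map (homOfLE (π.preimage_mono hU)).op (hπ.sectionMap U h s) := by
  rw [← CategoryTheory.comp_apply, ← CategoryTheory.comp_apply, sectionMap, sectionMap, Scheme.Hom.map_appLE, Scheme.Hom.appLE_map]

/-- The action of the group on the functions on the preimage of an open subset. -/
abbrev mulSemiringAction (U : X.Opens) : MulSemiringAction H Γ(Y, π ⁻¹ᵁ U) where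
  -- Pulling back functions reverses the order of multiplication; the inverse makes this a left
  -- action.
  smul h s := hπ.sectionMap U h⁻¹ s
  one_smul s := by
    change hπ.sectionMap U 1⁻¹ s = s
    rw [inv_one, sectionMap_one]; rfl
  mul_smul g h s := by
    change hπ.sectionMap U (g * h)⁻¹ s = hπ.sectionMap U g⁻¹ (hπ.sectionMap U h⁻¹ s)
    rw [mul_inv_rev, sectionMap_mul]; rfl
  smul_zero h := map_zero (hπ.sectionMap U h⁻¹).hom
  smul_add h := map_add (hπ.sectionMap U h⁻¹).hom
  smul_one h := map_one (hπ.sectionMap U h⁻¹).hom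
  smul_mul h := map_mul (hπ.sectionMap U h⁻¹).hom

theorem app_injective (U : X.Opens) : Function.Injective (π.app U).hom := by
  intro a b hab
  obtain ⟨t, -, ht⟩ := hπ.sections U (π.app U a) fun h e =>
    congrArg (fun f => f.hom a) (hπ.app_sectionMap U h)
  rw [ht a rfl, ht b hab.symm]

theorem isInvariant (U : X.Opens) :
    letI := hπ.mulSemiringAction U
    letI := (π.app U).hom.toAlgebra
    Algebra.IsInvariant Γ(X, U) Γ(Y, π ⁻¹ᵁ U) H := by
  let := hπ.mulSemiringAction U
  let := (π.app U).hom.toAlgebra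
  refine ⟨fun s hs => ?_⟩
  obtain ⟨t, ht, -⟩ := hπ.sections U s fun h e => by
    have := hs h⁻¹
    change hπ.sectionMap U h⁻¹⁻¹ s = s at this
    rwa [inv_inv] at this
  exact ⟨t, ht⟩

theorem smulCommClass (U : X.Opens) :
    letI := hπ.mulSemiringAction U
    letI := (π.app U).hom.toAlgebra
    SMulCommClass H Γ(X, U) Γ(Y, π ⁻¹ᵁ U) := by
  let := hπ.mulSemiringAction U
  let := (π.app U).hom.toAlgebra
  refine ⟨fun h a b => ?_⟩
  rw [Algebra.smul_def, Algebra.smul_def, smul_mul']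
  congr 1
  exact congrArg (fun f => f.hom a) (hπ.app_sectionMap U h⁻¹)

section Rings

variable [Finite H] {F : Type u} [Field F] (U : X.Opens)

theorem exists_ringHom_extension [IsAlgClosed F] (f : Γ(X, U) →+* F) : ∃ φ : Γ(Y, π ⁻¹ᵁ U) →+* F, φ.comp (π.app U).hom = f := by
  let := hπ.mulSemiringAction U
  let := (π.app U).hom.toAlgebra
  have := hπ.isInvariant U
  exact Algebra.IsInvariant.exists_ringHom_extension H (hπ.app_injective U) f

theorem formallyUnramified_app (c : Γ(Y, π ⁻¹ᵁ U)) (hc : ∀ g : H, g ≠ 1 → IsUnit (c - hπ.sectionMap U g c)) :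
    (π.app U).hom.FormallyUnramified := by
  let := hπ.mulSemiringAction U
  let := (π.app U).hom.toAlgebra
  have := hπ.isInvariant U
  exact Algebra.IsInvariant.formallyUnramified_of_isUnit_sub (A := Γ(X, U)) (H := H) c fun g hg => hc g⁻¹ (inv_ne_one.mpr hg)

variable {K : Type u} [Field K] [Infinite K] (κ : K →+* Γ(X, U))

include κ

theorem exists_eq_comp_sectionMap {φ ψ : Γ(Y, π ⁻¹ᵁ U) →+* F} (h : φ.comp (π.app U).hom = ψ.comp (π.app U).hom) :
    ∃ g : H, φ = ψ.comp (hπ.sectionMap U g).hom := by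
  let := hπ.mulSemiringAction U
  let := (π.app U).hom.toAlgebra
  let := κ.toAlgebra
  let := ((π.app U).hom.comp κ).toAlgebra
  have := hπ.isInvariant U
  have := hπ.smulCommClass U
  have : IsScalarTower K Γ(X, U) Γ(Y, π ⁻¹ᵁ U) := IsScalarTower.of_algebraMap_eq' rfl
  obtain ⟨g, hg⟩ := Algebra.IsInvariant.exists_eq_comp_smul (A := Γ(X, U)) (H := H) K h
  exact ⟨g⁻¹, RingHom.ext hg⟩

/-- `c` separates the conjugates of the point `φ`, and `a` is the discriminant of its orbit. Where
`a` is invertible, all the differences `c - g c` become units. -/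
theorem exists_separating [Fintype H] [DecidableEq H] (φ : Γ(Y, π ⁻¹ᵁ U) →+* F) (h : ∀ g : H, φ.comp (hπ.sectionMap U g).hom = φ → g = 1) :
    ∃ (c : Γ(Y, π ⁻¹ᵁ U)) (a : Γ(X, U)), φ (π.app U a) ≠ 0 ∧ ∀ g : H, g ≠ 1 → (c - hπ.sectionMap U g c) ∣ π.app U a := by
  let := hπ.mulSemiringAction U
  let := (π.app U).hom.toAlgebra
  let := κ.toAlgebra
  let := ((π.app U).hom.comp κ).toAlgebra
  have := hπ.isInvariant U
  have := hπ.smulCommClass U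
  have : IsScalarTower K Γ(X, U) Γ(Y, π ⁻¹ᵁ U) := IsScalarTower.of_algebraMap_eq' rfl
  obtain ⟨c, hc⟩ := Algebra.IsInvariant.exists_injective_apply_smul K Γ(X, U) (H := H) φ fun g hg =>
    inv_eq_one.mp (h g⁻¹ (RingHom.ext hg))
  obtain ⟨a, ha⟩ := Algebra.IsInvariant.exists_algebraMap_eq_prod_offDiag Γ(X, U) (H := H) c
  refine ⟨c, a, ?_, fun g hg => ?_⟩
  · change φ (algebraMap _ _ a) ≠ 0
    rw [ha, map_prod, Finset.prod_ne_zero_iff]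
    intro p hp
    rw [map_sub, sub_ne_zero]
    exact fun he => (Finset.mem_offDiag.mp hp).2.2 (hc _ _ he)
  · change _ ∣ algebraMap _ _ a
    rw [ha]
    have h1 := Finset.dvd_prod_of_mem (fun p : H × H => p.1 • c - p.2 • c) (a := (1, g⁻¹)) (s := (Finset.univ : Finset H).offDiag) (by
      simpa [eq_comm] using hg)
    have h2 : (g⁻¹ : H) • c = hπ.sectionMap U g c := by
      change hπ.sectionMap U g⁻¹⁻¹ c = _
      rw [inv_inv]
    simp only [one_smul, h2] at h1
    exact h1

end Rings

end IsGroupQuotient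

end AlgebraicGeometry
end

/-! ### Geometric and rational points of a quotient. -/

noncomputable section

namespace AlgebraicGeometry

theorem Scheme.exists_affine_mem (X : Scheme.{u}) (p : X) : ∃ U : X.Opens, IsAffineOpen U ∧ p ∈ U := by
  obtain ⟨_, ⟨U, hU, rfl⟩, hpU, -⟩ := X.isBasis_affineOpens.exists_subset_of_mem_open (Set.mem_univ p) isOpen_univ
  exact ⟨U, hU, hpU⟩

/-- Functions coming from the base field. -/
def Scheme.constHom {K : Type u} [Field K] {X : Scheme.{u}} (s : X ⟶ Spec (CommRingCat.of K)) (U : X.Opens) : K →+* Γ(X, U) :=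
  (s.appLE ⊤ U le_top).hom.comp (Scheme.ΓSpecIso (CommRingCat.of K)).inv.hom

section Field

variable {F : Type u} [Field F] {X : Scheme.{u}}

/-- The point of the spectrum of a field. -/
def fieldPoint (F : Type u) [Field F] : Spec (CommRingCat.of F) := IsLocalRing.closedPoint F

theorem eq_fieldPoint (p : Spec (CommRingCat.of F)) : p = fieldPoint F :=
  Subsingleton.elim (α := PrimeSpectrum F) _ _

theorem exists_eq_comp_fromSpec_of_field (g : Spec (CommRingCat.of F) ⟶ X) {U : X.Opens} (hU : IsAffineOpen U) (h : g (fieldPoint F) ∈ U) :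
    ∃ φ : Γ(X, U) →+* F, g = Spec.map (CommRingCat.ofHom φ) ≫ hU.fromSpec := by
  obtain ⟨φ, hφ⟩ := hU.exists_eq_SpecMap_comp_fromSpec g fun p => by rw [eq_fieldPoint p]; exact h
  exact ⟨φ.hom, hφ⟩

theorem SpecMap_comp_fromSpec_inj {R : CommRingCat.{u}} {U : X.Opens} (hU : IsAffineOpen U) {φ ψ : Γ(X, U) ⟶ R} :
    Spec.map φ ≫ hU.fromSpec = Spec.map ψ ≫ hU.fromSpec ↔ φ = ψ := by
  rw [cancel_mono, Spec.map_injective.eq_iff]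

variable {K Ω : Type u} [Field K] [Field Ω] [Algebra K Ω]

theorem eq_of_SpecMap_algebraMap_comp_eq {x x' : Spec (CommRingCat.of K) ⟶ X}
    (h : Spec.map (CommRingCat.ofHom (algebraMap K Ω)) ≫ x = Spec.map (CommRingCat.ofHom (algebraMap K Ω)) ≫ x') : x = x' := by
  have hp : x (fieldPoint K) = x' (fieldPoint K) := by
    have h1 := congrArg (fun f => f (fieldPoint Ω)) h
    change x (Spec.map (CommRingCat.ofHom (algebraMap K Ω)) (fieldPoint Ω)) = x' (Spec.map (CommRingCat.ofHom (algebraMap K Ω)) (fieldPoint Ω)) at h1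
    rwa [eq_fieldPoint (Spec.map (CommRingCat.ofHom (algebraMap K Ω)) (fieldPoint Ω))] at h1
  obtain ⟨U, hU, hxU⟩ := X.exists_affine_mem (x (fieldPoint K))
  obtain ⟨a, rfl⟩ := exists_eq_comp_fromSpec_of_field x hU hxU
  obtain ⟨b, rfl⟩ := exists_eq_comp_fromSpec_of_field x' hU (hp ▸ hxU)
  rw [← Spec.map_comp_assoc, ← Spec.map_comp_assoc, SpecMap_comp_fromSpec_inj] at h
  have hab : a = b := RingHom.ext fun s => (algebraMap K Ω).injective (congrArg (fun f => f.hom s) h)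
  rw [hab]

/-- Galois descent: functions near the image point take Galois-fixed values, and these lie in `K`.
-/
theorem exists_eq_SpecMap_algebraMap_comp [IsGalois K Ω] (g : Spec (CommRingCat.of Ω) ⟶ X)
    (hg : ∀ τ : Gal(Ω/K), Spec.map (CommRingCat.ofHom (τ : Ω →+* Ω)) ≫ g = g) :
    ∃ x : Spec (CommRingCat.of K) ⟶ X, g = Spec.map (CommRingCat.ofHom (algebraMap K Ω)) ≫ x := by
  obtain ⟨U, hU, hxU⟩ := X.exists_affine_mem (g (fieldPoint Ω))
  obtain ⟨f, rfl⟩ := exists_eq_comp_fromSpec_of_field g hU hxU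
  have hf : ∀ s, ∃ a, algebraMap K Ω a = f s := by
    intro s
    refine (InfiniteGalois.mem_range_algebraMap_iff_fixed (k := K) (f s)).mpr fun τ => ?_
    have h1 := hg τ
    rw [← Spec.map_comp_assoc, SpecMap_comp_fromSpec_inj] at h1
    exact congrArg (fun f => f.hom s) h1
  choose a ha using hf
  let φ : Γ(X, U) →+* K :=
    { toFun := a
      map_one' := (algebraMap K Ω).injective (by rw [ha, map_one, map_one])
      map_zero' := (algebraMap K Ω).injective (by rw [ha, map_zero, map_zero])
      map_add' := fun s t => (algebraMap K Ω).injective (by rw [ha, map_add, map_add, ha, ha])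
      map_mul' := fun s t => (algebraMap K Ω).injective (by rw [ha, map_mul, map_mul, ha, ha]) }
  refine ⟨Spec.map (CommRingCat.ofHom φ) ≫ hU.fromSpec, ?_⟩
  rw [← Spec.map_comp_assoc, SpecMap_comp_fromSpec_inj]
  ext s
  exact (ha s).symm

end Field

namespace IsGroupQuotient

variable {Y X : Scheme.{u}} {H : Type*} [Group H] {α : H → (Y ⟶ Y)} {π : Y ⟶ X} (hπ : IsGroupQuotient α π)

include hπ

theorem isAffineOpen_preimage {U : X.Opens} (hU : IsAffineOpen U) : IsAffineOpen (π ⁻¹ᵁ U) :=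
  have := hπ.isAffineHom
  hU.preimage π

theorem SpecMap_fromSpec_comp_proj {U : X.Opens} (hU : IsAffineOpen U) {R : CommRingCat.{u}} (φ : Γ(Y, π ⁻¹ᵁ U) ⟶ R) :
    (Spec.map φ ≫ (hπ.isAffineOpen_preimage hU).fromSpec) ≫ π = Spec.map (π.app U ≫ φ) ≫ hU.fromSpec := by
  rw [Category.assoc, ← hU.SpecMap_appLE_fromSpec π (hπ.isAffineOpen_preimage hU) le_rfl, Scheme.Hom.app_eq_appLE, Spec.map_comp, Category.assoc]

theorem SpecMap_fromSpec_comp_act {U : X.Opens} (hU : IsAffineOpen U) {R : CommRingCat.{u}} (φ : Γ(Y, π ⁻¹ᵁ U) ⟶ R) (h : H) :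
    (Spec.map φ ≫ (hπ.isAffineOpen_preimage hU).fromSpec) ≫ α h = Spec.map (hπ.sectionMap U h ≫ φ) ≫ (hπ.isAffineOpen_preimage hU).fromSpec := by
  rw [Category.assoc, ← (hπ.isAffineOpen_preimage hU).SpecMap_appLE_fromSpec (α h) (hπ.isAffineOpen_preimage hU) (hπ.le_preimage U h), sectionMap, Spec.map_comp, Category.assoc]

variable [Finite H] {F : Type u} [Field F]

theorem exists_lift [IsAlgClosed F] (x : Spec (CommRingCat.of F) ⟶ X) : ∃ y : Spec (CommRingCat.of F) ⟶ Y, y ≫ π = x := by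
  obtain ⟨U, hU, hxU⟩ := X.exists_affine_mem (x (fieldPoint F))
  obtain ⟨f, rfl⟩ := exists_eq_comp_fromSpec_of_field x hU hxU
  obtain ⟨φ, hφ⟩ := hπ.exists_ringHom_extension U f
  refine ⟨Spec.map (CommRingCat.ofHom φ) ≫ (hπ.isAffineOpen_preimage hU).fromSpec, ?_⟩
  rw [hπ.SpecMap_fromSpec_comp_proj hU, SpecMap_comp_fromSpec_inj, ← hφ]
  rfl

variable {K : Type u} [Field K] [Infinite K] (s : X ⟶ Spec (CommRingCat.of K))

include s

/-- The morphism `s` makes the rings of functions algebras over the infinite field `K`, as needed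
for the covering by subspaces. -/
theorem exists_eq_comp_act {y y' : Spec (CommRingCat.of F) ⟶ Y} (h : y ≫ π = y' ≫ π) : ∃ g : H, y = y' ≫ α g := by
  obtain ⟨U, hU, hxU⟩ := X.exists_affine_mem ((y ≫ π) (fieldPoint F))
  have hxU' := hxU
  rw [h] at hxU'
  obtain ⟨φ, rfl⟩ := exists_eq_comp_fromSpec_of_field y (hπ.isAffineOpen_preimage hU) hxU
  obtain ⟨ψ, rfl⟩ := exists_eq_comp_fromSpec_of_field y' (hπ.isAffineOpen_preimage hU) hxU'
  rw [hπ.SpecMap_fromSpec_comp_proj hU, hπ.SpecMap_fromSpec_comp_proj hU, SpecMap_comp_fromSpec_inj] at h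
  obtain ⟨g, hg⟩ := hπ.exists_eq_comp_sectionMap U (Scheme.constHom s U) (congrArg (fun f => f.hom) h)
  refine ⟨g, ?_⟩
  rw [hπ.SpecMap_fromSpec_comp_act hU, SpecMap_comp_fromSpec_inj]
  exact CommRingCat.hom_ext hg

/-- A trivial stabilizer yields a function with distinct conjugates at `y`. On the basic open set of
its discriminant the differences of conjugates are units, so the quotient map is unramified there.
-/
theorem exists_formallyUnramified (y : Spec (CommRingCat.of F) ⟶ Y) (hy : ∀ g : H, y ≫ α g = y → g = 1) :
    ∃ U : X.Opens, (y ≫ π) (fieldPoint F) ∈ U ∧ FormallyUnramified (π ∣_ U) := by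
  classical
  cases nonempty_fintype H
  obtain ⟨U, hU, hxU⟩ := X.exists_affine_mem ((y ≫ π) (fieldPoint F))
  obtain ⟨φ, rfl⟩ := exists_eq_comp_fromSpec_of_field y (hπ.isAffineOpen_preimage hU) hxU
  obtain ⟨c, a, ha, hc⟩ := hπ.exists_separating U (Scheme.constHom s U) φ fun g hg => hy g (by
    rw [hπ.SpecMap_fromSpec_comp_act hU, SpecMap_comp_fromSpec_inj]
    exact CommRingCat.hom_ext hg)
  have hU' : IsAffineOpen (X.basicOpen a) := hU.basicOpen a
  have hle : X.basicOpen a ≤ U := X.basicOpen_le a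
  refine ⟨X.basicOpen a, ?_, ?_⟩
  · rw [hπ.SpecMap_fromSpec_comp_proj hU]
    change hU.fromSpec (Spec.map (π.app U ≫ CommRingCat.ofHom φ) (fieldPoint F)) ∈ X.basicOpen a
    change _ ∈ hU.fromSpec ⁻¹ᵁ X.basicOpen a
    rw [hU.fromSpec_preimage_basicOpen]
    intro h0
    exact ha ((Ideal.mem_bot (R := F)).mp (by
      have : fieldPoint F = (⊥ : PrimeSpectrum F) := Subsingleton.elim (α := PrimeSpectrum F) _ _
      rw [this] at h0
      exact h0))
  · have hun : (π.app (X.basicOpen a)).hom.FormallyUnramified := by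
      refine hπ.formallyUnramified_app _ (Y.presheaf.map (homOfLE (π.preimage_mono hle)).op c) fun g hg => ?_
      rw [hπ.sectionMap_res hle, ← map_sub]
      refine isUnit_of_dvd_unit (map_dvd (Y.presheaf.map (homOfLE (π.preimage_mono hle)).op).hom (hc g hg)) ?_
      have h1 : Y.presheaf.map (homOfLE (π.preimage_mono hle)).op (π.app U a) = π.app (X.basicOpen a) (X.presheaf.map (homOfLE hle).op a) := by
        rw [← CategoryTheory.comp_apply, ← CategoryTheory.comp_apply, Scheme.Hom.naturality]
        rfl
      refine h1 ▸ IsUnit.map (π.app (X.basicOpen a)).hom ?_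
      exact RingedSpace.isUnit_res_basicOpen _ a
    have : IsAffine (X.basicOpen a : Scheme.{u}) := hU'
    have : IsAffine (π ⁻¹ᵁ X.basicOpen a : Scheme.{u}) := hπ.isAffineOpen_preimage hU'
    rw [HasRingHomProperty.iff_of_isAffine (P := @FormallyUnramified), Scheme.Hom.appTop, Scheme.Hom.app_eq_appLE, morphismRestrict_appLE]
    -- The restricted morphism is expressed through images of `⊤`, which are only propositionally
    -- equal to the intended open sets.
    have key : ∀ (U' : X.Opens) (V' : Y.Opens) (e : V' ≤ π ⁻¹ᵁ U'), U' = X.basicOpen a → V' = π ⁻¹ᵁ X.basicOpen a →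
        (π.appLE U' V' e).hom.FormallyUnramified := by
      rintro _ _ e rfl rfl
      rwa [Scheme.Hom.app_eq_appLE] at hun
    exact key _ _ _ (Scheme.Opens.ι_image_top _) (Scheme.Opens.ι_image_top _)

end IsGroupQuotient

end AlgebraicGeometry
end

/-! ### Uniqueness of infinitesimal lifts over the unramified locus. -/

noncomputable section

namespace AlgebraicGeometry

theorem isNilpotent_ker_SpecMap {R S : CommRingCat.{u}} (φ : R ⟶ S) (h : ∀ a b : R, φ.hom a = 0 → φ.hom b = 0 → a * b = 0) :
    IsNilpotent (Spec.map φ).ker := by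
  refine ⟨2, Scheme.IdealSheafData.ext_of_isAffine ?_⟩
  rw [Scheme.IdealSheafData.ideal_pow, Pi.pow_apply, Scheme.Hom.ker_apply, pow_two]
  refine le_antisymm (Ideal.mul_le.mpr fun a ha b hb => ?_) bot_le
  have key : ∀ a, a ∈ RingHom.ker ((Spec.map φ).app ⊤).hom → φ.hom ((Scheme.ΓSpecIso R).hom a) = 0 := by
    intro a ha
    have h1 := congrArg (fun f => f.hom a) (Scheme.ΓSpecIso_naturality φ)
    refine h1.symm.trans ?_
    change (Scheme.ΓSpecIso S).hom ((Spec.map φ).app ⊤ a) = 0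
    exact (congrArg (Scheme.ΓSpecIso S).hom.hom (show (Spec.map φ).app ⊤ a = 0 from ha)).trans (map_zero (Scheme.ΓSpecIso S).hom.hom)
  have h2 := h _ _ (key a ha) (key b hb)
  rw [← map_mul] at h2
  have h3 := congrArg (Scheme.ΓSpecIso R).inv h2
  rw [map_zero] at h3
  change a * b = 0
  rw [← h3, ← CategoryTheory.comp_apply, Iso.hom_inv_id, CategoryTheory.id_apply]

theorem eq_of_formallyUnramified_restrict {Y X : Scheme.{u}} {π : Y ⟶ X} {U : X.Opens} (hU : FormallyUnramified (π ∣_ U))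
    {R S : CommRingCat.{u}} (φ : R ⟶ S) (hφ : Function.Surjective φ) (h : ∀ a b : R, φ.hom a = 0 → φ.hom b = 0 → a * b = 0)
    {g₁ g₂ : Spec R ⟶ Y} (hg : Spec.map φ ≫ g₁ = Spec.map φ ≫ g₂) (hπ : g₁ ≫ π = g₂ ≫ π) (hmem : ∀ p : Spec S, (Spec.map φ ≫ g₁ ≫ π) p ∈ U) :
    g₁ = g₂ := by
  have : IsClosedImmersion (Spec.map φ) := IsClosedImmersion.spec_of_surjective φ hφ
  -- The kernel has square zero and so lies in every prime: both spectra have the same points, and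
  -- it suffices to know on `Spec S` that the image lies in `U`.
  have hs : ∀ q : Spec R, ∃ p, Spec.map φ p = q := by
    intro q
    have h1 : RingHom.ker φ.hom ≤ q.asIdeal := fun a ha =>
      q.2.mem_of_pow_mem 2 (by rw [pow_two, h a a ha ha]; exact zero_mem _)
    have h2 := range_comap_of_surjective _ φ.hom hφ
    obtain ⟨p, hp⟩ := (h2.ge h1 : q ∈ Set.range (PrimeSpectrum.comap φ.hom))
    exact ⟨p, hp⟩
  have hm : ∀ q : Spec R, (g₁ ≫ π) q ∈ U := by
    intro q
    obtain ⟨p, rfl⟩ := hs q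
    exact hmem p
  have hr : ∀ g : Spec R ⟶ Y, (∀ q, (g ≫ π) q ∈ U) → Set.range g ⊆ Set.range (π ⁻¹ᵁ U).ι := by
    rintro g hg _ ⟨q, rfl⟩
    rw [Scheme.Opens.range_ι]
    exact hg q
  let l₁ := IsOpenImmersion.lift (π ⁻¹ᵁ U).ι g₁ (hr g₁ hm)
  let l₂ := IsOpenImmersion.lift (π ⁻¹ᵁ U).ι g₂ (hr g₂ (hπ ▸ hm))
  have h1 : l₁ ≫ (π ⁻¹ᵁ U).ι = g₁ := IsOpenImmersion.lift_fac _ _ _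
  have h2 : l₂ ≫ (π ⁻¹ᵁ U).ι = g₂ := IsOpenImmersion.lift_fac _ _ _
  have hl : l₁ = l₂ := FormallyUnramified.hom_ext (Spec.map φ) (isNilpotent_ker_SpecMap φ h) (π ∣_ U)
    (by rw [← cancel_mono (π ⁻¹ᵁ U).ι, Category.assoc, Category.assoc, h1, h2, hg])
    (by rw [← cancel_mono U.ι, Category.assoc, Category.assoc, morphismRestrict_ι, reassoc_of% h1, reassoc_of% h2, hπ])
  rw [← h1, ← h2, hl]

end AlgebraicGeometry

/-! ### Geometric points of the power of projective space, in coordinates. -/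

namespace PermQuot

variable {K : Type u} [Field K] {m n : ℕ}

section Coordinates

variable {F : Type u} [Field F] [Algebra K F]

theorem coordPowerPoint_π (y : Fin n → Fin (m + 1) → F) (hy : ∀ i, y i ≠ 0) (i : Fin n) :
    coordPowerPoint (K := K) y hy ≫ Pi.π (fun _ : Fin n => projSpace K m) i = coordPoint (y i) (hy i) :=
  limit.lift_π _ _

theorem coordPowerPoint_eq_iff {y y' : Fin n → Fin (m + 1) → F} (hy : ∀ i, y i ≠ 0) (hy' : ∀ i, y' i ≠ 0) :
    coordPowerPoint (K := K) y hy = coordPowerPoint y' hy' ↔ ∀ i, ∃ c : F, c ≠ 0 ∧ y' i = c • y i := by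
  constructor
  · intro h i
    rw [← coordPoint_eq_iff (K := K) (hy i) (hy' i), ← coordPowerPoint_π y hy, ← coordPowerPoint_π y' hy', h]
  · intro h
    refine Pi.hom_ext _ _ fun i => ?_
    rw [coordPowerPoint_π, coordPowerPoint_π, coordPoint_eq_iff]
    exact h i

theorem exists_coordPowerPoint (f : specOver K F ⟶ projPower K m n) : ∃ y, ∃ hy : ∀ i, y i ≠ 0, f = coordPowerPoint y hy := by
  choose y hy h using fun i => exists_coordPoint (f ≫ Pi.π (fun _ : Fin n => projSpace K m) i)
  refine ⟨y, hy, Pi.hom_ext _ _ fun i => ?_⟩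
  rw [coordPowerPoint_π, h]

theorem permAction_π (σ : Equiv.Perm (Fin n)) (i : Fin n) :
    permAction K m n σ ≫ Pi.π (fun _ : Fin n => projSpace K m) i = Pi.π (fun _ : Fin n => projSpace K m) (σ⁻¹ i) :=
  limit.lift_π _ _

theorem coordPowerPoint_permAction (y : Fin n → Fin (m + 1) → F) (hy : ∀ i, y i ≠ 0) (σ : Equiv.Perm (Fin n)) :
    coordPowerPoint (K := K) y hy ≫ permAction K m n σ = coordPowerPoint (fun i => y (σ⁻¹ i)) fun _ => hy _ := by
  refine Pi.hom_ext _ _ fun i => ?_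
  rw [Category.assoc, permAction_π, coordPowerPoint_π, coordPowerPoint_π]

/-- The morphism of spectra over `K` given by a homomorphism of extensions of `K`. -/
def specOverMap {F' : Type u} [Field F'] [Algebra K F'] (τ : F →ₐ[K] F') : specOver K F' ⟶ specOver K F := specAlgMap τ

theorem specOverMap_coordPoint {F' : Type u} [Field F'] [Algebra K F'] (τ : F →ₐ[K] F') (v : Fin (m + 1) → F) (hv : v ≠ 0)
    (hv' : (fun j => τ (v j)) ≠ 0) : specOverMap τ ≫ coordPoint v hv = coordPoint (fun j => τ (v j)) hv' := by
  obtain ⟨j, hj⟩ := Function.ne_iff.mp hv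
  have hj : IsUnit (v j) := IsUnit.mk0 _ hj
  rw [coordPoint_eq_ringPoint _ hv' j (hj.map τ), coordPoint_eq_ringPoint v hv j hj]
  exact specAlgMap_ringPoint τ v j hj

theorem map_ne_zero_of_ne_zero {F' : Type u} [Field F'] [Algebra K F'] (τ : F →ₐ[K] F') {v : Fin (m + 1) → F} (hv : v ≠ 0) : (fun j => τ (v j)) ≠ 0 := by
  obtain ⟨j, hj⟩ := Function.ne_iff.mp hv
  exact fun h => hj (τ.toRingHom.injective ((congrFun h j).trans (map_zero τ).symm))

theorem specOverMap_coordPowerPoint {F' : Type u} [Field F'] [Algebra K F'] (τ : F →ₐ[K] F') (y : Fin n → Fin (m + 1) → F) (hy : ∀ i, y i ≠ 0) :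
    specOverMap τ ≫ coordPowerPoint y hy = coordPowerPoint (fun i j => τ (y i j)) fun i => map_ne_zero_of_ne_zero τ (hy i) := by
  refine Pi.hom_ext _ _ fun i => ?_
  rw [coordPowerPoint_π, Category.assoc, coordPowerPoint_π, specOverMap_coordPoint]

end Coordinates

/-- Two tuples of homogeneous coordinates represent the same point of `(ℙ^m)^n`. -/
def SamePoint {F : Type*} [Field F] (y y' : Fin n → Fin (m + 1) → F) : Prop :=
  ∀ i, ∃ c : F, c ≠ 0 ∧ y' i = c • y i

section Lift

theorem isGroupQuotient (Q : PermQuotients K m n) (G : Subgroup (Equiv.Perm (Fin n))) :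
    IsGroupQuotient (fun σ : G => (permAction K m n σ.1).left) (Q.proj G).left where
  one := by
    change (permAction K m n 1).left = _
    rw [map_one]; rfl
  mul g h := by
    change (permAction K m n (g.1 * h.1)).left = _
    rw [map_mul]; rfl
  comp_eq h := congrArg (fun f => f.left) ((Q.isQuotientBy G).invariant h)
  isAffineHom := (Q.isQuotientBy G).isAffineHom
  sections := (Q.isQuotientBy G).sections

theorem mkIdTerminal_from_left (F : Type u) [Field F] [Algebra K F] :
    (Over.mkIdTerminal.from (specOver K F)).left = Spec.map (CommRingCat.ofHom (algebraMap K F)) :=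
  (Category.comp_id _).symm.trans (Over.w (Over.mkIdTerminal.from (specOver K F)))

variable {Q : PermQuotients K m n} {G : Subgroup (Equiv.Perm (Fin n))}

local notation "Ω" => AlgebraicClosure K

/-- The morphism of schemes underlying a point over the algebraic closure. -/
def powerMap (y : Fin n → Fin (m + 1) → Ω) (hy : ∀ i, y i ≠ 0) : Spec (CommRingCat.of Ω) ⟶ (projPower K m n).left :=
  (coordPowerPoint (K := K) y hy).left

/-- The morphism of schemes underlying a rational point. -/
def ratMap (x : RatPoint (Q.quot G)) : Spec (CommRingCat.of K) ⟶ (Q.quot G).left := x.left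

theorem isLift_iff (x : RatPoint (Q.quot G)) (y : Fin n → Fin (m + 1) → Ω) :
    IsLift Q G x y ↔ ∃ hy : ∀ i, y i ≠ 0, powerMap y hy ≫ (Q.proj G).left = Spec.map (CommRingCat.ofHom (algebraMap K Ω)) ≫ ratMap x := by
  refine exists_congr fun hy => ⟨fun h => ?_, fun h => ?_⟩
  · have := congrArg (fun f => f.left) h
    rw [Over.comp_left, Over.comp_left, mkIdTerminal_from_left] at this
    exact this
  · apply Over.OverMorphism.ext
    rw [Over.comp_left, Over.comp_left, mkIdTerminal_from_left]
    exact h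

theorem IsLift.ne_zero {x : RatPoint (Q.quot G)} {y : Fin n → Fin (m + 1) → Ω} (h : IsLift Q G x y) (i : Fin n) : y i ≠ 0 := h.1 i

theorem powerMap_eq_iff {y y' : Fin n → Fin (m + 1) → Ω} (hy : ∀ i, y i ≠ 0) (hy' : ∀ i, y' i ≠ 0) :
    powerMap y hy = powerMap y' hy' ↔ SamePoint y y' := by
  refine Iff.trans ?_ (coordPowerPoint_eq_iff (K := K) hy hy')
  exact ⟨fun h => Over.OverMorphism.ext h, fun h => congrArg (fun f => f.left) h⟩

theorem powerMap_permAction (y : Fin n → Fin (m + 1) → Ω) (hy : ∀ i, y i ≠ 0) (σ : Equiv.Perm (Fin n)) :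
    powerMap y hy ≫ (permAction K m n σ).left = powerMap (fun i => y (σ⁻¹ i)) fun _ => hy _ :=
  congrArg (fun f => f.left) (coordPowerPoint_permAction (K := K) y hy σ)

theorem SpecMap_powerMap (τ : Ω →ₐ[K] Ω) (y : Fin n → Fin (m + 1) → Ω) (hy : ∀ i, y i ≠ 0) :
    Spec.map (CommRingCat.ofHom τ.toRingHom) ≫ powerMap y hy = powerMap (fun i j => τ (y i j)) fun i => map_ne_zero_of_ne_zero τ (hy i) :=
  congrArg (fun f => f.left) (specOverMap_coordPowerPoint τ y hy)

theorem exists_powerMap (f : Spec (CommRingCat.of Ω) ⟶ (projPower K m n).left)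
    (hf : f ≫ (projPower K m n).hom = Spec.map (CommRingCat.ofHom (algebraMap K Ω))) : ∃ y, ∃ hy : ∀ i, y i ≠ 0, f = powerMap y hy := by
  let f' : specOver K Ω ⟶ projPower K m n := Over.homMk f hf
  obtain ⟨y, hy, h⟩ := exists_coordPowerPoint f'
  exact ⟨y, hy, congrArg (fun f => f.left) h⟩

end Lift

end PermQuot
end

/-! ### Lifts of rational points of the quotient. -/

noncomputable section

namespace PermQuot

section SamePoint

variable {F : Type*} [Field F] {m n : ℕ}

theorem SamePoint.refl (y : Fin n → Fin (m + 1) → F) : SamePoint y y := fun i => ⟨1, one_ne_zero, by rw [one_smul]⟩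

theorem SamePoint.symm {y y' : Fin n → Fin (m + 1) → F} (h : SamePoint y y') : SamePoint y' y := fun i => by
  obtain ⟨c, hc, hi⟩ := h i
  exact ⟨c⁻¹, inv_ne_zero hc, by rw [hi, inv_smul_smul₀ hc]⟩

theorem SamePoint.trans {y y' y'' : Fin n → Fin (m + 1) → F} (h : SamePoint y y') (h' : SamePoint y' y'') : SamePoint y y'' := fun i => by
  obtain ⟨c, hc, hi⟩ := h i
  obtain ⟨c', hc', hi'⟩ := h' i
  exact ⟨c' * c, mul_ne_zero hc' hc, by rw [hi', hi, mul_smul]⟩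

theorem SamePoint.perm {y y' : Fin n → Fin (m + 1) → F} (h : SamePoint y y') (σ : Fin n → Fin n) :
    SamePoint (fun i => y (σ i)) (fun i => y' (σ i)) := fun i => h (σ i)

theorem SamePoint.map {F' : Type*} [Field F'] (τ : F →+* F') {y y' : Fin n → Fin (m + 1) → F} (h : SamePoint y y') :
    SamePoint (fun i j => τ (y i j)) (fun i j => τ (y' i j)) := fun i => by
  obtain ⟨c, hc, hi⟩ := h i
  exact ⟨τ c, (map_ne_zero τ).mpr hc, funext fun j => by simp [hi]⟩

theorem SamePoint.ne_zero {y y' : Fin n → Fin (m + 1) → F} (h : SamePoint y y') (hy : ∀ i, y i ≠ 0) (i : Fin n) : y' i ≠ 0 := by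
  obtain ⟨c, hc, hi⟩ := h i
  rw [hi]
  exact smul_ne_zero hc (hy i)

end SamePoint

variable {K : Type u} [Field K] {m n : ℕ}


section Lifts

variable {Q : PermQuotients K m n} {G : Subgroup (Equiv.Perm (Fin n))} {x : RatPoint (Q.quot G)} {y y' : Fin n → Fin (m + 1) → AlgebraicClosure K}

theorem exists_isLift (x : RatPoint (Q.quot G)) : ∃ y, IsLift Q G x y := by
  obtain ⟨f, hf⟩ := (isGroupQuotient Q G).exists_lift (Spec.map (CommRingCat.ofHom (algebraMap K (AlgebraicClosure K))) ≫ ratMap x)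
  have hx : ratMap x ≫ (Q.quot G).hom = 𝟙 _ := Over.w x
  obtain ⟨y, hy, rfl⟩ := exists_powerMap f (by
    rw [← Over.w (Q.proj G), reassoc_of% hf, hx, Category.comp_id])
  exact ⟨y, (isLift_iff x y).mpr ⟨hy, hf⟩⟩

theorem IsLift.samePoint (h : IsLift Q G x y) (h' : SamePoint y y') : IsLift Q G x y' := by
  obtain ⟨hy, h⟩ := (isLift_iff x y).mp h
  refine (isLift_iff x y').mpr ⟨h'.ne_zero hy, ?_⟩
  rw [← (powerMap_eq_iff hy _).mpr h', h]

theorem IsLift.perm (h : IsLift Q G x y) {σ : Equiv.Perm (Fin n)} (hσ : σ ∈ G) : IsLift Q G x (fun i => y (σ i)) := by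
  obtain ⟨hy, h⟩ := (isLift_iff x y).mp h
  refine (isLift_iff x _).mpr ⟨fun i => hy _, ?_⟩
  have h1 := powerMap_permAction y hy σ⁻¹
  have h2 := (isGroupQuotient Q G).comp_eq (⟨σ⁻¹, inv_mem hσ⟩ : G)
  simp only [inv_inv] at h1
  rw [← h1, Category.assoc, ← h]
  exact congrArg (powerMap y hy ≫ ·) h2

theorem IsLift.map (h : IsLift Q G x y) (τ : AlgebraicClosure K →ₐ[K] AlgebraicClosure K) : IsLift Q G x (fun i j => τ (y i j)) := by
  obtain ⟨hy, h⟩ := (isLift_iff x y).mp h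
  refine (isLift_iff x _).mpr ⟨fun i => map_ne_zero_of_ne_zero τ (hy i), ?_⟩
  rw [← SpecMap_powerMap τ y hy, Category.assoc, h, ← Category.assoc, ← Spec.map_comp, ← CommRingCat.ofHom_comp]
  congr 3
  exact τ.comp_algebraMap

theorem IsLift.exists_perm [Infinite K] (h : IsLift Q G x y) (h' : IsLift Q G x y') : ∃ σ ∈ G, SamePoint (fun i => y (σ i)) y' := by
  obtain ⟨hy, h⟩ := (isLift_iff x y).mp h
  obtain ⟨hy', h'⟩ := (isLift_iff x y').mp h'
  obtain ⟨g, hg⟩ := (isGroupQuotient Q G).exists_eq_comp_act (Q.quot G).hom (h'.trans h.symm)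
  rw [powerMap_permAction, powerMap_eq_iff] at hg
  exact ⟨g.1⁻¹, inv_mem g.2, hg.symm⟩

theorem IsLift.unique {x' : RatPoint (Q.quot G)} (h : IsLift Q G x y) (h' : IsLift Q G x' y) : x = x' := by
  obtain ⟨hy, h⟩ := (isLift_iff x y).mp h
  obtain ⟨_, h'⟩ := (isLift_iff x' y).mp h'
  exact Over.OverMorphism.ext (eq_of_SpecMap_algebraMap_comp_eq (x := ratMap x) (x' := ratMap x') (h.symm.trans h'))

/-- If Galois moves `y` only inside its orbit under `G`, its image in the quotient is Galois-fixed,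
hence rational. -/
theorem exists_isLift_of_galois [CharZero K] (Q : PermQuotients K m n) (G : Subgroup (Equiv.Perm (Fin n))) (hy : ∀ i, y i ≠ 0)
    (h : ∀ τ : Gal(AlgebraicClosure K/K), ∃ σ ∈ G, SamePoint (fun i => y (σ i)) (fun i j => τ (y i j))) : ∃ x, IsLift Q G x y := by
  have : IsGalois K (AlgebraicClosure K) := { }
  obtain ⟨x, hx⟩ := exists_eq_SpecMap_algebraMap_comp (K := K) (powerMap y hy ≫ (Q.proj G).left) fun τ => by
    obtain ⟨σ, hσ, hs⟩ := h τ
    have h1 := SpecMap_powerMap (τ : AlgebraicClosure K →ₐ[K] AlgebraicClosure K) y hy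
    have h2 := powerMap_permAction y hy σ⁻¹
    have h3 := (isGroupQuotient Q G).comp_eq (⟨σ⁻¹, inv_mem hσ⟩ : G)
    simp only [inv_inv] at h2
    have h4 := (powerMap_eq_iff (fun i => hy (σ i)) (fun i => map_ne_zero_of_ne_zero (τ : AlgebraicClosure K →ₐ[K] AlgebraicClosure K) (hy i))).mpr hs
    rw [← Category.assoc]
    refine (congrArg (· ≫ (Q.proj G).left) (h1.trans (h4.symm.trans h2.symm))).trans ?_
    rw [Category.assoc, h3]
  have hs : x ≫ (Q.quot G).hom = 𝟙 _ := by
    apply eq_of_SpecMap_algebraMap_comp_eq (Ω := AlgebraicClosure K)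
    rw [← reassoc_of% hx, Over.w (Q.proj G), Category.comp_id]
    exact Over.w (coordPowerPoint (K := K) y hy)
  exact ⟨Over.homMk x hs, (isLift_iff _ y).mpr ⟨hy, hx⟩⟩

theorem IsLift.desc {H : Subgroup (Equiv.Perm (Fin n))} (hH : H ≤ G) {z : RatPoint (Q.quot H)} (h : IsLift Q H z y) :
    IsLift Q G (z ≫ Q.desc hH) y := by
  obtain ⟨hy, h⟩ := h
  refine ⟨hy, ?_⟩
  rw [← Q.proj_desc hH, ← Category.assoc, h, Category.assoc]

theorem IsLift.mem_unramifiedLocus [Infinite K] (h : IsLift Q G x y) (hfree : ∀ σ ∈ G, SamePoint y (fun i => y (σ i)) → σ = 1) (p) :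
    x.left p ∈ unramifiedLocus (Q.proj G) := by
  obtain ⟨hy, h⟩ := (isLift_iff x y).mp h
  obtain ⟨U, hU, hun⟩ := (isGroupQuotient Q G).exists_formallyUnramified (Q.quot G).hom (powerMap y hy) fun g hg => by
    rw [powerMap_permAction, powerMap_eq_iff] at hg
    have := hfree g.1⁻¹ (inv_mem g.2) hg.symm
    exact Subtype.ext (inv_eq_one.mp this)
  rw [h] at hU
  have h1 : x.left p ∈ U := by
    have h2 : Spec.map (CommRingCat.ofHom (algebraMap K (AlgebraicClosure K))) (fieldPoint (AlgebraicClosure K)) = p := Subsingleton.elim (α := PrimeSpectrum K) _ _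
    rw [← h2]; exact hU
  exact (le_sSup (a := U) hun : U ≤ unramifiedLocus (Q.proj G)) h1

end Lifts

end PermQuot
end

/-! ### Points of the unramified locus have trivial stabilizer. -/

noncomputable section

namespace PermQuot

section DualNumbers

variable {K : Type u} [Field K] {m n : ℕ} {R : Type u} [CommRing R] [Algebra K R]

/-- The `R`-point of `(ℙ^m)^n` with given coordinates. -/
def ringPowerPoint (y : Fin n → Fin (m + 1) → R) (j : Fin n → Fin (m + 1)) (hj : ∀ i, IsUnit (y i (j i))) : specAlg K R ⟶ projPower K m n :=
  Pi.lift fun i => ringPoint (y i) (j i) (hj i)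

theorem ringPowerPoint_π (y : Fin n → Fin (m + 1) → R) (j : Fin n → Fin (m + 1)) (hj : ∀ i, IsUnit (y i (j i))) (i : Fin n) :
    ringPowerPoint (K := K) y j hj ≫ Pi.π (fun _ : Fin n => projSpace K m) i = ringPoint (y i) (j i) (hj i) :=
  limit.lift_π _ _

theorem ringPowerPoint_permAction (y : Fin n → Fin (m + 1) → R) (j : Fin n → Fin (m + 1)) (hj : ∀ i, IsUnit (y i (j i))) (σ : Equiv.Perm (Fin n)) :
    ringPowerPoint (K := K) y j hj ≫ permAction K m n σ = ringPowerPoint (fun i => y (σ⁻¹ i)) (fun i => j (σ⁻¹ i)) fun _ => hj _ := by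
  refine Pi.hom_ext _ _ fun i => ?_
  rw [Category.assoc, permAction_π, ringPowerPoint_π, ringPowerPoint_π]

variable {F : Type u} [Field F] [Algebra K F]

theorem specAlgMap_ringPowerPoint (f : R →ₐ[K] F) (y : Fin n → Fin (m + 1) → R) (j : Fin n → Fin (m + 1)) (hj : ∀ i, IsUnit (y i (j i))) (y' : Fin n → Fin (m + 1) → F)
    (hy : ∀ i j, f (y i j) = y' i j) (hy' : ∀ i, y' i ≠ 0) :
    specAlgMap f ≫ ringPowerPoint y j hj = coordPowerPoint y' hy' := by
  refine Pi.hom_ext _ _ fun i => ?_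
  have h1 : (fun j => f (y i j)) = y' i := funext fun j => hy i j
  have h2 := coordPoint_eq_ringPoint (K := K) (y' i) (hy' i) (j i) (by rw [← hy]; exact (hj i).map f)
  rw [Category.assoc, ringPowerPoint_π, specAlgMap_ringPoint]
  refine Eq.trans ?_ (h2.symm.trans (coordPowerPoint_π y' hy' i).symm)
  congr 1

end DualNumbers

variable {K : Type u} [Field K] {m n : ℕ} {Q : PermQuotients K m n} {G : Subgroup (Equiv.Perm (Fin n))} {x : RatPoint (Q.quot G)} {y : Fin n → Fin (m + 1) → AlgebraicClosure K}

/-- Suppose σ fixes the point but moves an index i. A tangent vector that varies only the i-th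
factor is not fixed by σ, although it and its translate agree at the base point and have the same
image in the quotient. This contradicts unramifiedness. A nonzero tangent direction exists because
`m ≠ 0`. -/
theorem IsLift.eq_one_of_mem_unramifiedLocus (hm : m ≠ 0) (h : IsLift Q G x y) (hx : ∀ p, x.left p ∈ unramifiedLocus (Q.proj G)) {σ : Equiv.Perm (Fin n)} (hσ : σ ∈ G)
    (hs : SamePoint y (fun i => y (σ i))) : σ = 1 := by
  by_contra hne
  obtain ⟨i, hi⟩ : ∃ i, σ i ≠ i := by
    by_contra! h0
    exact hne (Equiv.ext h0)
  obtain ⟨hy, h⟩ := (isLift_iff x y).mp h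
  obtain ⟨U, hU, hxU⟩ : ∃ U : (Q.quot G).left.Opens, FormallyUnramified ((Q.proj G).left ∣_ U) ∧ ratMap x (fieldPoint K) ∈ U := by
    obtain ⟨U, hU, hxU⟩ := TopologicalSpace.Opens.mem_sSup.mp (hx (fieldPoint K))
    exact ⟨U, hU, hxU⟩
  obtain ⟨j₀, hj₀⟩ : ∃ j, y i j ≠ 0 := Function.ne_iff.mp (hy i)
  obtain ⟨c, hc, hci⟩ := hs i
  have hci : y (σ i) = c • y i := hci
  have hj₀' : y (σ i) j₀ ≠ 0 := by
    rw [hci]; exact mul_ne_zero hc hj₀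
  obtain ⟨t, ht⟩ : ∃ t : Fin (m + 1), t ≠ j₀ := by
    have : Nontrivial (Fin (m + 1)) := Fin.nontrivial_iff_two_le.mpr (by omega)
    exact exists_ne j₀
  choose k hk using fun i => Function.ne_iff.mp (hy i)
  classical
  -- The chart `j₀` is used wherever possible, so that the components `i` and `σ i` are compared in
  -- the same chart.
  let j : Fin n → Fin (m + 1) := fun l => if y l j₀ ≠ 0 then j₀ else k l
  have hj : ∀ l, y l (j l) ≠ 0 := by
    intro l
    by_cases hl : y l j₀ ≠ 0
    · simp only [j, if_pos hl]; exact hl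
    · simp only [j, if_neg hl]; exact hk l
  -- The tangent vector: only the coordinate `t ≠ j₀` of the factor `i` receives an infinitesimal
  -- part.
  let Y : Fin n → Fin (m + 1) → (DualNumber (AlgebraicClosure K)) := fun l r => TrivSqZeroExt.inl (y l r) + if l = i ∧ r = t then DualNumber.eps else 0
  let f : (DualNumber (AlgebraicClosure K)) →ₐ[K] AlgebraicClosure K := (TrivSqZeroExt.fstHom (AlgebraicClosure K) (AlgebraicClosure K) (AlgebraicClosure K)).restrictScalars K
  have hfst : ∀ z : (DualNumber (AlgebraicClosure K)), f z = TrivSqZeroExt.fst z := fun z => rfl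
  have hYf : ∀ l r, f (Y l r) = y l r := by
    intro l r
    rw [hfst]
    simp only [Y]
    split_ifs <;> simp
  have hYu : ∀ l, IsUnit (Y l (j l)) := by
    intro l
    rw [TrivSqZeroExt.isUnit_iff_isUnit_fst]
    have := hYf l (j l)
    rw [hfst] at this
    rw [this]
    exact IsUnit.mk0 _ (hj l)
  let P := ringPowerPoint (K := K) Y j hYu
  have hmod : specAlgMap f ≫ P = coordPowerPoint y hy := specAlgMap_ringPowerPoint f Y j hYu y hYf hy
  have hπ : permAction K m n σ⁻¹ ≫ Q.proj G = Q.proj G := (Q.isQuotientBy G).invariant (⟨σ⁻¹, inv_mem hσ⟩ : G)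
  have hfix : coordPowerPoint y hy ≫ permAction K m n σ⁻¹ = coordPowerPoint y hy := by
    rw [coordPowerPoint_permAction, coordPowerPoint_eq_iff]
    simp only [inv_inv]
    exact hs.symm
  let φ : CommRingCat.of (DualNumber (AlgebraicClosure K)) ⟶ CommRingCat.of (AlgebraicClosure K) := CommRingCat.ofHom f.toRingHom
  let PL : Spec (CommRingCat.of (DualNumber (AlgebraicClosure K))) ⟶ (projPower K m n).left := P.left
  have hmodL : Spec.map φ ≫ PL = powerMap y hy := congrArg (fun f => f.left) hmod
  have hP : PL = (P ≫ permAction K m n σ⁻¹).left := by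
    refine eq_of_formallyUnramified_restrict hU φ (fun z => ⟨TrivSqZeroExt.inl z, rfl⟩) ?_ ?_ ?_ ?_
    · intro a b ha hb
      have ha : TrivSqZeroExt.fst (a : (DualNumber (AlgebraicClosure K))) = 0 := ha
      have hb : TrivSqZeroExt.fst (b : (DualNumber (AlgebraicClosure K))) = 0 := hb
      refine TrivSqZeroExt.ext ?_ ?_
      · exact (TrivSqZeroExt.fst_mul (a : (DualNumber (AlgebraicClosure K))) b).trans (by rw [ha, zero_mul]; rfl)
      · exact (TrivSqZeroExt.snd_mul (a : (DualNumber (AlgebraicClosure K))) b).trans (by rw [ha, hb]; simp)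
    · have h1 : specAlgMap f ≫ P = specAlgMap f ≫ P ≫ permAction K m n σ⁻¹ := by
        rw [← Category.assoc, hmod]; exact hfix.symm
      exact congrArg (fun f => f.left) h1
    · have h1 : P ≫ Q.proj G = (P ≫ permAction K m n σ⁻¹) ≫ Q.proj G := by
        rw [Category.assoc, hπ]
      exact congrArg (fun f => f.left) h1
    · intro p
      have h1 : Spec.map φ ≫ PL ≫ (Q.proj G).left = Spec.map (CommRingCat.ofHom (algebraMap K (AlgebraicClosure K))) ≫ ratMap x := by
        rw [← h, ← hmodL, Category.assoc]
      have h2 : Spec.map (CommRingCat.ofHom (algebraMap K (AlgebraicClosure K))) p = fieldPoint K := eq_fieldPoint _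
      rw [h1]
      change ratMap x (Spec.map (CommRingCat.ofHom (algebraMap K (AlgebraicClosure K))) p) ∈ U
      rw [h2]
      exact hxU
  have hP' : P = P ≫ permAction K m n σ⁻¹ := Over.OverMorphism.ext hP
  have hPi := congrArg (· ≫ Pi.π (fun _ : Fin n => projSpace K m) i) hP'
  simp only [P, ringPowerPoint_permAction, ringPowerPoint_π, inv_inv] at hPi
  have hji : j i = j₀ := if_pos hj₀
  have hji' : j (σ i) = j₀ := if_pos hj₀'
  simp only [hji, hji'] at hPi
  rw [ringPoint_eq_iff] at hPi
  -- The ε-part of this relation reads c · y_{i j₀} = 0, because `σ i ≠ i` and `t ≠ j₀` leave no ε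
  -- on the other side.
  have h1 := congrArg TrivSqZeroExt.snd (hPi t)
  simp [Y, hi, ht.symm, hci] at h1
  exact h1.elim hc hj₀

end PermQuot
end

/-! ### Invariant forms and their norms. -/

noncomputable section

namespace PermQuot

section Forms

variable {K : Type u} [Field K] {m n : ℕ} {G : Subgroup (Equiv.Perm (Fin n))} {d : ℕ} {f : MvPolynomial (Fin n × Fin (m + 1)) K}

theorem evalForm_smul (hf : ∀ e ∈ f.support, ∀ i, ∑ j, e (i, j) = d) (c : Fin n → AlgebraicClosure K) (y : Fin n → Fin (m + 1) → AlgebraicClosure K) :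
    evalForm f (fun i => c i • y i) = (∏ i, c i ^ d) * evalForm f y := by
  rw [evalForm, evalForm, MvPolynomial.aeval_def, MvPolynomial.aeval_def, MvPolynomial.eval₂_eq', MvPolynomial.eval₂_eq', Finset.mul_sum]
  refine Finset.sum_congr rfl fun e he => ?_
  simp only [Pi.smul_apply, smul_eq_mul, mul_pow, Finset.prod_mul_distrib]
  have h1 : ∏ p : Fin n × Fin (m + 1), c p.1 ^ e p = ∏ i, c i ^ d := by
    rw [Fintype.prod_prod_type]
    refine Finset.prod_congr rfl fun i _ => ?_
    simp only
    rw [Finset.prod_pow_eq_pow_sum, hf e he]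
  rw [h1]
  ring

theorem evalForm_perm {σ : Equiv.Perm (Fin n)} (hf : MvPolynomial.rename (fun p : Fin n × Fin (m + 1) => (σ p.1, p.2)) f = f)
    (y : Fin n → Fin (m + 1) → AlgebraicClosure K) : evalForm f (fun i => y (σ i)) = evalForm f y := by
  conv_rhs => rw [evalForm, ← hf, MvPolynomial.aeval_rename]
  rfl

theorem evalForm_map (τ : AlgebraicClosure K →ₐ[K] AlgebraicClosure K) (y : Fin n → Fin (m + 1) → AlgebraicClosure K) :
    evalForm f (fun i j => τ (y i j)) = τ (evalForm f y) := by
  rw [evalForm, evalForm, MvPolynomial.aeval_def, MvPolynomial.aeval_def, MvPolynomial.eval₂_eq', MvPolynomial.eval₂_eq', map_sum]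
  simp

/-- Rescaling multiplies numerator and denominator by the same factor, and a permutation in `G`
reorders the product. So the norm is the same at all lifts of a rational point. -/
theorem upstairsNorm_perm_smul (hf : f ∈ invForms K m G d) (w : AbsoluteValue (AlgebraicClosure K) ℝ) {σ : Equiv.Perm (Fin n)} (hσ : σ ∈ G)
    {y y' : Fin n → Fin (m + 1) → AlgebraicClosure K} (h : SamePoint (fun i => y (σ i)) y') : upstairsNorm w d f y' = upstairsNorm w d f y := by
  choose c hc hi using h
  obtain rfl : y' = fun i => c i • y (σ i) := funext hi
  have h1 : ∏ i, (⨆ j, w ((c i • y (σ i)) j)) ^ d = (∏ i, w (c i) ^ d) * ∏ i, (⨆ j, w (y i j)) ^ d := by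
    rw [← Equiv.prod_comp σ (fun i => (⨆ j, w (y i j)) ^ d), ← Finset.prod_mul_distrib]
    refine Finset.prod_congr rfl fun i _ => ?_
    rw [← mul_pow]
    congr 1
    simp only [Pi.smul_apply, smul_eq_mul, map_mul]
    exact (Real.mul_iSup_of_nonneg (w.nonneg _) _).symm
  have h2 : ∏ i, w (c i) ^ d ≠ 0 := Finset.prod_ne_zero_iff.mpr fun i _ => pow_ne_zero _ (w.ne_zero (hc i))
  rw [upstairsNorm, upstairsNorm, h1, evalForm_smul hf.1 c (fun i => y (σ i)), evalForm_perm (hf.2 σ hσ), map_mul, map_prod]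
  simp only [map_pow]
  exact mul_div_mul_left _ _ h2

/-- The linear forms vanishing at one of the `n` points fill finitely many proper subspaces, which
cannot cover a space over an infinite field. -/
theorem exists_linearForm_ne_zero [Infinite K] {y : Fin n → Fin (m + 1) → AlgebraicClosure K} (hy : ∀ i, y i ≠ 0) :
    ∃ a : Fin (m + 1) → K, ∀ i, ∑ j, algebraMap K _ (a j) * y i j ≠ 0 := by
  let φ : Fin n → (Fin (m + 1) → K) →ₗ[K] AlgebraicClosure K := fun i => Fintype.linearCombination K (y i)
  have hφ : ∀ i a, φ i a = ∑ j, algebraMap K _ (a j) * y i j := by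
    intro i a
    simp [φ, Fintype.linearCombination_apply, Algebra.smul_def]
  by_contra! h
  obtain ⟨i, hi⟩ := Subspace.exists_eq_top_of_iUnion_eq_univ (p := fun i => LinearMap.ker (φ i)) (by
    rw [Set.eq_univ_iff_forall]
    intro a
    obtain ⟨i, hi⟩ := h a
    exact Set.mem_iUnion.mpr ⟨i, by rw [SetLike.mem_coe, LinearMap.mem_ker, hφ, hi]⟩)
  obtain ⟨j, hj⟩ := Function.ne_iff.mp (hy i)
  have h1 : φ i (Pi.single j 1) = 0 := by
    rw [← LinearMap.mem_ker, hi]; trivial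
  rw [hφ, Finset.sum_eq_single j (fun k _ hk => by rw [Pi.single_eq_of_ne hk]; simp) (by simp)] at h1
  simp at h1
  exact hj h1

theorem exists_mem_invForms [Infinite K] (G : Subgroup (Equiv.Perm (Fin n))) (d : ℕ) {y : Fin n → Fin (m + 1) → AlgebraicClosure K} (hy : ∀ i, y i ≠ 0) :
    ∃ f ∈ invForms K m G d, evalForm f y ≠ 0 := by
  classical
  obtain ⟨a, ha⟩ := exists_linearForm_ne_zero hy
  let l : Fin n → MvPolynomial (Fin n × Fin (m + 1)) K := fun i => ∑ j, MvPolynomial.C (a j) * MvPolynomial.X (i, j)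
  refine ⟨∏ i, l i ^ d, ⟨?_, ?_⟩, ?_⟩
  · intro e he i
    -- Weighted degree for these weights is the degree in the `i`-th block of variables.
    let w : Fin n × Fin (m + 1) → ℕ := fun p => if p.1 = i then 1 else 0
    have hl : ∀ k, MvPolynomial.IsWeightedHomogeneous w (l k) (if k = i then 1 else 0) := by
      intro k
      refine MvPolynomial.IsWeightedHomogeneous.sum _ _ _ fun j _ => ?_
      have h1 := (MvPolynomial.isWeightedHomogeneous_C (R := K) w (a j)).mul (MvPolynomial.isWeightedHomogeneous_X K w (k, j))
      rwa [zero_add] at h1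
    have hp : MvPolynomial.IsWeightedHomogeneous w (∏ k, l k ^ d) (∑ k, d • if k = i then 1 else 0) :=
      MvPolynomial.IsWeightedHomogeneous.prod _ _ _ fun k _ => (hl k).pow d
    have h2 := hp (MvPolynomial.mem_support_iff.mp he)
    rw [Finsupp.weight_apply, Finsupp.sum_fintype _ _ (by simp), Fintype.sum_prod_type] at h2
    simpa [w, Finset.sum_ite_eq, Finset.sum_comm] using h2
  · intro σ _
    rw [map_prod, ← Equiv.prod_comp σ (fun i => l i ^ d)]
    refine Finset.prod_congr rfl fun i _ => ?_
    rw [map_pow]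
    simp [l]
  · rw [evalForm, map_prod, Finset.prod_ne_zero_iff]
    intro i _
    rw [map_pow]
    refine pow_ne_zero _ ?_
    simpa [l] using ha i

end Forms

end PermQuot
end

/-! ### The height of a rational point of the quotient. -/

noncomputable section

namespace PermQuot

theorem prod_smul_eq_prod_pow {G α M : Type*} [Group G] [Fintype G] [MulAction G α] [Fintype α] [MulAction.IsPretransitive G α] [CommMonoid M]
    (i₀ : α) (F : α → M) : ∏ g : G, F (g • i₀) = (∏ i, F i) ^ Nat.card (MulAction.stabilizer G i₀) := by
  classical
  obtain ⟨N, -, hN, h⟩ := prod_comp_eq_prod_image_pow (M := M) (fun g : G => g⁻¹ • i₀) fun g h k hgh => by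
    simp only [mul_inv_rev, mul_smul] at hgh ⊢
    rw [hgh]
  have h1 := h F
  have himg : Finset.univ.image (fun g : G => g⁻¹ • i₀) = Finset.univ := by
    ext i
    obtain ⟨g, hg⟩ := MulAction.exists_smul_eq G i₀ i
    simpa using ⟨g⁻¹, by simpa using hg⟩
  have hc : N = Nat.card (MulAction.stabilizer G i₀) := by
    rw [hN]
    refine Nat.card_congr (Equiv.subtypeEquiv (Equiv.inv G) fun g => ?_)
    rw [inv_one, one_smul]
    exact Iff.rfl
  rw [himg, hc] at h1
  rw [← h1]
  exact (Equiv.prod_comp (Equiv.inv G) fun g : G => F (g • i₀)).symm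

section Local

variable {K L : Type u} [Field K] [Field L] [Algebra K L] [FiniteDimensional K L] [IsGalois K L] {m n : ℕ}
  {G : Subgroup (Equiv.Perm (Fin n))} [hG : MulAction.IsPretransitive G (Fin n)] (e : G ≃* Gal(L/K)) {i₀ : Fin n} {v : Fin (m + 1) → L}
  {ι : L →ₐ[K] AlgebraicClosure K} {y : Fin n → Fin (m + 1) → AlgebraicClosure K} (hy : ∀ (g : G) j, y (g • i₀) j = ι (e g (v j)))

include hy

omit [FiniteDimensional K L] [IsGalois K L] in
theorem coords_ne_zero (hv : v ≠ 0) (i : Fin n) : y i ≠ 0 := by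
  obtain ⟨g, rfl⟩ := MulAction.exists_smul_eq G i₀ i
  obtain ⟨j, hj⟩ := Function.ne_iff.mp hv
  refine Function.ne_iff.mpr ⟨j, ?_⟩
  rw [hy]
  exact (map_ne_zero ι).mpr ((map_ne_zero (e g)).mpr hj)

omit [IsGalois K L] in
-- Each index is `g • i₀` for as many `g` as the stabilizer has elements; this links the product
-- over the `n` components with the Galois products that compute heights.
theorem prod_iSup_pow_eq (w : AbsoluteValue (AlgebraicClosure K) ℝ) :
    (∏ i, ⨆ j, w (y i j)) ^ Nat.card (MulAction.stabilizer G i₀) = ∏ τ : Gal(L/K), ⨆ j, w.comp (f := (ι : L →+* AlgebraicClosure K)) ι.injective (τ (v j)) := by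
  classical
  cases nonempty_fintype G
  rw [← prod_smul_eq_prod_pow i₀ fun i => ⨆ j, w (y i j), ← Equiv.prod_comp e.toEquiv]
  simp only [hy]
  rfl

omit hy in
theorem prod_iSup_pos (w : AbsoluteValue (AlgebraicClosure K) ℝ) (hy : ∀ i, y i ≠ 0) : 0 < ∏ i, ⨆ j, w (y i j) := by
  refine Finset.prod_pos fun i _ => ?_
  obtain ⟨j, hj⟩ := Function.ne_iff.mp (hy i)
  exact (w.pos hj).trans_le (le_ciSup (f := fun j => w (y i j)) (Set.finite_range _).bddAbove j)

/-- On `L` two extensions of the same absolute value differ by a Galois element, and that only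
permutes the factors of the Galois product. -/
theorem prod_iSup_eq_of_extension (hv : v ≠ 0) {w w' : AbsoluteValue (AlgebraicClosure K) ℝ} (h : ∀ a, w (algebraMap K _ a) = w' (algebraMap K _ a))
    (hw : ∃ a : K, a ≠ 0 ∧ w (algebraMap K _ a) ≠ 1) : ∏ i, ⨆ j, w (y i j) = ∏ i, ⨆ j, w' (y i j) := by
  let u := w.comp (f := (ι : L →+* AlgebraicClosure K)) ι.injective
  let u' := w'.comp (f := (ι : L →+* AlgebraicClosure K)) ι.injective
  have hu : ∀ (w : AbsoluteValue (AlgebraicClosure K) ℝ) a, w.comp (f := (ι : L →+* AlgebraicClosure K)) ι.injective (algebraMap K L a) = w (algebraMap K _ a) := fun w a =>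
    congrArg w (ι.commutes a)
  obtain ⟨g, hg⟩ := AbsoluteValue.exists_galois_conj (K := K) u u' (fun a => by rw [hu, hu, h]) (by
    obtain ⟨a, ha, h1⟩ := hw
    exact ⟨a, ha, by rw [hu]; exact h1⟩)
  have hne := coords_ne_zero e hy hv
  have hc : Nat.card (MulAction.stabilizer G i₀) ≠ 0 := Nat.card_pos.ne'
  refine (pow_left_inj₀ (prod_iSup_pos w hne).le (prod_iSup_pos w' hne).le hc).mp ?_
  rw [prod_iSup_pow_eq e hy, prod_iSup_pow_eq e hy, ← Equiv.prod_comp (Equiv.mulLeft g)]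
  refine Finset.prod_congr rfl fun τ _ => ?_
  congr 1
  ext j
  exact (hg _).symm

omit [FiniteDimensional K L] [IsGalois K L] in
theorem galois_smul_coords (τ : Gal(AlgebraicClosure K/K)) {h : G} (hh : ∀ a, τ (ι a) = ι (e h a)) (i : Fin n) (j) : τ (y i j) = y (h • i) j := by
  obtain ⟨g, rfl⟩ := MulAction.exists_smul_eq G i₀ i
  rw [hy, hh, ← mul_smul, hy, map_mul]
  rfl

omit hy hG [FiniteDimensional K L] in
theorem exists_restrict (τ : Gal(AlgebraicClosure K/K)) : ∃ h : G, ∀ a, τ (ι a) = ι (e h a) := by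
  have : Normal K (AlgebraicClosure K) := IsAlgClosure.normal K _
  let φ : L →ₐ[K] AlgebraicClosure K := (τ : AlgebraicClosure K →ₐ[K] AlgebraicClosure K).comp ι
  let _ := ι.toRingHom.toAlgebra
  have : IsScalarTower K L (AlgebraicClosure K) := IsScalarTower.of_algebraMap_eq' ι.comp_algebraMap.symm
  refine ⟨e.symm (τ.restrictNormal L), fun a => ?_⟩
  rw [MulEquiv.apply_symm_apply]
  exact (AlgEquiv.restrictNormal_commutes τ L a).symm

end Local

end PermQuot
end

noncomputable section

namespace PermQuot

open NumberField Height

theorem exists_placeExtensions (K : Type*) [Field K] [NumberField K] : ∃ w : AbsoluteValue K ℝ → AbsoluteValue (AlgebraicClosure K) ℝ,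
    (∀ (v : InfinitePlace K) a, w v.1 (algebraMap K _ a) = v.1 a) ∧ ∀ (v : FinitePlace K) a, w v.1 (algebraMap K _ a) = v.1 a := by
  classical
  have hex : ∀ v : AbsoluteValue K ℝ, ∃ w : AbsoluteValue (AlgebraicClosure K) ℝ,
      IsInfinitePlace v ∨ IsFinitePlace v → ∀ a, w (algebraMap K _ a) = v a := by
    intro v
    by_cases hv : IsInfinitePlace v
    · obtain ⟨w', hw'⟩ := InfinitePlace.exists_extension_algebraicClosure ⟨v, hv⟩
      exact ⟨w', fun _ => hw'⟩
    · by_cases hv' : IsFinitePlace v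
      · obtain ⟨w', hw'⟩ := FinitePlace.exists_extension_algebraicClosure ⟨v, hv'⟩
        exact ⟨w', fun _ => hw'⟩
      · exact ⟨AbsoluteValue.trivial, fun h => absurd h (by tauto)⟩
  choose w hw using hex
  exact ⟨w, fun v => hw v.1 (Or.inl v.isInfinitePlace), fun v => hw v.1 (Or.inr v.isFinitePlace)⟩

theorem exists_infinitePlace_ne_one {K : Type*} [Field K] [NumberField K] (v : InfinitePlace K) : ∃ a : K, a ≠ 0 ∧ v.1 a ≠ 1 := by
  refine ⟨2, two_ne_zero, ?_⟩
  have h : v (2 : K) = 2 := by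
    have := v.map_natCast 2
    simpa using this
  change v 2 ≠ 1
  rw [h]; norm_num

variable {K L : Type u} [Field K] [NumberField K] [Field L] [NumberField L] [Algebra K L] [IsGalois K L] {m n : ℕ}
  {G : Subgroup (Equiv.Perm (Fin n))} [hG : MulAction.IsPretransitive G (Fin n)] (e : G ≃* Gal(L/K)) {i₀ : Fin n}
  {ι : L →ₐ[K] AlgebraicClosure K} {y : Fin n → Fin (m + 1) → AlgebraicClosure K}
  {Q : PermQuotients K m n} {x : RatPoint (Q.quot G)}

section Vector

variable {v : Fin (m + 1) → L} (hy : ∀ (g : G) j, y (g • i₀) j = ι (e g (v j)))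

include hy

/-- The witness behind `Classical.epsilon` is unknown, but any two lifts differ by `G` and scaling,
and any two extensions give the same product, so the value is forced. -/
theorem localNorm_eq (hv : v ≠ 0) (hx : IsLift Q G x y) {d : ℕ} {f : MvPolynomial (Fin n × Fin (m + 1)) K} (hf : f ∈ invForms K m G d)
    {a : K} (ha : evalForm f y = algebraMap K _ a) {u : AbsoluteValue K ℝ} (hu : ∃ a : K, a ≠ 0 ∧ u a ≠ 1)
    {w : AbsoluteValue (AlgebraicClosure K) ℝ} (hw : ∀ a, w (algebraMap K _ a) = u a) :
    localNorm Q G u d f x = u a / (∏ i, ⨆ j, w (y i j)) ^ d := by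
  have hex : ∃ t : ℝ, ∃ w : AbsoluteValue (AlgebraicClosure K) ℝ, (∀ a, w (algebraMap K _ a) = u a) ∧
      ∃ y, IsLift Q G x y ∧ t = upstairsNorm w d f y := ⟨_, w, hw, y, hx, rfl⟩
  obtain ⟨w', hw', y', hy', ht⟩ := Classical.epsilon_spec hex
  obtain ⟨σ, hσ, hs⟩ := hx.exists_perm hy'
  refine ht.trans ?_
  rw [upstairsNorm_perm_smul hf w' hσ hs, upstairsNorm, ha, hw', Finset.prod_pow, prod_iSup_eq_of_extension e hy hv (w := w) (w' := w') (fun a => by rw [hw, hw'])]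
  obtain ⟨b, hb, hb1⟩ := hu
  exact ⟨b, hb, by rwa [hw]⟩

omit [NumberField L] in
-- Galois permutes the components of `y` through `G`, under which `f` is invariant, so the value is
-- Galois-fixed.
theorem exists_evalForm_eq_algebraMap {d : ℕ} {f : MvPolynomial (Fin n × Fin (m + 1)) K} (hf : f ∈ invForms K m G d) :
    ∃ a : K, evalForm f y = algebraMap K _ a := by
  have : IsGalois K (AlgebraicClosure K) := { }
  obtain ⟨a, ha⟩ := (InfiniteGalois.mem_range_algebraMap_iff_fixed (k := K) (evalForm f y)).mpr fun τ => by
    obtain ⟨h, hh⟩ := exists_restrict e (ι := ι) τ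
    have h1 := evalForm_map (f := f) (τ : AlgebraicClosure K →ₐ[K] AlgebraicClosure K) y
    refine h1.symm.trans (Eq.trans ?_ (evalForm_perm (hf.2 h.1 h.2) y))
    congr 1
    ext i j
    exact galois_smul_coords e hy τ hh i j
  exact ⟨a, ha.symm⟩

theorem height_product_eq (hv : v ≠ 0) {w : AbsoluteValue K ℝ → AbsoluteValue (AlgebraicClosure K) ℝ}
    (hinf : ∀ (v : InfinitePlace K) a, w v.1 (algebraMap K _ a) = v.1 a) (hfin : ∀ (v : FinitePlace K) a, w v.1 (algebraMap K _ a) = v.1 a) :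
    (Function.HasFiniteMulSupport fun u : FinitePlace K => ∏ i, ⨆ j, w u.1 (y i j)) ∧
    ((∏ u : InfinitePlace K, (∏ i, ⨆ j, w u.1 (y i j)) ^ u.mult) * ∏ᶠ u : FinitePlace K, ∏ i, ⨆ j, w u.1 (y i j)) ^ Nat.card (MulAction.stabilizer G i₀) =
      mulHeight v := by
  have hc : Nat.card (MulAction.stabilizer G i₀) ≠ 0 := Nat.card_pos.ne'
  have hne := coords_ne_zero e hy hv
  have h1 := mulHeight_eq_prod_galois (K := K) hv (fun u => (w u).comp (f := (ι : L →+* AlgebraicClosure K)) ι.injective)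
    (fun u a => (congrArg (w u.1) (ι.commutes a)).trans (hinf u a)) (fun u a => (congrArg (w u.1) (ι.commutes a)).trans (hfin u a))
  simp only [← prod_iSup_pow_eq e hy] at h1
  have hfs : Function.HasFiniteMulSupport fun u : FinitePlace K => ∏ i, ⨆ j, w u.1 (y i j) := by
    refine Set.Finite.subset h1.1 fun u hu hu' => hu ?_
    exact (pow_eq_one_iff_of_nonneg (prod_iSup_pos (w u.1) hne).le hc).mp hu'
  refine ⟨hfs, ?_⟩
  rw [h1.2, mul_pow, ← finprod_pow hfs, ← Finset.prod_pow]
  congr 1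
  exact Finset.prod_congr rfl fun u _ => pow_right_comm _ _ _

end Vector

/-- The local norms are |a|_v divided by the d-th power of the product of the local factors of the
y_i, where a = f(y) lies in `K`. Their global product is a power of the height of `v` over the fixed
field of the stabilizer. -/
theorem quotHeight_eq {v : Fin (m + 1) → IntermediateField.fixedField ((MulAction.stabilizer G i₀).map e.toMonoidHom)} (hv : v ≠ 0)
    [NumberField (IntermediateField.fixedField ((MulAction.stabilizer G i₀).map e.toMonoidHom))]
    (hy : ∀ (g : G) j, y (g • i₀) j = ι (e g (v j))) (hx : IsLift Q G x y) : quotHeight Q G x = mulHeight v ^ (m + 1) := by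
  have hv' : (fun j => (v j : L)) ≠ 0 := by
    obtain ⟨j, hj⟩ := Function.ne_iff.mp hv
    exact Function.ne_iff.mpr ⟨j, fun h => hj (Subtype.ext h)⟩
  have hne := coords_ne_zero e (v := fun j => (v j : L)) hy hv'
  obtain ⟨w, hinf, hfin⟩ := exists_placeExtensions K
  obtain ⟨hfs, hprod⟩ := height_product_eq e (v := fun j => (v j : L)) hy hv' hinf hfin
  have hc : Nat.card (MulAction.stabilizer G i₀) ≠ 0 := Nat.card_pos.ne'
  have hpos : ∀ u, 0 < ∏ i, ⨆ j, w u (y i j) := fun u => prod_iSup_pos (w u) hne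
  -- Both sides are compared after raising to the order of the stabilizer, which is the degree of
  -- `L` over the fixed field.
  have hH : (∏ u : InfinitePlace K, (∏ i, ⨆ j, w u.1 (y i j)) ^ u.mult) * ∏ᶠ u : FinitePlace K, ∏ i, ⨆ j, w u.1 (y i j) = mulHeight v := by
    refine (pow_left_inj₀ ?_ (mulHeight_pos _).le hc).mp ?_
    · exact mul_nonneg (Finset.prod_nonneg fun u _ => pow_nonneg (hpos _).le _) (finprod_nonneg fun u => (hpos _).le)
    · rw [hprod]
      have h1 := mulHeight_algebraMap (L := L) hv
      rw [IntermediateField.finrank_fixedField_eq_card] at h1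
      refine h1.trans ?_
      congr 1
      exact Nat.card_congr ((MulAction.stabilizer G i₀).equivMapOfInjective e.toMonoidHom e.injective).symm.toEquiv
  obtain ⟨f₀, hf₀, hf₀y⟩ := exists_mem_invForms G (Nat.card G * (m + 1)) hne
  have hr : Nat.card G ≠ 0 := Nat.card_pos.ne'
  obtain ⟨f, hf, ⟨y', hy', hfy'⟩, ht⟩ := Classical.epsilon_spec (p := fun t : ℝ => ∃ f ∈ invForms K m G (Nat.card G * (m + 1)),
      (∃ y, IsLift Q G x y ∧ evalForm f y ≠ 0) ∧
      t = (((AdmissibleAbsValues.archAbsVal (K := K)).map fun v =>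
              (localNorm Q G v (Nat.card G * (m + 1)) f x)⁻¹).prod *
            ∏ᶠ v : AdmissibleAbsValues.nonarchAbsVal (K := K),
              (localNorm Q G v.1 (Nat.card G * (m + 1)) f x)⁻¹) ^ ((Nat.card G : ℝ)⁻¹)) ⟨_, f₀, hf₀, ⟨y, hx, hf₀y⟩, rfl⟩
  refine ht.trans ?_
  generalize hd : Nat.card G * (m + 1) = d at *
  have hfy : evalForm f y ≠ 0 := by
    obtain ⟨σ, hσ, hs⟩ := hx.exists_perm hy'
    choose c hc hi using hs
    obtain rfl : y' = fun i => c i • y (σ i) := funext hi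
    rw [evalForm_smul hf.1 c (fun i => y (σ i)), evalForm_perm (hf.2 σ hσ)] at hfy'
    exact right_ne_zero_of_mul hfy'
  obtain ⟨a, ha⟩ := exists_evalForm_eq_algebraMap e (v := fun j => (v j : L)) hy hf
  have ha0 : a ≠ 0 := by
    rintro rfl
    exact hfy (by rw [ha, map_zero])
  have hlinf : ∀ u : InfinitePlace K, (localNorm Q G u.1 d f x)⁻¹ = (∏ i, ⨆ j, w u.1 (y i j)) ^ d / u.1 a := fun u => by
    rw [localNorm_eq e (v := fun j => (v j : L)) hy hv' hx hf ha (exists_infinitePlace_ne_one u) (hinf u), inv_div]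
  have hlfin : ∀ u : FinitePlace K, (localNorm Q G u.1 d f x)⁻¹ = (∏ i, ⨆ j, w u.1 (y i j)) ^ d / u.1 a := fun u => by
    rw [localNorm_eq e (v := fun j => (v j : L)) hy hv' hx hf ha ?_ (hfin u), inv_div]
    exact u.isNontrivial
  have hpf := AdmissibleAbsValues.product_formula ha0
  rw [prod_archAbsVal_eq fun u => u a, prod_nonarchAbsVal_eq fun u => u a] at hpf
  have hafs : Function.HasFiniteMulSupport fun u : FinitePlace K => u.1 a := FinitePlace.hasFiniteMulSupport ha0
  rw [prod_archAbsVal_eq fun u => (localNorm Q G u d f x)⁻¹, prod_nonarchAbsVal_eq fun u => (localNorm Q G u d f x)⁻¹]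
  simp only [hlinf, hlfin]
  have hfsd : Function.HasFiniteMulSupport fun u : FinitePlace K => (∏ i, ⨆ j, w u.1 (y i j)) ^ d := hfs.pow d
  have h1 : ∏ᶠ u : FinitePlace K, (∏ i, ⨆ j, w u.1 (y i j)) ^ d / u.1 a =
      (∏ᶠ u : FinitePlace K, ∏ i, ⨆ j, w u.1 (y i j)) ^ d / ∏ᶠ u : FinitePlace K, u.1 a := by
    rw [finprod_div_distrib hfsd hafs, finprod_pow hfs]
  have h2 : ∏ u : InfinitePlace K, ((∏ i, ⨆ j, w u.1 (y i j)) ^ d / u.1 a) ^ u.mult =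
      (∏ u : InfinitePlace K, (∏ i, ⨆ j, w u.1 (y i j)) ^ u.mult) ^ d / ∏ u : InfinitePlace K, u.1 a ^ u.mult := by
    rw [← Finset.prod_pow, ← Finset.prod_div_distrib]
    exact Finset.prod_congr rfl fun u _ => by rw [div_pow, pow_right_comm]
  -- The product formula `hpf` removes `a`; what remains is the height to the power d = |G|(m + 1),
  -- and the |G|-th root leaves the exponent m + 1.
  refine (congrArg (· ^ ((Nat.card G : ℝ)⁻¹)) ((congrArg₂ (· * ·) h2 h1).trans ((div_mul_div_comm _ _ _ _).trans (congrArg _ hpf)))).trans ?_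
  rw [div_one, ← mul_pow, hH, ← hd, mul_comm, pow_mul, Real.pow_rpow_inv_natCast (pow_nonneg (mulHeight_pos _).le _) hr]

end PermQuot
end

/-! ### From original points to primitive points. -/

noncomputable section

namespace PermQuot

variable {K : Type u} [Field K] {m n : ℕ} {G : Subgroup (Equiv.Perm (Fin n))}

theorem LargeGField.mem_fixed {L : LargeGField K G} {S : Subgroup G} {a : L.carrier} : a ∈ L.fixed S ↔ ∀ g ∈ S, L.galEquiv g a = a := by
  rw [LargeGField.fixed, IntermediateField.mem_fixedField_iff]
  exact ⟨fun h g hg => h _ ⟨g, hg, rfl⟩, by rintro h _ ⟨g, hg, rfl⟩; exact h g hg⟩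

/-- `y` consists of the conjugates of the coordinate vector `v`. -/
def IsCoords (L : LargeGField K G) (ι : L.carrier →ₐ[K] AlgebraicClosure K) (i₀ : Fin n) (v : Fin (m + 1) → L.carrier)
    (y : Fin n → Fin (m + 1) → AlgebraicClosure K) : Prop :=
  ∀ (g : G) j, y (g • i₀) j = ι (L.galEquiv g (v j))

/-- The choice of a group element carrying `i₀` to `i` does not matter because `v` is fixed by the
stabilizer. -/
theorem exists_isCoords [hG : MulAction.IsPretransitive G (Fin n)] {L : LargeGField K G} (ι : L.carrier →ₐ[K] AlgebraicClosure K) {i₀ : Fin n}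
    {v : Fin (m + 1) → L.carrier} (hv : ∀ j, v j ∈ L.fixed (MulAction.stabilizer G i₀)) : ∃ y, IsCoords L ι i₀ v y := by
  choose k hk using fun i : Fin n => MulAction.exists_smul_eq G i₀ i
  refine ⟨fun i j => ι (L.galEquiv (k i) (v j)), fun g j => ?_⟩
  have h1 : g⁻¹ * k (g • i₀) ∈ MulAction.stabilizer G i₀ := by
    rw [MulAction.mem_stabilizer_iff, mul_smul, hk, inv_smul_smul]
  have h2 := LargeGField.mem_fixed.mp (hv j) _ h1
  rw [map_mul, AlgEquiv.mul_apply] at h2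
  have h3 := congrArg (L.galEquiv g) h2
  rw [← AlgEquiv.mul_apply, ← map_mul, mul_inv_cancel, map_one] at h3
  exact congrArg ι h3

/-- The permutations that fix the point with coordinates `y`. -/
def pointFixer (G : Subgroup (Equiv.Perm (Fin n))) {F : Type*} [Field F] (y : Fin n → Fin (m + 1) → F) : Subgroup G where
  carrier := {σ | SamePoint y (fun i => y (σ.1 i))}
  one_mem' := SamePoint.refl y
  mul_mem' {σ σ'} hσ hσ' := SamePoint.trans (y' := fun i => y (σ'.1 i)) hσ' (hσ.perm σ'.1)
  inv_mem' {σ} hσ := by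
    have h := (SamePoint.perm hσ (σ⁻¹ : G).1).symm
    have h1 : (fun i => y (σ.1 ((σ⁻¹ : G).1 i))) = y := funext fun i => congrArg y (smul_inv_smul σ i)
    rw [h1] at h
    exact h

theorem exists_extend {L : LargeGField K G} (ι : L.carrier →ₐ[K] AlgebraicClosure K) (h : G) :
    ∃ τ : Gal(AlgebraicClosure K/K), ∀ a, τ (ι a) = ι (L.galEquiv h a) := by
  let _ := ι.toRingHom.toAlgebra
  have : IsScalarTower K L.carrier (AlgebraicClosure K) := IsScalarTower.of_algebraMap_eq' ι.comp_algebraMap.symm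
  have : Normal K (AlgebraicClosure K) := IsAlgClosure.normal K _
  refine ⟨AlgEquiv.liftNormal (L.galEquiv h) (AlgebraicClosure K), fun a => ?_⟩
  exact AlgEquiv.liftNormal_commutes (L.galEquiv h) (AlgebraicClosure K) a

namespace IsCoords

variable [hG : MulAction.IsPretransitive G (Fin n)] {L : LargeGField K G} {ι : L.carrier →ₐ[K] AlgebraicClosure K} {i₀ : Fin n}
  {v : Fin (m + 1) → L.carrier} {y : Fin n → Fin (m + 1) → AlgebraicClosure K} (hy : IsCoords L ι i₀ v y)

include hy

omit hG in
theorem apply_base (j) : y i₀ j = ι (v j) := by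
  have := hy 1 j
  rwa [one_smul, map_one] at this

theorem galois_apply {τ : Gal(AlgebraicClosure K/K)} {h : G} (hh : ∀ a, τ (ι a) = ι (L.galEquiv h a)) :
    (fun i j => τ (y i j)) = fun i => y (h.1 i) :=
  funext fun i => funext fun j => galois_smul_coords L.galEquiv hy τ hh i j

theorem ne_zero (hv : v ≠ 0) (i : Fin n) : y i ≠ 0 := coords_ne_zero L.galEquiv hy hv i

theorem exists_isLift [CharZero K] (Q : PermQuotients K m n) (hv : v ≠ 0) : ∃ x : RatPoint (Q.quot G), IsLift Q G x y := by
  refine exists_isLift_of_galois Q G (hy.ne_zero hv) fun τ => ?_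
  obtain ⟨h, hh⟩ := exists_restrict L.galEquiv (ι := ι) τ
  refine ⟨h.1, h.2, ?_⟩
  rw [hy.galois_apply hh]
  exact SamePoint.refl _

/-- Every `h` in `G` is realized by a Galois element. Applying it to the relation "σ fixes y" gives
the same relation for h σ h⁻¹. -/
theorem normal_pointFixer : (pointFixer G y).Normal := by
  refine ⟨fun σ (hσ : SamePoint y _) h => ?_⟩
  obtain ⟨τ, hτ⟩ := exists_extend ι h
  have h1 : SamePoint (fun i j => τ (y i j)) (fun i j => τ (y (σ.1 i) j)) := hσ.map (τ : AlgebraicClosure K →+* AlgebraicClosure K)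
  have h2 := hy.galois_apply hτ
  have h3 : (fun i j => τ (y (σ.1 i) j)) = fun i => y (h.1 (σ.1 i)) := funext fun i => congrFun h2 (σ.1 i)
  rw [h2, h3] at h1
  have h4 := h1.perm (h⁻¹ : G).1
  have h5 : (fun i => y (h.1 ((h⁻¹ : G).1 i))) = y := funext fun i => congrArg y (smul_inv_smul h i)
  rw [h5] at h4
  exact h4

omit hy in
/-- An original point has trivial stabilizer in `G`. -/
theorem eq_one_of_samePoint {v : Fin (m + 1) → L.fixed (MulAction.stabilizer G i₀)} (hv : v ≠ 0) (hy : IsCoords L ι i₀ (fun j => (v j : L.carrier)) y)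
    (horig : Projectivization.mk _ v hv ∈ L.origPoints (MulAction.stabilizer G i₀) m) {σ : Equiv.Perm (Fin n)} (hσ : σ ∈ G)
    (hs : SamePoint y (fun i => y (σ i))) : σ = 1 := by
  by_contra hne
  obtain ⟨j₀, hj₀⟩ := Function.ne_iff.mp hv
  have hj₀ : v j₀ ≠ 0 := hj₀
  -- With one coordinate equal to 1, an element that preserves the point up to scaling fixes all
  -- coordinates. So `v'` lies in the fixed field of the stabilizer joined with the normal subgroup
  -- `pointFixer G y`, and originality forces that subgroup to be trivial.
  let v' : Fin (m + 1) → L.fixed (MulAction.stabilizer G i₀) := (v j₀)⁻¹ • v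
  have hv' : v' ≠ 0 := smul_ne_zero (inv_ne_zero hj₀) hv
  refine horig (pointFixer G y) hy.normal_pointFixer (fun h => hne ?_) ⟨v', hv', fun j => ?_, ?_⟩
  · have h1 : (⟨σ, hσ⟩ : G) ∈ (pointFixer G y) := hs
    rw [h, Subgroup.mem_bot] at h1
    exact congrArg Subtype.val h1
  · have hle : MulAction.stabilizer G i₀ ⊔ (pointFixer G y) ≤ (MulAction.stabilizer Gal(L.carrier/K) (v' j : L.carrier)).comap L.galEquiv.toMonoidHom := by
      refine sup_le (fun g hg => ?_) fun g (hg : SamePoint y _) => ?_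
      · exact LargeGField.mem_fixed.mp (v' j).2 g hg
      · obtain ⟨c, hc, hi⟩ := hg i₀
        have h1 : ∀ j, L.galEquiv g (v j) = L.galEquiv g (v j₀) * (v j₀ : L.carrier)⁻¹ * v j := by
          intro j
          have e1 : ∀ j, ι (L.galEquiv g (v j)) = c * ι (v j) := fun j => by
            rw [← hy g j, ← hy.apply_base j]
            exact congrFun hi j
          have h0 : ι (v j₀ : L.carrier) ≠ 0 := (map_ne_zero ι).mpr fun h => hj₀ (Subtype.ext h)
          apply ι.injective
          rw [map_mul, map_mul, map_inv₀]
          change ι _ = ι _ * (ι _)⁻¹ * ι _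
          rw [e1, e1]
          field_simp
        have h0 : (v j₀ : L.carrier) ≠ 0 := fun h => hj₀ (Subtype.ext h)
        have h0' : L.galEquiv g (v j₀ : L.carrier) ≠ 0 := (map_ne_zero _).mpr h0
        change L.galEquiv g ((v j₀ : L.carrier)⁻¹ * v j) = (v j₀ : L.carrier)⁻¹ * v j
        rw [map_mul, map_inv₀, h1 j]
        field_simp
    exact LargeGField.mem_fixed.mpr fun g hg => hle hg
  · rw [Projectivization.mk_eq_mk_iff']
    exact ⟨(v j₀)⁻¹, rfl⟩

omit hy in
/-- A point with trivial stabilizer is original. -/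
theorem mk_mem_origPoints {v : Fin (m + 1) → L.fixed (MulAction.stabilizer G i₀)} (hv : v ≠ 0) (hy : IsCoords L ι i₀ (fun j => (v j : L.carrier)) y)
    (hfree : ∀ σ ∈ G, SamePoint y (fun i => y (σ i)) → σ = 1) : Projectivization.mk _ v hv ∈ L.origPoints (MulAction.stabilizer G i₀) m := by
  rintro N hN hne ⟨v', hv', hmem, heq⟩
  apply hne
  rw [Subgroup.eq_bot_iff_forall]
  intro σ hσ
  refine Subtype.ext (hfree σ.1 σ.2 fun i => ?_)
  obtain ⟨g, rfl⟩ := MulAction.exists_smul_eq G i₀ i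
  obtain ⟨a, ha⟩ := (Projectivization.mk_eq_mk_iff' _ _ _ _ _).mp heq
  have ha0 : a ≠ 0 := by
    rintro rfl
    exact hv' (by rw [← ha, zero_smul])
  have h1 : ∀ h : G, ∀ j, y (h • i₀) j = (ι (L.galEquiv h (a : L.carrier)))⁻¹ * ι (L.galEquiv h (v' j : L.carrier)) := by
    intro h j
    have h0 : ι (L.galEquiv h (a : L.carrier)) ≠ 0 := (map_ne_zero ι).mpr ((map_ne_zero _).mpr fun h => ha0 (Subtype.ext h))
    rw [hy, ← ha]
    change _ = _ * ι (L.galEquiv h ((a : L.carrier) * v j))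
    rw [map_mul, map_mul]
    field_simp
  -- Normality of `N` turns invariance of the component at `i₀` into invariance of all components,
  -- since σ g = g (g⁻¹ σ g).
  have h2 : g⁻¹ * σ * g ∈ N := by
    have := hN.conj_mem σ hσ g⁻¹
    rwa [inv_inv] at this
  have h3 : ∀ j, L.galEquiv (σ * g) (v' j : L.carrier) = L.galEquiv g (v' j) := by
    intro j
    have h4 := LargeGField.mem_fixed.mp (hmem j) _ (Subgroup.mem_sup_right h2)
    have h5 := congrArg (L.galEquiv g) h4
    rw [← AlgEquiv.mul_apply, ← map_mul] at h5
    rwa [show g * (g⁻¹ * σ * g) = σ * g by group] at h5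
  have hne : ∀ h : G, ι (L.galEquiv h (a : L.carrier)) ≠ 0 := fun h => (map_ne_zero ι).mpr ((map_ne_zero _).mpr fun h => ha0 (Subtype.ext h))
  refine ⟨(ι (L.galEquiv (σ * g) (a : L.carrier)))⁻¹ * ι (L.galEquiv g (a : L.carrier)), mul_ne_zero (inv_ne_zero (hne _)) (hne _), ?_⟩
  ext j
  change y (σ • g • i₀) j = _ * y (g • i₀) j
  rw [← mul_smul, h1, h1, h3]
  have := hne g
  field_simp

/-- If `x` came from a quotient by `H`, Galois would act on a lift y ∘ σ through `H`, whereas on `y`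
it realizes every h in `G`. As the stabilizer is trivial, the two actions can be compared: σ⁻¹ h σ
lies in `H` for all h, so H = G. -/
theorem mem_primPoints [CharZero K] {Q : PermQuotients K m n} {x : RatPoint (Q.quot G)} (hx : IsLift Q G x y)
    (hfree : ∀ σ ∈ G, SamePoint y (fun i => y (σ i)) → σ = 1) : x ∈ primPoints Q G := by
  refine ⟨hx.mem_unramifiedLocus hfree, ?_⟩
  rintro H hH ⟨z, rfl⟩
  obtain ⟨y', hy'⟩ := PermQuot.exists_isLift z
  obtain ⟨σ, hσ, hs⟩ := hx.exists_perm (hy'.desc hH.le)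
  refine hH.not_ge ?_
  have hconj : ∀ h ∈ G, σ⁻¹ * h * σ ∈ H := by
    intro h hh
    obtain ⟨τ, hτ⟩ := exists_extend ι (⟨h, hh⟩ : G)
    obtain ⟨r, hr, hrs⟩ := hy'.exists_perm (hy'.map (τ : AlgebraicClosure K →ₐ[K] AlgebraicClosure K))
    have h1 : SamePoint (fun i j => τ (y (σ i) j)) (fun i j => τ (y' i j)) := hs.map (τ : AlgebraicClosure K →+* AlgebraicClosure K)
    have h2 : (fun i j => τ (y (σ i) j)) = fun i => y (h (σ i)) := funext fun i => congrFun (hy.galois_apply hτ) (σ i)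
    rw [h2] at h1
    have h3 : SamePoint (fun i => y (σ (r i))) (fun i => y (h (σ i))) := ((hs.perm r).trans hrs).trans h1.symm
    have h4 := h3.perm (r⁻¹ * σ⁻¹ : Equiv.Perm (Fin n))
    have h5 := hfree (h * σ * (r⁻¹ * σ⁻¹)) (mul_mem (mul_mem hh hσ) (mul_mem (inv_mem (hH.le hr)) (inv_mem hσ))) (by
      have e1 : (fun i => y (σ (r ((r⁻¹ * σ⁻¹ : Equiv.Perm (Fin n)) i)))) = y := by
        funext i; simp [Equiv.Perm.mul_apply]
      rw [e1] at h4
      exact h4)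
    have h6 : σ⁻¹ * h * σ = r := by
      have : h = σ * r * σ⁻¹ := by
        rw [← mul_inv_eq_one, ← h5]; group
      rw [this]; group
    rwa [h6]
  intro h hh
  have h1 := hconj (σ * h * σ⁻¹) (mul_mem (mul_mem hσ hh) (inv_mem hσ))
  rwa [show σ⁻¹ * (σ * h * σ⁻¹) * σ = h by group] at h1

end IsCoords

end PermQuot
end

/-! ### From primitive points to large G-fields. -/

noncomputable section

namespace PermQuot

variable {K : Type u} [Field K] {m n : ℕ} {G : Subgroup (Equiv.Perm (Fin n))}

theorem eq_of_samePoint_perm {F : Type*} [Field F] {y : Fin n → Fin (m + 1) → F} (hfree : ∀ σ ∈ G, SamePoint y (fun i => y (σ i)) → σ = 1) {σ σ' : Equiv.Perm (Fin n)}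
    (hσ : σ ∈ G) (hσ' : σ' ∈ G) (h : SamePoint (fun i => y (σ i)) (fun i => y (σ' i))) : σ = σ' := by
  have h1 := h.perm (σ⁻¹ : Equiv.Perm (Fin n))
  have e1 : (fun i => y (σ ((σ⁻¹ : Equiv.Perm (Fin n)) i))) = y := by
    funext i; simp
  rw [e1] at h1
  exact (mul_inv_eq_one.mp (hfree (σ' * σ⁻¹) (mul_mem hσ' (inv_mem hσ)) h1)).symm

section Hom

variable {Q : PermQuotients K m n} {x : RatPoint (Q.quot G)} {y : Fin n → Fin (m + 1) → AlgebraicClosure K}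

theorem IsLift.free (hm : m ≠ 0) (hx : x ∈ primPoints Q G) (hy : IsLift Q G x y) : ∀ σ ∈ G, SamePoint y (fun i => y (σ i)) → σ = 1 :=
  fun _ hσ hs => hy.eq_one_of_mem_unramifiedLocus hm hx.1 hσ hs

/-- The Galois group acts on the coordinates of a lift of a primitive point through a surjection onto `G`. -/
theorem IsLift.exists_galois_hom [CharZero K] (hm : m ≠ 0) (hx : x ∈ primPoints Q G) (hy : IsLift Q G x y) :
    ∃ ρ : Gal(AlgebraicClosure K/K) →* G, Function.Surjective ρ ∧ ∀ τ, SamePoint (fun i => y ((ρ τ).1 i)) (fun i j => τ (y i j)) := by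
  have hfree := hy.free hm hx
  choose r hr hrs using fun τ : Gal(AlgebraicClosure K/K) => hy.exists_perm (hy.map (τ : AlgebraicClosure K →ₐ[K] AlgebraicClosure K))
  -- Freeness makes the permutation attached to a Galois element unique, hence multiplicative.
  have hmul : ∀ τ τ', r (τ * τ') = r τ * r τ' := by
    intro τ τ'
    refine eq_of_samePoint_perm hfree (hr _) (mul_mem (hr _) (hr _)) ?_
    have h1 : SamePoint (fun i j => τ (y (r τ' i) j)) (fun i j => τ (τ' (y i j))) := (hrs τ').map (τ : AlgebraicClosure K →+* AlgebraicClosure K)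
    exact ((hrs (τ * τ')).trans h1.symm).trans ((hrs τ).perm (r τ')).symm
  let ρ : Gal(AlgebraicClosure K/K) →* G := MonoidHom.mk' (fun τ => ⟨r τ, hr τ⟩) fun τ τ' => Subtype.ext (hmul τ τ')
  refine ⟨ρ, ?_, hrs⟩
  by_contra hsurj
  -- If the image were a proper subgroup, `y` would descend to a rational point of the quotient by
  -- it, against primitivity.
  let H := ρ.range.map G.subtype
  have hHle : H ≤ G := by
    rintro _ ⟨g, -, rfl⟩
    exact g.2
  have hH : H < G := by
    refine lt_of_le_of_ne hHle fun h => hsurj fun g => ?_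
    have hg : g.1 ∈ H := h.symm ▸ g.2
    obtain ⟨g', ⟨τ, hτ⟩, hg'⟩ := hg
    exact ⟨τ, hτ.trans (Subtype.ext hg')⟩
  obtain ⟨z, hz⟩ := exists_isLift_of_galois Q H hy.ne_zero fun τ => ⟨r τ, ⟨ρ τ, ⟨τ, rfl⟩, rfl⟩, hrs τ⟩
  exact hx.2 H hH ⟨z, (hz.desc hH.le).unique hy⟩

end Hom

theorem exists_mulEquiv_of_ker_eq {Γ A B : Type*} [Group Γ] [Group A] [Group B] (ρ : Γ →* A) (hρ : Function.Surjective ρ) (r : Γ →* B) (hr : Function.Surjective r)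
    (h : ρ.ker = r.ker) : ∃ e : A ≃* B, ∀ τ, e (ρ τ) = r τ := by
  refine ⟨(QuotientGroup.quotientKerEquivOfSurjective ρ hρ).symm.trans ((QuotientGroup.quotientMulEquivOfEq h).trans (QuotientGroup.quotientKerEquivOfSurjective r hr)), fun τ => ?_⟩
  have h1 : (QuotientGroup.quotientKerEquivOfSurjective ρ hρ).symm (ρ τ) = (τ : Γ ⧸ ρ.ker) := by
    rw [MulEquiv.symm_apply_eq]; rfl
  rw [MulEquiv.trans_apply, h1]
  rfl

/-- A Galois-stable family of elements of the algebraic closure on which the Galois group acts freely through `G` gives a large `G`-field. -/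
theorem exists_largeGField [CharZero K] {y : Fin n → Fin (m + 1) → AlgebraicClosure K} (ρ : Gal(AlgebraicClosure K/K) →* G) (hρ : Function.Surjective ρ)
    (h : ∀ τ i j, τ (y i j) = y ((ρ τ).1 i) j) (hfree : ∀ σ ∈ G, (∀ i, y (σ i) = y i) → σ = 1) (i₀ : Fin n) :
    ∃ (L : LargeGField K G) (ι : L.carrier →ₐ[K] AlgebraicClosure K) (v : Fin (m + 1) → L.carrier), IsCoords L ι i₀ v y := by
  let S : Set (AlgebraicClosure K) := Set.range fun p : Fin n × Fin (m + 1) => y p.1 p.2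
  let L : IntermediateField K (AlgebraicClosure K) := IntermediateField.adjoin K S
  have hyL : ∀ i j, y i j ∈ L := fun i j => IntermediateField.subset_adjoin K S ⟨(i, j), rfl⟩
  have : FiniteDimensional K L := by
    have : Finite S := Set.finite_range _
    exact IntermediateField.finiteDimensional_adjoin fun x _ => Algebra.IsIntegral.isIntegral x
  have hnK : Normal K (AlgebraicClosure K) := IsAlgClosure.normal K _
  have : Normal K L := by
    rw [IntermediateField.normal_iff_forall_map_le']
    intro τ
    rw [IntermediateField.adjoin_map, IntermediateField.adjoin_le_iff]
    rintro _ ⟨_, ⟨⟨i, j⟩, rfl⟩, rfl⟩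
    change τ (y i j) ∈ L
    rw [h]
    exact hyL _ _
  have : IsGalois K L := { }
  let r : Gal(AlgebraicClosure K/K) →* Gal(L/K) := AlgEquiv.restrictNormalHom L
  have hrv : ∀ τ (a : L), ((r τ a : L) : AlgebraicClosure K) = τ a := fun τ a => AlgEquiv.restrictNormal_commutes τ L a
  -- The kernel of ρ fixes the generators of `L`; conversely, a Galois element trivial on `L` acts
  -- trivially on `y`, and freeness applies.
  have hker : ρ.ker = r.ker := by
    ext τ
    rw [MonoidHom.mem_ker, MonoidHom.mem_ker]
    constructor
    · intro hτ
      have hfix : ∀ a ∈ L, τ a = a := by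
        intro a ha
        induction ha using IntermediateField.adjoin_induction with
        | mem x hx =>
          obtain ⟨⟨i, j⟩, rfl⟩ := hx
          change τ (y i j) = y i j
          rw [h, hτ]; rfl
        | algebraMap x => exact τ.commutes x
        | add x y _ _ hx hy => rw [map_add, hx, hy]
        | inv x _ hx => rw [map_inv₀, hx]
        | mul x y _ _ hx hy => rw [map_mul, hx, hy]
      exact AlgEquiv.ext fun a => Subtype.ext ((hrv τ a).trans (hfix a a.2))
    · intro hτ
      refine Subtype.ext (hfree _ (ρ τ).2 fun i => funext fun j => ?_)
      rw [← h]
      have h1 := hrv τ ⟨y i j, hyL i j⟩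
      rw [hτ] at h1
      exact h1.symm
  obtain ⟨e, he⟩ := exists_mulEquiv_of_ker_eq ρ hρ r (AlgEquiv.restrictNormalHom_surjective _) hker
  refine ⟨{ carrier := L, galEquiv := e }, L.val, fun j => ⟨y i₀ j, hyL i₀ j⟩, fun g j => ?_⟩
  obtain ⟨τ, rfl⟩ := hρ g
  change _ = ((e (ρ τ) ⟨y i₀ j, hyL i₀ j⟩ : L) : AlgebraicClosure K)
  rw [he, hrv]
  exact (h τ i₀ j).symm

/-- Galois is transitive on the indices, so a coordinate `j₀` nonzero in one component is nonzero in
all. Dividing by it turns the relations up to scaling into equalities τ(y_i) = y_{ρ(τ) i}, as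
required by `exists_largeGField`. -/
theorem exists_isCoords_of_mem_primPoints [CharZero K] [hG : MulAction.IsPretransitive G (Fin n)] {Q : PermQuotients K m n} (hm : m ≠ 0) {x : RatPoint (Q.quot G)} (hx : x ∈ primPoints Q G) (i₀ : Fin n) :
    ∃ (L : LargeGField K G) (ι : L.carrier →ₐ[K] AlgebraicClosure K) (v : Fin (m + 1) → L.carrier) (y : _), v ≠ 0 ∧ IsCoords L ι i₀ v y ∧ IsLift Q G x y := by
  obtain ⟨y₀, hy₀⟩ := PermQuot.exists_isLift x
  obtain ⟨ρ, hρ, hs⟩ := hy₀.exists_galois_hom hm hx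
  have hfree := hy₀.free hm hx
  obtain ⟨j₀, hj₀⟩ := Function.ne_iff.mp (hy₀.ne_zero i₀)
  have hj₀ : y₀ i₀ j₀ ≠ 0 := hj₀
  have hne : ∀ i, y₀ i j₀ ≠ 0 := by
    intro i
    obtain ⟨g, rfl⟩ := MulAction.exists_smul_eq G i₀ i
    obtain ⟨τ, rfl⟩ := hρ g
    obtain ⟨c, hc, hi⟩ := hs τ i₀
    have h1 : τ (y₀ i₀ j₀) = c * y₀ ((ρ τ).1 i₀) j₀ := congrFun hi j₀
    have h2 : τ (y₀ i₀ j₀) ≠ 0 := (map_ne_zero τ).mpr hj₀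
    rw [h1] at h2
    exact right_ne_zero_of_mul h2
  let y : Fin n → Fin (m + 1) → AlgebraicClosure K := fun i => (y₀ i j₀)⁻¹ • y₀ i
  have hsy : SamePoint y₀ y := fun i => ⟨_, inv_ne_zero (hne i), rfl⟩
  have hτ : ∀ τ i j, τ (y i j) = y ((ρ τ).1 i) j := by
    intro τ i j
    obtain ⟨c, hc, hi⟩ := hs τ i
    have h1 : ∀ j, τ (y₀ i j) = c * y₀ ((ρ τ).1 i) j := fun j => congrFun hi j
    change τ ((y₀ i j₀)⁻¹ * y₀ i j) = (y₀ ((ρ τ).1 i) j₀)⁻¹ * y₀ ((ρ τ).1 i) j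
    rw [map_mul, map_inv₀, h1, h1]
    have := hne ((ρ τ).1 i)
    field_simp
  obtain ⟨L, ι, v, hv⟩ := exists_largeGField ρ hρ hτ (fun σ hσ h => hfree σ hσ (by
    have h1 : (fun i => y (σ i)) = y := funext h
    have h2 := (hsy.perm σ).symm
    rw [h1] at h2
    exact hsy.trans h2)) i₀
  refine ⟨L, ι, v, y, ?_, hv, hy₀.samePoint hsy⟩
  rintro rfl
  refine hsy.ne_zero hy₀.ne_zero i₀ (funext fun j => ?_)
  rw [hv.apply_base]
  exact map_zero ι

end PermQuot
end

/-! ### Original points over the same rational point: isomorphism and the center. -/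

noncomputable section

namespace PermQuot

theorem exists_galois_comp_eq {K E : Type*} [Field K] [Field E] [Algebra K E] [Algebra.IsAlgebraic K E] (ι ι' : E →ₐ[K] AlgebraicClosure K) :
    ∃ τ : Gal(AlgebraicClosure K/K), ∀ a, τ (ι a) = ι' a := by
  have hint : (ι : E →+* AlgebraicClosure K).IsIntegral := by
    refine RingHom.IsIntegral.tower_top (algebraMap K E) _ ?_
    rw [ι.comp_algebraMap]
    exact algebraMap_isIntegral_iff.mpr inferInstance
  obtain ⟨φ, hφ⟩ := RingHom.exists_extension_of_isIntegral (ι : E →+* AlgebraicClosure K) ι.injective hint (ι' : E →+* AlgebraicClosure K) ι'.injective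
  have hφ' : ∀ a, φ (ι a) = ι' a := fun a => DFunLike.congr_fun hφ a
  let ψ : AlgebraicClosure K →ₐ[K] AlgebraicClosure K :=
    { toRingHom := φ
      commutes' := fun r => by
        exact (congrArg φ (ι.commutes r).symm).trans ((hφ' _).trans (ι'.commutes r)) }
  exact ⟨AlgEquiv.ofBijective ψ (Algebra.IsAlgebraic.algHom_bijective ψ), hφ'⟩

variable {K : Type u} [Field K] {m n : ℕ} {G : Subgroup (Equiv.Perm (Fin n))}

section Pair

variable [hG : MulAction.IsPretransitive G (Fin n)] {L L' : LargeGField K G} {ι : L.carrier →ₐ[K] AlgebraicClosure K} {ι' : L'.carrier →ₐ[K] AlgebraicClosure K} {i₀ : Fin n}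
  {v : Fin (m + 1) → L.carrier} {v' : Fin (m + 1) → L'.carrier} {y y' : Fin n → Fin (m + 1) → AlgebraicClosure K}

omit hG in
theorem IsCoords.transport (hy : IsCoords L ι i₀ v y) (ι' : L'.carrier →ₐ[K] AlgebraicClosure K) (φ : L.carrier ≃ₐ[K] L'.carrier)
    (hφ : ∀ (g : G) a, φ (L.galEquiv g a) = L'.galEquiv g (φ a)) :
    ∃ τ : Gal(AlgebraicClosure K/K), IsCoords L' ι' i₀ (fun j => φ (v j)) (fun i j => τ (y i j)) := by
  obtain ⟨τ, hτ⟩ := exists_galois_comp_eq ι (ι'.comp φ.toAlgHom)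
  refine ⟨τ, fun g j => ?_⟩
  change τ (y (g • i₀) j) = _
  rw [hy, hτ]
  exact congrArg ι' (hφ g _)

variable (hy : IsCoords L ι i₀ v y) (hy' : IsCoords L' ι' i₀ v' y') (hfree : ∀ σ ∈ G, SamePoint y (fun i => y (σ i)) → σ = 1)
  {σ : G} (hσ : SamePoint (fun i => y (σ.1 i)) y')

include hy hy' hfree hσ

/-- Apply τ to y ∘ σ ~ y' and use freeness. This one relation identifies the two fields, makes the
identification equivariant, and for equal embedded G-fields shows that σ is central. -/
theorem mul_eq_mul_of_samePoint {τ : Gal(AlgebraicClosure K/K)} {h h' : G} (hh : ∀ a, τ (ι a) = ι (L.galEquiv h a)) (hh' : ∀ a, τ (ι' a) = ι' (L'.galEquiv h' a)) :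
    h * σ = σ * h' := by
  have h1 : SamePoint (fun i j => τ (y (σ.1 i) j)) (fun i j => τ (y' i j)) := hσ.map (τ : AlgebraicClosure K →+* AlgebraicClosure K)
  have h2 : (fun i j => τ (y (σ.1 i) j)) = fun i => y (h.1 (σ.1 i)) := funext fun i => congrFun (hy.galois_apply hh) (σ.1 i)
  rw [h2, hy'.galois_apply hh'] at h1
  exact Subtype.ext (eq_of_samePoint_perm hfree (h * σ).2 (σ * h').2 (h1.trans (hσ.perm h'.1).symm))

theorem largeGField_equiv_of_samePoint [CharZero K] : L ≈ L' := by
  -- A Galois element trivial on the image of `L'` has h' = 1, hence h = 1, so it is trivial on the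
  -- image of `L`.
  have hfix : ∀ a, ι a ∈ ι'.range := by
    intro a
    let _ := ι'.toRingHom.toAlgebra
    have : IsScalarTower K L'.carrier (AlgebraicClosure K) := IsScalarTower.of_algebraMap_eq' ι'.comp_algebraMap.symm
    have : CharZero L'.carrier := charZero_of_injective_algebraMap (algebraMap K L'.carrier).injective
    have : Algebra.IsAlgebraic L'.carrier (AlgebraicClosure K) := Algebra.IsAlgebraic.tower_top (K := K) L'.carrier
    have : Normal L'.carrier (AlgebraicClosure K) := Normal.tower_top_of_normal K _ _
    have : IsGalois L'.carrier (AlgebraicClosure K) := { }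
    refine (InfiniteGalois.mem_range_algebraMap_iff_fixed (k := L'.carrier) (ι a)).mpr fun τ' => ?_
    let τ : Gal(AlgebraicClosure K/K) := τ'.restrictScalars K
    obtain ⟨h, hh⟩ := exists_restrict L.galEquiv (ι := ι) τ
    have h1 := mul_eq_mul_of_samePoint hy hy' hfree hσ hh (h' := 1) fun b => by
      rw [map_one]; exact τ'.commutes b
    have h2 : h = 1 := by rwa [mul_one, mul_eq_right] at h1
    have h3 := hh a
    rw [h2, map_one] at h3
    exact h3
  let ψ : L.carrier →ₐ[K] L'.carrier := (AlgEquiv.ofInjective ι' ι'.injective).symm.toAlgHom.comp (ι.codRestrict ι'.range hfix)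
  have hψ : ∀ a, ι' (ψ a) = ι a := fun a =>
    congrArg Subtype.val ((AlgEquiv.ofInjective ι' ι'.injective).apply_symm_apply (ι.codRestrict ι'.range hfix a))
  have hcard : Module.finrank K L.carrier = Module.finrank K L'.carrier := by
    rw [← IsGalois.card_aut_eq_finrank, ← IsGalois.card_aut_eq_finrank]
    exact Nat.card_congr (L.galEquiv.symm.trans L'.galEquiv).toEquiv
  have hbij : Function.Bijective ψ :=
    ⟨ψ.injective, (LinearMap.injective_iff_surjective_of_finrank_eq_finrank (f := ψ.toLinearMap) hcard).mp ψ.injective⟩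
  -- The map ψ intertwines g with σ⁻¹ g σ; composing with the action of σ makes it equivariant.
  refine ⟨(AlgEquiv.ofBijective ψ hbij).trans (L'.galEquiv σ), fun g a => ?_⟩
  obtain ⟨τ, hτ⟩ := exists_extend ι g
  obtain ⟨h', hh'⟩ := exists_restrict L'.galEquiv (ι := ι') τ
  have h1 := mul_eq_mul_of_samePoint hy hy' hfree hσ hτ hh'
  have h2 : ψ (L.galEquiv g a) = L'.galEquiv h' (ψ a) := ι'.injective (by
    change ι' _ = ι' _
    rw [hψ, ← hh', hψ, hτ])
  change L'.galEquiv σ (ψ (L.galEquiv g a)) = L'.galEquiv g (L'.galEquiv σ (ψ a))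
  rw [h2, ← AlgEquiv.mul_apply, ← AlgEquiv.mul_apply, ← map_mul, ← map_mul, h1]

end Pair

section Center

variable [hG : MulAction.IsPretransitive G (Fin n)] {L : LargeGField K G} {ι : L.carrier →ₐ[K] AlgebraicClosure K} {i₀ : Fin n}

theorem mem_center_of_samePoint {v v' : Fin (m + 1) → L.carrier} {y y' : Fin n → Fin (m + 1) → AlgebraicClosure K}
    (hy : IsCoords L ι i₀ v y) (hy' : IsCoords L ι i₀ v' y') (hfree : ∀ σ ∈ G, SamePoint y (fun i => y (σ i)) → σ = 1)
    {σ : G} (hσ : SamePoint (fun i => y (σ.1 i)) y') : σ ∈ Subgroup.center G := by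
  refine Subgroup.mem_center_iff.mpr fun h => ?_
  obtain ⟨τ, hτ⟩ := exists_extend ι h
  exact mul_eq_mul_of_samePoint hy hy' hfree hσ hτ hτ

/-- The action of a central element of `G` on a fixed field. -/
def centerMap (L : LargeGField K G) (S : Subgroup G) (z : Subgroup.center G) : L.fixed S →+* L.fixed S where
  toFun a := ⟨L.galEquiv z a, LargeGField.mem_fixed.mpr fun g hg => by
    rw [← AlgEquiv.mul_apply, ← map_mul, Subgroup.mem_center_iff.mp z.2 g, map_mul, AlgEquiv.mul_apply, LargeGField.mem_fixed.mp a.2 g hg]⟩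
  map_one' := Subtype.ext (map_one _)
  map_zero' := Subtype.ext (map_zero _)
  map_add' _ _ := Subtype.ext (map_add _ _ _)
  map_mul' _ _ := Subtype.ext (map_mul _ _ _)

omit hG in
theorem centerMap_ne_zero {S : Subgroup G} (z : Subgroup.center G) {v : Fin (m + 1) → L.fixed S} (hv : v ≠ 0) :
    (fun j => centerMap L S z (v j)) ≠ 0 := by
  obtain ⟨j, hj⟩ := Function.ne_iff.mp hv
  exact Function.ne_iff.mpr ⟨j, (map_ne_zero _).mpr hj⟩

/-- The action of a central element of `G` on the projective space over a fixed field. -/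
def centerAct (L : LargeGField K G) (S : Subgroup G) (z : Subgroup.center G) (p : Projectivization (L.fixed S) (Fin (m + 1) → L.fixed S)) :
    Projectivization (L.fixed S) (Fin (m + 1) → L.fixed S) :=
  Projectivization.mk _ (fun j => centerMap L S z (p.rep j)) (centerMap_ne_zero z p.rep_nonzero)

omit hG in
theorem centerAct_mk {S : Subgroup G} (z : Subgroup.center G) {v : Fin (m + 1) → L.fixed S} (hv : v ≠ 0) :
    centerAct L S z (Projectivization.mk _ v hv) = Projectivization.mk _ (fun j => centerMap L S z (v j)) (centerMap_ne_zero z hv) := by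
  obtain ⟨a, ha⟩ := Projectivization.exists_smul_eq_mk_rep (L.fixed S) v hv
  rw [centerAct, Projectivization.mk_eq_mk_iff']
  refine ⟨centerMap L S z a, funext fun j => ?_⟩
  rw [← ha]
  exact (map_mul (centerMap L S z) _ _).symm

omit hG in
theorem IsCoords.centerMap {v : Fin (m + 1) → L.fixed (MulAction.stabilizer G i₀)} {y : Fin n → Fin (m + 1) → AlgebraicClosure K}
    (hy : IsCoords L ι i₀ (fun j => (v j : L.carrier)) y) (z : Subgroup.center G) :
    IsCoords L ι i₀ (fun j => (PermQuot.centerMap L _ z (v j) : L.carrier)) (fun i => y (z.1.1 i)) := by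
  intro g j
  change y (z.1 • g • i₀) j = ι (L.galEquiv g (L.galEquiv z.1 (v j)))
  rw [← mul_smul, hy, ← AlgEquiv.mul_apply, ← map_mul, Subgroup.mem_center_iff.mp z.2 g]

/-- A scalar identifying two central translates has conjugates that identify the translated tuples
in every component, so freeness applies. -/
theorem IsCoords.eq_one_of_centerAct_eq {v : Fin (m + 1) → L.fixed (MulAction.stabilizer G i₀)} (hv : v ≠ 0) {y : Fin n → Fin (m + 1) → AlgebraicClosure K}
    (hy : IsCoords L ι i₀ (fun j => (v j : L.carrier)) y) (hfree : ∀ σ ∈ G, SamePoint y (fun i => y (σ i)) → σ = 1) {z : Subgroup.center G} {z' : Subgroup.center G}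
    (h : centerAct L _ z (Projectivization.mk _ v hv) = centerAct L _ z' (Projectivization.mk _ v hv)) : z = z' := by
  rw [centerAct_mk, centerAct_mk, Projectivization.mk_eq_mk_iff'] at h
  obtain ⟨a, ha⟩ := h
  have ha0 : a ≠ 0 := by
    rintro rfl
    exact centerMap_ne_zero z hv (by rw [← ha, zero_smul])
  refine Subtype.ext (Subtype.ext (eq_of_samePoint_perm hfree z'.1.2 z.1.2 fun i => ?_).symm)
  obtain ⟨g, rfl⟩ := MulAction.exists_smul_eq G i₀ i
  have h1 : ι (L.galEquiv g (a : L.carrier)) ≠ 0 := (map_ne_zero ι).mpr ((map_ne_zero _).mpr fun h => ha0 (Subtype.ext h))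
  refine ⟨ι (L.galEquiv g (a : L.carrier)), h1, funext fun j => ?_⟩
  have h2 := hy.centerMap z g j
  have h3 := hy.centerMap z' g j
  have h4 : (PermQuot.centerMap L _ z (v j) : L.carrier) = a * (PermQuot.centerMap L _ z' (v j) : L.carrier) :=
    (congrArg Subtype.val (congrFun ha j)).symm
  refine h2.trans ((congrArg (fun t => ι (L.galEquiv g t)) h4).trans ?_)
  rw [map_mul, map_mul]
  exact congrArg _ h3.symm

omit hG in
theorem IsCoords.mk_eq_centerAct {v v' : Fin (m + 1) → L.fixed (MulAction.stabilizer G i₀)} (hv : v ≠ 0) (hv' : v' ≠ 0) {y y' : Fin n → Fin (m + 1) → AlgebraicClosure K}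
    (hy : IsCoords L ι i₀ (fun j => (v j : L.carrier)) y) (hy' : IsCoords L ι i₀ (fun j => (v' j : L.carrier)) y') (z : Subgroup.center G)
    (h : SamePoint (fun i => y (z.1.1 i)) y') : Projectivization.mk _ v' hv' = centerAct L _ z (Projectivization.mk _ v hv) := by
  rw [centerAct_mk, Projectivization.mk_eq_mk_iff']
  obtain ⟨c, hc, hi⟩ := h i₀
  have hz := hy.centerMap z
  have h1 : ∀ j, ι (v' j : L.carrier) = c * ι (PermQuot.centerMap L _ z (v j) : L.carrier) := fun j => by
    rw [← hy'.apply_base, ← hz.apply_base]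
    exact congrFun hi j
  obtain ⟨j₀, hj₀⟩ := Function.ne_iff.mp (centerMap_ne_zero z hv)
  have hj₀ : PermQuot.centerMap L _ z (v j₀) ≠ 0 := hj₀
  have hj₁ : (PermQuot.centerMap L _ z (v j₀) : L.carrier) ≠ 0 := fun h => hj₀ (Subtype.ext h)
  have hj₂ : ι (PermQuot.centerMap L _ z (v j₀) : L.carrier) ≠ 0 := (map_ne_zero ι).mpr hj₁
  refine ⟨v' j₀ / PermQuot.centerMap L _ z (v j₀), funext fun j => Subtype.ext (ι.injective ?_)⟩
  change ι ((v' j₀ : L.carrier) / (PermQuot.centerMap L _ z (v j₀) : L.carrier) * (PermQuot.centerMap L _ z (v j) : L.carrier)) = ι (v' j)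
  rw [map_mul, map_div₀, h1, h1]
  field_simp

end Center

end PermQuot
end

/-! ### The bijection with original points and the height zeta functions. -/

noncomputable section

namespace PermQuot

/-- A series over a total space that is pulled back along a bijection from a series over a base with
finite constant fibre. -/
theorem summable_sigma_and_tsum_eq {α Z B : Type*} [Finite Z] {β : B → Type*} (e : α × Z ≃ Σ b, β b) {f : α → ℂ} {g : ∀ b, β b → ℂ}
    (hfg : ∀ p, g (e p).1 (e p).2 = f p.1) (hf : Summable fun a => ‖f a‖) :
    (∀ b, Summable fun t => ‖g b t‖) ∧ (Summable fun b => ‖∑' t, g b t‖) ∧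
      ∑' b, ∑' t, g b t = Nat.card Z * ∑' a, f a := by
  have := Fintype.ofFinite Z
  have h1 : Summable fun p : α × Z => ‖f p.1‖ := by
    have := hf.mul_of_nonneg (g := fun _ : Z => (1 : ℝ)) (Summable.of_finite) (fun _ => norm_nonneg _) (fun _ => zero_le_one)
    simpa using this
  have h2 : Summable fun s : Σ b, β b => ‖g s.1 s.2‖ := by
    rw [← e.summable_iff]
    exact h1.congr fun p => by rw [Function.comp_apply, hfg]
  obtain ⟨h3, h4⟩ := (summable_sigma_of_nonneg fun s : Σ b, β b => norm_nonneg (g s.1 s.2)).mp h2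
  refine ⟨h3, h4.of_nonneg_of_le (fun _ => norm_nonneg _) fun b => norm_tsum_le_tsum_norm (h3 b), ?_⟩
  have h5 : Summable fun s : Σ b, β b => g s.1 s.2 := h2.of_norm
  have h6 : Summable fun p : α × Z => f p.1 := h1.of_norm
  rw [← h5.tsum_sigma, ← e.tsum_eq]
  simp_rw [hfg]
  rw [h6.tsum_prod]
  simp_rw [tsum_fintype, Finset.sum_const, Finset.card_univ, nsmul_eq_mul]
  rw [tsum_mul_left, Nat.card_eq_fintype_card]

variable {K : Type u} [Field K] {m n : ℕ} {G : Subgroup (Equiv.Perm (Fin n))}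

/-- A chosen embedding of a large `G`-field in the algebraic closure. -/
def embed (L : LargeGField K G) : L.carrier →ₐ[K] AlgebraicClosure K := IsAlgClosed.lift

/-- The point `p` of projective space over the fixed field of a stabilizer gives, together with its conjugates,
a geometric point over `x`. -/
def LiesOver (Q : PermQuotients K m n) (L : LargeGField K G) (i₀ : Fin n)
    (p : Projectivization (L.fixed (MulAction.stabilizer G i₀)) (Fin (m + 1) → L.fixed (MulAction.stabilizer G i₀))) (x : RatPoint (Q.quot G)) : Prop :=
  ∃ (v : Fin (m + 1) → L.fixed (MulAction.stabilizer G i₀)) (hv : v ≠ 0) (y : _),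
    p = Projectivization.mk _ v hv ∧ IsCoords L (embed L) i₀ (fun j => (v j : L.carrier)) y ∧ IsLift Q G x y

section

variable [hG : MulAction.IsPretransitive G (Fin n)] {Q : PermQuotients K m n} {L : LargeGField K G} {i₀ : Fin n}
  {p : Projectivization (L.fixed (MulAction.stabilizer G i₀)) (Fin (m + 1) → L.fixed (MulAction.stabilizer G i₀))} {x x' : RatPoint (Q.quot G)}

theorem exists_liesOver [CharZero K] (hp : p ∈ L.origPoints (MulAction.stabilizer G i₀) m) : ∃ x ∈ primPoints Q G, LiesOver Q L i₀ p x := by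
  induction p using Projectivization.ind with
  | h v hv =>
    obtain ⟨y, hy⟩ := exists_isCoords (embed L) fun j => (v j).2
    obtain ⟨x, hx⟩ := hy.exists_isLift Q fun h => hv (funext fun j => Subtype.ext (congrFun h j))
    exact ⟨x, hy.mem_primPoints hx fun σ hσ hs => hy.eq_one_of_samePoint hv hp hσ hs, v, hv, y, rfl, hy, hx⟩

theorem LiesOver.unique (h : LiesOver Q L i₀ p x) (h' : LiesOver Q L i₀ p x') : x = x' := by
  obtain ⟨v, hv, y, rfl, hy, hx⟩ := h
  obtain ⟨v', hv', y', heq, hy', hx'⟩ := h'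
  obtain ⟨a, rfl⟩ := (Projectivization.mk_eq_mk_iff' _ _ _ _ _).mp heq
  have ha : a ≠ 0 := by
    rintro rfl
    exact hv (zero_smul _ _)
  refine hx.unique (hx'.samePoint fun i => ?_)
  obtain ⟨g, rfl⟩ := MulAction.exists_smul_eq G i₀ i
  refine ⟨embed L (L.galEquiv g (a : L.carrier)), (map_ne_zero _).mpr ((map_ne_zero _).mpr fun h => ha (Subtype.ext h)), funext fun j => ?_⟩
  change _ = _ * y' (g • i₀) j
  rw [hy, hy', ← map_mul, ← map_mul]
  rfl

/-- The field built from `x` is replaced by the chosen representative of its class with the chosen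
embedding. This changes the lift by a Galois element, and the result still lies over the rational
point `x`. -/
theorem exists_origPoints_liesOver [CharZero K] (hm : m ≠ 0) (hx : x ∈ primPoints Q G) (i₀ : Fin n) :
    ∃ (L : LargeGFieldClass K G) (p : L.out.origPoints (MulAction.stabilizer G i₀) m), LiesOver Q L.out i₀ p.1 x := by
  obtain ⟨L, ι, v, y, hv, hy, hlift⟩ := exists_isCoords_of_mem_primPoints hm hx i₀
  obtain ⟨φ, hφ⟩ : L ≈ (Quotient.mk (LargeGField.setoid K G) L).out := Setoid.symm (Quotient.mk_out L)
  obtain ⟨τ, hy'⟩ := hy.transport (embed _) φ hφ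
  have hlift' := hlift.map (τ : AlgebraicClosure K →ₐ[K] AlgebraicClosure K)
  have hmem : ∀ j, φ (v j) ∈ (Quotient.mk (LargeGField.setoid K G) L).out.fixed (MulAction.stabilizer G i₀) := fun j =>
    LargeGField.mem_fixed.mpr fun g hg => (embed _).injective (((hy' g j).symm.trans
      (congrArg (fun i => τ (y i j)) (MulAction.mem_stabilizer_iff.mp hg))).trans (hy'.apply_base j))
  obtain ⟨j₀, hj₀⟩ := Function.ne_iff.mp hv
  have hv' : (fun j => (⟨φ (v j), hmem j⟩ : (Quotient.mk (LargeGField.setoid K G) L).out.fixed (MulAction.stabilizer G i₀))) ≠ 0 :=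
    Function.ne_iff.mpr ⟨j₀, fun h => (map_ne_zero φ).mpr hj₀ (congrArg Subtype.val h)⟩
  exact ⟨Quotient.mk _ L, ⟨_, IsCoords.mk_mem_origPoints hv' hy' (hlift'.free hm hx)⟩, _, hv', _, rfl, hy', hlift'⟩

omit hG in
theorem LiesOver.centerAct (h : LiesOver Q L i₀ p x) (z : Subgroup.center G) : LiesOver Q L i₀ (centerAct L _ z p) x := by
  obtain ⟨v, hv, y, rfl, hy, hx⟩ := h
  exact ⟨_, centerMap_ne_zero z hv, _, centerAct_mk z hv, hy.centerMap z, hx.perm z.1.2⟩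

theorem LiesOver.mem_origPoints (hm : m ≠ 0) (hx : x ∈ primPoints Q G) (h : LiesOver Q L i₀ p x) :
    p ∈ L.origPoints (MulAction.stabilizer G i₀) m := by
  obtain ⟨v, hv, y, rfl, hy, hlift⟩ := h
  exact IsCoords.mk_mem_origPoints hv hy (hlift.free hm hx)

theorem LiesOver.centerAct_injective (hm : m ≠ 0) (hx : x ∈ primPoints Q G) (h : LiesOver Q L i₀ p x) :
    Function.Injective fun z => PermQuot.centerAct L _ z p := by
  obtain ⟨v, hv, y, rfl, hy, hlift⟩ := h
  exact fun z z' hz => hy.eq_one_of_centerAct_eq hv (hlift.free hm hx) hz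

theorem LiesOver.equiv [CharZero K] {L' : LargeGField K G} {p' : Projectivization (L'.fixed (MulAction.stabilizer G i₀)) (Fin (m + 1) → L'.fixed (MulAction.stabilizer G i₀))}
    (hm : m ≠ 0) (hx : x ∈ primPoints Q G) (h : LiesOver Q L i₀ p x) (h' : LiesOver Q L' i₀ p' x) : L ≈ L' := by
  obtain ⟨v, hv, y, rfl, hy, hlift⟩ := h
  obtain ⟨v', hv', y', rfl, hy', hlift'⟩ := h'
  obtain ⟨σ, hσ, hs⟩ := hlift.exists_perm hlift'
  exact largeGField_equiv_of_samePoint hy hy' (hlift.free hm hx) (σ := ⟨σ, hσ⟩) hs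

theorem LiesOver.exists_centerAct_eq [CharZero K] {p' : Projectivization (L.fixed (MulAction.stabilizer G i₀)) (Fin (m + 1) → L.fixed (MulAction.stabilizer G i₀))}
    (hm : m ≠ 0) (hx : x ∈ primPoints Q G) (h : LiesOver Q L i₀ p x) (h' : LiesOver Q L i₀ p' x) : ∃ z, PermQuot.centerAct L _ z p = p' := by
  obtain ⟨v, hv, y, rfl, hy, hlift⟩ := h
  obtain ⟨v', hv', y', rfl, hy', hlift'⟩ := h'
  obtain ⟨σ, hσ, hs⟩ := hlift.exists_perm hlift'
  have hz := mem_center_of_samePoint hy hy' (hlift.free hm hx) (σ := ⟨σ, hσ⟩) hs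
  exact ⟨⟨_, hz⟩, (hy.mk_eq_centerAct hv hv' hy' ⟨_, hz⟩ hs).symm⟩

theorem LiesOver.quotHeight_eq [NumberField K] (h : LiesOver Q L i₀ p x) : quotHeight Q G x = projHeight p := by
  obtain ⟨v, hv, y, rfl, hy, hlift⟩ := h
  have : NumberField L.carrier := NumberField.of_module_finite K _
  rw [projHeight, Projectivization.mulHeight_mk]
  exact PermQuot.quotHeight_eq L.galEquiv hv hy hlift

end

/-- Primitive points, together with central elements of `G`, parametrize the original points of all large `G`-fields. -/
theorem exists_primPoints_prod_center_equiv [CharZero K] [hG : MulAction.IsPretransitive G (Fin n)] (Q : PermQuotients K m n) (hm : m ≠ 0) (i₀ : Fin n) :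
    ∃ e : primPoints Q G × Subgroup.center G ≃ Σ L : LargeGFieldClass K G, L.out.origPoints (MulAction.stabilizer G i₀) m,
      ∀ t, LiesOver Q (e t).1.out i₀ (e t).2.1 t.1.1 := by
  choose L p hp using fun x : primPoints Q G => exists_origPoints_liesOver hm x.2 i₀
  let f : primPoints Q G × Subgroup.center G → Σ L : LargeGFieldClass K G, L.out.origPoints (MulAction.stabilizer G i₀) m :=
    fun t => ⟨L t.1, centerAct _ _ t.2 (p t.1).1, ((hp t.1).centerAct t.2).mem_origPoints hm t.1.2⟩
  have hf : ∀ t, LiesOver Q (f t).1.out i₀ (f t).2.1 t.1.1 := fun t => (hp t.1).centerAct t.2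
  have huniq : ∀ {s s' : Σ L : LargeGFieldClass K G, L.out.origPoints (MulAction.stabilizer G i₀) m} {x x' : RatPoint (Q.quot G)}, s = s' →
      LiesOver Q s.1.out i₀ s.2.1 x → LiesOver Q s'.1.out i₀ s'.2.1 x' → x = x' := by
    rintro s _ x x' rfl h h'
    exact h.unique h'
  refine ⟨Equiv.ofBijective f ⟨?_, ?_⟩, hf⟩
  · rintro ⟨x, z⟩ ⟨x', z'⟩ h
    obtain rfl : x = x' := Subtype.ext (huniq h (hf (x, z)) (hf (x', z')))
    have h2 := eq_of_heq (Sigma.mk.inj_iff.mp h).2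
    exact congrArg (Prod.mk x) ((hp x).centerAct_injective hm x.2 (congrArg Subtype.val h2))
  · rintro ⟨L', p'⟩
    obtain ⟨x, hx, hxp⟩ := exists_liesOver (Q := Q) p'.2
    -- Large G-fields carrying original points over the same `x` are isomorphic, so their classes
    -- agree; then only a central translation remains.
    obtain rfl : L ⟨x, hx⟩ = L' := Quotient.out_equiv_out.mp ((hp ⟨x, hx⟩).equiv hm hx hxp)
    obtain ⟨z, hz⟩ := (hp ⟨x, hx⟩).exists_centerAct_eq hm hx hxp
    exact ⟨(⟨x, hx⟩, z), congrArg (Sigma.mk _) (Subtype.ext hz)⟩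

end PermQuot
end

open PermQuot in
theorem mainTheorem1 {K : Type u} [Field K] [NumberField K] {n m : ℕ} (hn : 2 ≤ n)
    (G : Subgroup (Equiv.Perm (Fin n))) (hG : MulAction.IsPretransitive G (Fin n))
    (hm : 2 ≤ m * groupIndex G) (Q : PermQuotients K m n) (s : ℂ)
    (hs : ZetaSummable (primPoints Q G) (quotHeight Q G) s) :
    let G₁ : Subgroup G := MulAction.stabilizer G (⟨0, by omega⟩ : Fin n)
    (∀ L : LargeGFieldClass K G, ZetaSummable (L.out.origPoints G₁ m) projHeight s) ∧
    (Summable fun L : LargeGFieldClass K G =>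
      ‖heightZeta (L.out.origPoints G₁ m) projHeight s‖) ∧
    heightZeta (primPoints Q G) (quotHeight Q G) s =
      1 / (Nat.card (Subgroup.center G) : ℂ) *
        ∑' L : LargeGFieldClass K G, heightZeta (L.out.origPoints G₁ m) projHeight s := by
  -- For `m = 0` the product with the index would vanish.
  have hm0 : m ≠ 0 := by
    rintro rfl
    omega
  have := hG
  intro G₁
  obtain ⟨e, he⟩ := exists_primPoints_prod_center_equiv (G := G) Q hm0 (⟨0, by omega⟩ : Fin n)
  have hne : (Nat.card (Subgroup.center G) : ℂ) ≠ 0 := Nat.cast_ne_zero.mpr Nat.card_pos.ne'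
  -- Each primitive point contributes its term once for every element of the center, which is the
  -- source of the factor 1/#Z(G).
  obtain ⟨h1, h2, h3⟩ := summable_sigma_and_tsum_eq e (f := fun x => ((quotHeight Q G x : ℝ) : ℂ) ^ (-s))
    (g := fun _ p => ((projHeight p.1 : ℝ) : ℂ) ^ (-s)) (fun t => congrArg (fun r : ℝ => (r : ℂ) ^ (-s)) (he t).quotHeight_eq.symm) hs
  refine ⟨h1, h2, ?_⟩
  change _ = _ * ∑' b, ∑' t, _
  rw [h3, one_div, inv_mul_cancel_left₀ hne]
  rfl
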